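/- **Setting.** Let $n\ge 3$, and let $X\subset\mathbb R^n$ be convex and closed with nonempty interior, $x_0\in X$, $R<\infty$, $s\in\mathbb Z_{\ge0}$ and $\bar s\ge\max\{1,s\}$. Let $\mathcal S$ be the set of signals $x_*\in X$ with at most $s$ nonzero entries and $\|x_*-x_0\|_1\le R$. One observes $(\phi_i,\eta_i)$, $\eta_i=u(\phi_i^Tx_*)+\sigma\xi_i$, $i=1,2,\dots,N$, where $\sigma\ge 0$, the pairs $(\phi_i,\xi_i)\in\mathbb R^n\times\mathbb R$ are i.i.d., $\phi_i$ and $\xi_i$ are independent, $\mathbf E\|\phi_i\|_2^2<\infty$, $\Sigma=\mathbf E\{\phi_i\phi_i^T\}\succeq\kappa_\Sigma I$ with $\kappa_\Sigma>0$, $\max_{ij}|\Sigma_{ij}|\le\upsilon$, $\mathbf E\xi_i=0$, $\mathbf E\xi_i^2\le1$, and $\underline u(t-t')\le u(t)-u(t')\le\overline u(t-t')$ for all $t\ge t'$, with $0<\underline u\le\overline u$. Let $U(t)=\int_0^tu$, $g(x)=\mathbf E\{U(\phi^Tx)-\phi^Tx\,\eta\}$, $g_*=\min_Xg$ (these depend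 on $x_*$), $\|x\|_\Sigma=(x^T\Sigma x)^{1/2}$. Let $\varkappa,\varkappa'\ge1$, $\nu$ and $\varsigma_*\ge0$ be such that $\varsigma_*^2\le\nu\sigma^2$, $\|\nabla g(x)-\nabla g(x')\|_\infty\le\nu\|x-x'\|_1$ on $X$, and, for all $x_*\in\mathcal S$ and $x\in X$ (with finite expectations), $$\Big(\overline u\,\mathbf E\{\|\phi\|_\infty^2(\phi^T(x-x_*))^2\}^{1/2}+\overline u\,\upsilon^{1/2}\|x-x_*\|_\Sigma+\mathbf E\{\|\phi\|_\infty^2\}^{1/2}\sigma\Big)^2\le\varkappa\nu\,(g(x)-g_*)+\varkappa'\varsigma_*^2 .$$ **Algorithm (SMD-SR).** Put $\underline\kappa=\underline u\kappa_\Sigma$, $p=1+1/\ln n$, $\vartheta(x)=\frac12e\ln(n)\,n^{(p-1)(2-p)/p}\|x\|_p^2$, $\Theta=\frac12e^2\ln n$. For $y\in X$, $\beta>0$, $m\ge 1$ let $\widehat x_m(y,\beta)=\frac1m\sum_{i=1}^mx_i$ where $x_0:=y$ and $x_i=\operatorname{argmin}_{z\in X}\{\langle\phi_i(u(\phi_i^Tx_{i-1})-\eta_i),z\rangle+\beta[\vartheta(z-y)-\vartheta(x_{i-1}-y)-\langle\nabla\vartheta(x_{i-1}-y),z-x_{i-1}\rangle]\}$;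 each run uses $m$ fresh observations. Let $\mathrm{sparse}(x)$ be a (measurably chosen) $\|\cdot\|_2$-closest to $x$ point of $X$ with at most $s$ nonzero entries. Set $$m_0=\Big\lceil\tfrac{16\nu\bar s}{\underline u\kappa_\Sigma}(4e^2\varkappa\ln n+1)\Big\rceil,\quad \overline K=\max\Big\{1,\Big\lceil\log_2\tfrac{R^2\underline\kappa\nu\varkappa}{32\varsigma_*^2\bar s\varkappa'}\Big\rceil\Big\}\ (=\infty\text{ if }\varsigma_*=0),\quad m_k=\Big\lceil512\tfrac{\bar s\Theta\nu\varkappa}{\underline\kappa}2^k\Big\rceil\ (k\ge1).$$ *Preliminary phase:* $y_0=x_0$, $x^{[k]}=\widehat x_{m_0}(y_{k-1},2\varkappa\nu)$, $y_k=\mathrm{sparse}(x^{[k]})$ for $k=1,\dots,K=\min\{\lfloor N/m_0\rfloor,\overline K\}$. *Asymptotic phase:* let $K'$ be the largest $k\ge0$ with $m_1+\dots+m_k\le N-m_0\overline K$ ($K'=0$ if there is none); $y'_0=y_K$, $x'^{[k]}=\widehat x_{m_k}(y'_{k-1},2^k\nu\varkappa)$, $y'_k=\mathrm{sparse}(x'^{[k]})$,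 $k=1,\dots,K'$. Output $\widehat y_N=y'_{K'}$, and $\widehat x_N=x'^{[K']}$ if $K'\ge1$, $\widehat x_N=x^{[K]}$ otherwise. **Reliable solutions.** For $\epsilon\in(0,\frac14]$ let $L=\lceil a\ln(1/\epsilon)\rceil$, and let $z_1,\dots,z_L$ be the solutions $\widehat x_{\lfloor N/L\rfloor}$ computed by SMD-SR on $L$ disjoint subsamples of length $\lfloor N/L\rfloor$. Let $\overline x$ be any one of: (1) a minimizer over $\mathbb R^n$ of $x\mapsto\sum_\ell\|x-z_\ell\|_2$; (2) a minimizer of the same function over $\{z_1,\dots,z_L\}$; (3) a $z_i$ with the smallest value of the $(\lfloor L/2\rfloor+1)$-st order statistic of $\{\|z_i-z_j\|_2\}_{j\ne i}$; and let $\overline y=\mathrm{sparse}(\overline x)$. The constant $a$ may depend on the type (1)–(3). **Risks.** For a norm $|\cdot|$, $\mathrm{Risk}_{|\cdot|}(\widehat x)=\sup_{x_*\in\mathcal S}\mathbf E\{|\widehat x-x_*|^2\}^{1/2}$, $\mathrm{Risk}_g(\widehat x)=\sup_{x_*\in\mathcal S}[\mathbf E\,g(\widehat x)-g_*]$, and $\mathrm{Risk}_{|\cdot|,\epsilon}(\widehat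 x)=\inf\{r:\sup_{x_*\in\mathcal S}\mathrm{Prob}\{|\widehat x-x_*|\ge r\}\le\epsilon\}$. **Claim.** There are absolute constants $c,C,\alpha>0$, and $a>0$ for each of the three types, such that in every such situation the following holds. (i) If $N\ge m_0$, then $$\mathrm{Risk}_{\|\cdot\|_1}(\widehat y_N)\le2\sqrt{2s}\,\mathrm{Risk}_{\|\cdot\|_2}(\widehat x_N)\le C\Big[R\exp\Big\{-\frac{cN\underline u\kappa_\Sigma}{\varkappa\bar s\nu\ln n}\Big\}+\frac{\sigma\bar s}{\underline u\kappa_\Sigma}\sqrt{\frac{\varkappa'\nu\ln n}{N}}\Big],$$ $$\mathrm{Risk}_g(\widehat x_N)\le C\Big[\frac{\underline u\kappa_\Sigma R^2}{\bar s}\exp\Big\{-\frac{cN\underline u\kappa_\Sigma}{\varkappa\bar s\nu\ln n}\Big\}+\frac{\nu\sigma^2\bar s\varkappa'\ln n}{\underline u\kappa_\Sigma N}\Big].$$ (ii) If $\epsilon\in(0,\frac14]$ and $N\ge\alpha m_0\ln(1/\epsilon)$, then, for each of the three types of reliable solutions, $$\mathrm{Risk}_{\|\cdot\|_1,\epsilon}(\overline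 y)\le\sqrt{2s}\,\mathrm{Risk}_{\|\cdot\|_2,\epsilon}(\overline y)\le2\sqrt{2s}\,\mathrm{Risk}_{\|\cdot\|_2,\epsilon}(\overline x)\le C\Big[R\exp\Big\{-\frac{cN\underline u\kappa_\Sigma}{\varkappa\bar s\nu\ln(1/\epsilon)\ln n}\Big\}+\frac{\sigma\bar s}{\underline u\kappa_\Sigma}\sqrt{\frac{\varkappa'\nu\ln(1/\epsilon)\ln n}{N}}\Big].$$ -/

import Mathlib

open MeasureTheory ProbabilityTheory
open scoped ENNReal

noncomputable section

namespace SparseGLM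

/-- The space `ℝⁿ`; its norm `‖·‖` is the Euclidean norm. -/
abbrev Vec (n : ℕ) : Type := EuclideanSpace ℝ (Fin n)

/-- One observation: a pair `(φ, η)` of a regressor and a response. -/
abbrev Obs (n : ℕ) : Type := Vec n × ℝ

/-- The norm `‖x‖₁`. -/
def l1 {n : ℕ} (x : Vec n) : ℝ := ∑ i, |x i|

/-- The norm `‖x‖_∞`. -/
def linf {n : ℕ} (x : Vec n) : ℝ := ⨆ i, |x i|

/-- The norm `‖x‖_p`. -/
def lp {n : ℕ} (p : ℝ) (x : Vec n) : ℝ := (∑ i, |x i| ^ p) ^ (1 / p)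

/-- `x` has at most `s` nonzero entries. -/
def IsSparse {n : ℕ} (s : ℕ) (x : Vec n) : Prop :=
  (Finset.univ.filter fun i => x i ≠ 0).card ≤ s

/-! ### The `ℓ₁` proximal setup and stochastic mirror descent -/

/-- The exponent `p = 1 + 1 / ln n`. -/
def pExp (n : ℕ) : ℝ := 1 + 1 / Real.log n

/-- The distance-generating function
`ϑ(x) = ½ e ln(n) n^{(p-1)(2-p)/p} ‖x‖_p²`, `p = 1 + 1 / ln n`. -/
def dgf (n : ℕ) (x : Vec n) : ℝ :=
  1 / 2 * Real.exp 1 * Real.log n *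
    (n : ℝ) ^ ((pExp n - 1) * (2 - pExp n) / pExp n) * lp (pExp n) x ^ 2

/-- The bound `Θ = ½ e² ln n` on the quadratic growth constant of `dgf`. -/
def Theta (n : ℕ) : ℝ := 1 / 2 * Real.exp 1 ^ 2 * Real.log n

/-- The Bregman divergence
`V_{x₀}(x, z) = ϑ(z - x₀) - ϑ(x - x₀) - ⟨∇ϑ(x - x₀), z - x⟩`. -/
def bregman {n : ℕ} (x0 x z : Vec n) : ℝ :=
  dgf n (z - x0) - dgf n (x - x0) - inner ℝ (gradient (dgf n) (x - x0)) (z - x)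

/-- `z` minimizes `⟨a, z⟩ + β V_{x₀}(x, z)` over `z ∈ X`. -/
def IsProx {n : ℕ} (X : Set (Vec n)) (β : ℝ) (a x x0 z : Vec n) : Prop :=
  z ∈ X ∧ ∀ w ∈ X, inner ℝ a z + β * bregman x0 x z ≤ inner ℝ a w + β * bregman x0 x w

/-- The proximal mapping `Prox_β(a, x; x₀)`, i.e. the minimizer in `IsProx`
(it exists and is unique when `X` is nonempty, closed and convex and `β > 0`, `n ≥ 3`). -/
def prox {n : ℕ} (X : Set (Vec n)) (β : ℝ) (a x x0 : Vec n) : Vec n :=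
  Classical.epsilon (IsProx X β a x x0)

/-- The stochastic gradient `∇G(x, (φ, η)) = φ (u(φᵀx) - η)`. -/
def stochGrad {n : ℕ} (u : ℝ → ℝ) (o : Obs n) (x : Vec n) : Vec n :=
  (u (inner ℝ o.1 x) - o.2) • o.1

/-- The mirror descent iterates `x_i = Prox_β(∇G(x_{i-1}, ω_i), x_{i-1}; x₀)` started at `x₀`,
where `ω_i = d (i - 1)`. -/
def smdIter {n : ℕ} (X : Set (Vec n)) (u : ℝ → ℝ) (β : ℝ) (x0 : Vec n) (d : ℕ → Obs n) :
    ℕ → Vec n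
  | 0 => x0
  | i + 1 => prox X β (stochGrad u (d i) (smdIter X u β x0 d i)) (smdIter X u β x0 d i) x0

/-- The approximate solution `x̂_m(x₀, β) = (1/m) ∑_{i=1}^m x_i`. -/
def smdAvg {n : ℕ} (X : Set (Vec n)) (u : ℝ → ℝ) (β : ℝ) (m : ℕ) (x0 : Vec n)
    (d : ℕ → Obs n) : Vec n :=
  (m : ℝ)⁻¹ • ∑ i ∈ Finset.Icc 1 m, smdIter X u β x0 d i

/-- The data stream with its first `k` entries dropped. -/
def drop {n : ℕ} (k : ℕ) (d : ℕ → Obs n) : ℕ → Obs n := fun i => d (k + i)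

/-- The numerical parameters and the deterministic data of the problem and of the algorithm. -/
structure Params (n : ℕ) where
  /-- the domain -/
  X : Set (Vec n)
  /-- the starting point -/
  x0 : Vec n
  /-- the bound on `‖x_* - x₀‖₁` -/
  R : ℝ
  /-- the activation -/
  u : ℝ → ℝ
  /-- the strong monotonicity constant of `u` -/
  uLow : ℝ
  /-- the Lipschitz constant of `u` -/
  uUp : ℝ
  /-- the lower bound on the spectrum of `Σ` -/
  kappaSigma : ℝ
  /-- the upper bound on the moduli of the entries of `Σ` -/
  upsilon : ℝ
  /-- the noise level -/
  sigma : ℝ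
  /-- the constant `ϰ` -/
  vk : ℝ
  /-- the constant `ϰ'` -/
  vk' : ℝ
  /-- the constant `ν` -/
  nu : ℝ
  /-- the constant `ς_*` -/
  vs : ℝ
  /-- the sparsity level -/
  s : ℕ
  /-- the upper bound `s̄` on the sparsity level -/
  sbar : ℝ
  /-- the sparsification map `x ↦ sparse(x)` -/
  sp : Vec n → Vec n

namespace Params

variable {n : ℕ} (S : Params n)

/-- The quadratic minoration constant `u̲ κ_Σ`. -/
def kap : ℝ := S.uLow * S.kappaSigma

/-! ### The multistage algorithm SMD-SR -/

/-- The length of a preliminary stage,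
`m₀ = ⌈(16 ν s̄ / (u̲ κ_Σ)) (4 e² ϰ ln n + 1)⌉`; the bracket is `8 Θ ϰ + 1`. -/
def m0 : ℕ :=
  ⌈16 * S.nu * S.sbar / S.kap * (4 * Real.exp 1 ^ 2 * S.vk * Real.log n + 1)⌉₊

/-- The stepsize parameter `β₀ = 2 ϰ ν` of the preliminary phase. -/
def beta0 : ℝ := 2 * S.vk * S.nu

/-- The target number of preliminary stages
`max {1, ⌈log₂ (R² u̲ κ_Σ ν ϰ / (32 ς_*² s̄ ϰ'))⌉}` (used for `ς_* ≠ 0`). -/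
def Kbar : ℕ :=
  max 1 ⌈Real.logb 2
    (S.R ^ 2 * S.kap * S.nu * S.vk / (32 * S.vs ^ 2 * S.sbar * S.vk'))⌉₊

open Classical in
/-- The number `K` of preliminary stages for the sample size `N`; for `ς_* = 0` the target number
of preliminary stages is infinite. -/
def K (N : ℕ) : ℕ := if S.vs = 0 then N / S.m0 else min (N / S.m0) S.Kbar

open Classical in
/-- The number of observations left for the asymptotic phase (zero when there are none). -/
def budget (N : ℕ) : ℕ := if S.vs = 0 then 0 else N - S.m0 * S.Kbar

/-- The length `m_k = ⌈512 (s̄ Θ ν ϰ / (u̲ κ_Σ)) 2^k⌉` of the `k`-th asymptotic stage. -/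
def mA (k : ℕ) : ℕ := ⌈512 * (S.sbar * Theta n * S.nu * S.vk / S.kap) * 2 ^ k⌉₊

/-- The stepsize parameter `β_k = 2^k ν ϰ` of the `k`-th asymptotic stage. -/
def betaA (k : ℕ) : ℝ := 2 ^ k * S.nu * S.vk

/-- The number `K'` of asymptotic stages, the largest `k` with `m_1 + ⋯ + m_k` at most the budget;
it is zero if there is no asymptotic phase. -/
def K' (N : ℕ) : ℕ :=
  Nat.findGreatest (fun k => ∑ i ∈ Finset.Icc 1 k, S.mA i ≤ S.budget N) (S.budget N)

/-- The outcome `y_k` of the `k`-th preliminary stage, `y₀ = x₀`. -/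
def yPre (d : ℕ → Obs n) : ℕ → Vec n
  | 0 => S.x0
  | k + 1 => S.sp (smdAvg S.X S.u S.beta0 S.m0 (yPre d k) (drop (k * S.m0) d))

/-- The point `x̂_{m₀}(y_{k-1}, β₀)` computed at the `k`-th preliminary stage, `k ≥ 1`. -/
def xPre (d : ℕ → Obs n) (k : ℕ) : Vec n :=
  smdAvg S.X S.u S.beta0 S.m0 (S.yPre d (k - 1)) (drop ((k - 1) * S.m0) d)

/-- The outcome `y'_k` of the `k`-th asymptotic stage, `y'₀ = y_K`. -/
def yAs (N : ℕ) (d : ℕ → Obs n) : ℕ → Vec n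
  | 0 => S.yPre d (S.K N)
  | k + 1 => S.sp (smdAvg S.X S.u (S.betaA (k + 1)) (S.mA (k + 1)) (yAs N d k)
      (drop (S.K N * S.m0 + ∑ i ∈ Finset.Icc 1 k, S.mA i) d))

/-- The point `x̂_{m_k}(y'_{k-1}, β_k)` computed at the `k`-th asymptotic stage, `k ≥ 1`. -/
def xAs (N : ℕ) (d : ℕ → Obs n) (k : ℕ) : Vec n :=
  smdAvg S.X S.u (S.betaA k) (S.mA k) (S.yAs N d (k - 1))
    (drop (S.K N * S.m0 + ∑ i ∈ Finset.Icc 1 (k - 1), S.mA i) d)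

/-- The SMD-SR solution `x̂_N` as a function of the data; it uses only the first `N` entries. -/
def xHat (N : ℕ) (d : ℕ → Obs n) : Vec n :=
  if S.K' N = 0 then S.xPre d (S.K N) else S.xAs N d (S.K' N)

/-- The sparse SMD-SR solution `ŷ_N` as a function of the data. -/
def yHat (N : ℕ) (d : ℕ → Obs n) : Vec n := S.yAs N d (S.K' N)

/-- The `L` solutions of SMD-SR on consecutive disjoint subsamples of length `⌊N / L⌋`. -/
def subSol (N L : ℕ) (d : ℕ → Obs n) : Fin L → Vec n :=
  fun l => S.xHat (N / L) (drop (l * (N / L)) d)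

/-! ### The set of signals -/

/-- The signals in question: the `s`-sparse `x_* ∈ X` with `‖x_* - x₀‖₁ ≤ R`. -/
def signals : Set (Vec n) := {x | x ∈ S.X ∧ IsSparse S.s x ∧ l1 (x - S.x0) ≤ S.R}

end Params

/-! ### Median-type aggregation -/

/-- The order statistic `r^i_{(k)}`: the `k`-th smallest, counted with multiplicity, of the `L - 1`
distances `‖z_i - z_j‖₂`, `j ≠ i`. It is the least `t` such that at least `k` of these distances
are at most `t`. -/
def orderStat {n L : ℕ} (z : Fin L → Vec n) (k : ℕ) (i : Fin L) : ℝ :=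
  sInf {t : ℝ | k ≤ (Finset.univ.filter fun j => j ≠ i ∧ ‖z i - z j‖ ≤ t).card}

/-- The three aggregation rules. -/
inductive Rule where
  | geometric
  | empirical
  | ranked

/-- `x` is an outcome of the aggregation rule applied to `z_1, …, z_L`:
a minimizer of `∑ ‖x - z_ℓ‖₂` over `ℝⁿ`; a minimizer of this sum over `{z_1, …, z_L}`;
a point `z_i` with the smallest order statistic `r^i_{(⌊L/2⌋ + 1)}`. -/
def IsAggregate {n L : ℕ} (z : Fin L → Vec n) (x : Vec n) : Rule → Prop
  | .geometric => ∀ w : Vec n, ∑ l, ‖x - z l‖ ≤ ∑ l, ‖w - z l‖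
  | .empirical => (∃ i, x = z i) ∧ ∀ j, ∑ l, ‖x - z l‖ ≤ ∑ l, ‖z j - z l‖
  | .ranked => ∃ i, x = z i ∧ ∀ j, orderStat z (L / 2 + 1) i ≤ orderStat z (L / 2 + 1) j

/-! ### The observation model -/

section Model

variable {n : ℕ} (S : Params n) {Ω : Type*} [MeasurableSpace Ω] (P : Measure Ω)
  (φ : ℕ → Ω → Vec n) (ξ : ℕ → Ω → ℝ)

/-- The observations `(φ_i, η_i)`, `η_i = u(φ_iᵀ x_*) + σ ξ_i`, for the signal `x_*`. -/
def obs (xs : Vec n) (ω : Ω) : ℕ → Obs n :=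
  fun i => (φ i ω, S.u (inner ℝ (φ i ω) xs) + S.sigma * ξ i ω)

/-- The second moment matrix `Σ = E{φ φᵀ}`. -/
def Sig : Matrix (Fin n) (Fin n) ℝ := Matrix.of fun i j => ∫ ω, φ 0 ω i * φ 0 ω j ∂P

/-- The norm `‖x‖_Σ = (xᵀ Σ x)^{1/2}`. -/
def sigNorm (x : Vec n) : ℝ := Real.sqrt (∑ i, ∑ j, x i * Sig P φ i j * x j)

/-- The primitive `U(t) = ∫₀ᵗ u` of the activation. -/
def prim (u : ℝ → ℝ) (t : ℝ) : ℝ := ∫ r in (0 : ℝ)..t, u r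

/-- The objective `g(x) = E{U(φᵀx) - φᵀx η}` for the signal `x_*`. -/
def gObj (xs x : Vec n) : ℝ :=
  ∫ ω, (prim S.u (inner ℝ (obs S φ ξ xs ω 0).1 x)
    - inner ℝ (obs S φ ξ xs ω 0).1 x * (obs S φ ξ xs ω 0).2) ∂P

/-- The optimal value `g_* = min_{x ∈ X} g(x)` for the signal `x_*`. -/
def gStar (xs : Vec n) : ℝ := sInf (gObj S P φ ξ xs '' S.X)

/-- The moment condition
`(ū E{‖φ‖_∞² (φᵀ(x - x_*))²}^{1/2} + ū υ^{1/2} ‖x - x_*‖_Σ + E{‖φ‖_∞²}^{1/2} σ)²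
  ≤ ϰ ν (g(x) - g_*) + ϰ' ς_*²`
at the point `x` for the signal `x_*` (the expectation being finite). -/
def MomentBound (xs x : Vec n) : Prop :=
  Integrable (fun ω => linf (φ 0 ω) ^ 2 * inner ℝ (φ 0 ω) (x - xs) ^ 2) P ∧
  (S.uUp * Real.sqrt (∫ ω, linf (φ 0 ω) ^ 2 * inner ℝ (φ 0 ω) (x - xs) ^ 2 ∂P)
      + S.uUp * Real.sqrt S.upsilon * sigNorm P φ (x - xs)
      + Real.sqrt (∫ ω, linf (φ 0 ω) ^ 2 ∂P) * S.sigma) ^ 2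
    ≤ S.vk * S.nu * (gObj S P φ ξ xs x - gStar S P φ ξ xs) + S.vk' * S.vs ^ 2

/-- The standing assumptions of sparse generalized linear regression, with the moment condition. -/
structure Model : Prop where
  dim : 3 ≤ n
  -- the domain, the sparsity levels, the starting point
  convex : Convex ℝ S.X
  closed : IsClosed S.X
  solid : (interior S.X).Nonempty
  start : S.x0 ∈ S.X
  s_le : (S.s : ℝ) ≤ S.sbar
  one_le_sbar : 1 ≤ S.sbar
  -- `sp x` is a best Euclidean approximation of `x ∈ X` by `s`-sparse points of `X`
  sp_measurable : Measurable S.sp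
  sp_best : ∀ x ∈ S.X, S.sp x ∈ S.X ∧ IsSparse S.s (S.sp x) ∧
    ∀ z ∈ S.X, IsSparse S.s z → ‖x - S.sp x‖ ≤ ‖x - z‖
  -- the activation is strongly monotone and Lipschitz continuous
  uLow_pos : 0 < S.uLow
  uLow_le : S.uLow ≤ S.uUp
  u_bounds : ∀ t' t : ℝ, t' ≤ t →
    S.uLow * (t - t') ≤ S.u t - S.u t' ∧ S.u t - S.u t' ≤ S.uUp * (t - t')
  -- regressors and noises: the pairs are i.i.d., with independent components
  prob : IsProbabilityMeasure P
  φ_measurable : ∀ i, Measurable (φ i)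
  ξ_measurable : ∀ i, Measurable (ξ i)
  indep : iIndepFun (fun i ω => (φ i ω, ξ i ω)) P
  indep_pair : ∀ i, IndepFun (φ i) (ξ i) P
  φ_ident : ∀ i, IdentDistrib (φ i) (φ 0) P P
  ξ_ident : ∀ i, IdentDistrib (ξ i) (ξ 0) P P
  φ_memLp : MemLp (φ 0) 2 P
  ξ_memLp : MemLp (ξ 0) 2 P
  ξ_mean : ∫ ω, ξ 0 ω ∂P = 0
  ξ_var : ∫ ω, ξ 0 ω ^ 2 ∂P ≤ 1
  sigma_nonneg : 0 ≤ S.sigma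
  -- `κ_Σ I ⪯ Σ` and `|Σ_ij| ≤ υ`
  kappaSigma_pos : 0 < S.kappaSigma
  Sig_lower : (Sig P φ - S.kappaSigma • (1 : Matrix (Fin n) (Fin n) ℝ)).PosSemidef
  Sig_upper : ∀ i j, |Sig P φ i j| ≤ S.upsilon
  -- the constants: `ϰ, ϰ' ≥ 1`, `ν` is a Lipschitz constant of `∇g` on `X`, `ς_*² ≤ ν σ²`
  one_le_vk : 1 ≤ S.vk
  one_le_vk' : 1 ≤ S.vk'
  grad_lipschitz : ∀ xs ∈ S.signals, ∀ x ∈ S.X, ∀ x' ∈ S.X,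
    linf (gradient (gObj S P φ ξ xs) x - gradient (gObj S P φ ξ xs) x') ≤ S.nu * l1 (x - x')
  vs_nonneg : 0 ≤ S.vs
  vs_le : S.vs ^ 2 ≤ S.nu * S.sigma ^ 2
  moment : ∀ xs ∈ S.signals, ∀ x ∈ S.X, MomentBound S P φ ξ xs x

/-! ### Risks of an estimator `est`, a function of the data -/

/-- The recovery risk `sup_{x_*} E{|x̂ - x_*|²}^{1/2}` in the norm `nrm`. -/
def risk (nrm : Vec n → ℝ) (est : (ℕ → Obs n) → Vec n) : ℝ≥0∞ :=
  ⨆ xs ∈ S.signals,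
    (∫⁻ ω, ENNReal.ofReal (nrm (est (obs S φ ξ xs ω) - xs) ^ 2) ∂P) ^ (1 / 2 : ℝ)

/-- The recovery `ε`-risk `inf {r : sup_{x_*} P{|x̂ - x_*| ≥ r} ≤ ε}` in the norm `nrm`. -/
def riskEps (nrm : Vec n → ℝ) (ε : ℝ) (est : (ℕ → Obs n) → Vec n) : ℝ≥0∞ :=
  sInf {r : ℝ≥0∞ | ∀ xs ∈ S.signals,
    P {ω | r ≤ ENNReal.ofReal (nrm (est (obs S φ ξ xs ω) - xs))} ≤ ENNReal.ofReal ε}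

/-- The prediction risk `sup_{x_*} E{g(x̂)} - g_*` (of an estimator with values in `X`, so that
`g(x̂) - g_* ≥ 0`). -/
def riskG (est : (ℕ → Obs n) → Vec n) : ℝ≥0∞ :=
  ⨆ xs ∈ S.signals,
    ∫⁻ ω, ENNReal.ofReal (gObj S P φ ξ xs (est (obs S φ ξ xs ω)) - gStar S P φ ξ xs) ∂P

end Model

/-- The norm `‖·‖₂`. -/
def l2 {n : ℕ} (x : Vec n) : ℝ := ‖x‖

end SparseGLM

end

noncomputable section

namespace SparseGLM

/-! ### The two-point inequality -/

/-! The heart of the matter is one stage of mirror descent. Started at `y` and run for `m` steps, it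
returns an average whose expected gap `g - g_*` is at most `(2βΘ + ν/2)/m · E‖y - x_*‖₁² +
2ϰ'ς_*²/β` (`lintegral_gap_smdAvg_le`). Three facts give this. The proximal function is 1-strongly
convex for `‖·‖₁`, yet grows no faster than `Θ‖·‖₁²` with `Θ` of order `ln n`
(`half_l1_sq_le_bregman`, `bregman_self_le`); strong convexity comes from the 2-uniform convexity of
`ℓ_p` (`lp_two_uniform_convex`). The signal itself minimizes `g`, because the noise is centred and
independent of the regressor (`meanGrad_self`, `gStar_eq`). Finally, the error of the stochastic
gradient in `‖·‖_∞` has second moment at most `ϰν (g - g_*) + ϰ'ς_*²` (`integral_noise_sq_le`). For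
`β ≥ 2ϰν` the first part costs at most half of the gap at the previous iterate, and summation over
the steps absorbs it.

Sparsity closes the loop (`l1_sp_sub_sq_le`). The objective is strongly convex in the Euclidean norm
with modulus `u̲ κ_Σ`, so the gap controls `‖x̂ - x_*‖₂²`; passing to a nearest sparse point costs a
factor 2 in the norm; and the difference of two `s`-sparse vectors satisfies `‖·‖₁² ≤ 2s ‖·‖₂²`.
Hence the squared `ℓ₁` error at the next start is again bounded by the gap. With a fixed stepsize
and length `m₀` it is halved at every stage, up to a floor `noiseLevel` (`preliminary_le`). Once the
floor is reached, doubling `β` and the stage length together halves the error further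
(`asymptotic_le`). Comparing the numbers of stages with `N` gives the exponential term and the `1/N`
term (`asymptotic_rate`, `lintegral_gap_xHat_le`).

For the reliable solutions, Chebyshev's inequality makes each of the `L` independent solutions bad
with probability at most `1/256`. All three aggregates are within five radii of `x_*` as soon as at
most a quarter of the solutions are bad (`IsAggregate.norm_sub_le`), and a union bound over sets of
bad indices shows that this fails with probability at most `2^{-L} ≤ ε` (`measure_many_bad_le`). -/

theorem two_le_rpow_add_rpow_of_nonpos {q b : ℝ} (hq : q ≤ 0) (hb0 : 0 ≤ b) (hb1 : b < 1) :
    2 ≤ (1 + b) ^ q + (1 - b) ^ q := by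
  have hx : 0 < (1 + b) ^ q := Real.rpow_pos_of_pos (by linarith) _
  have hy : 0 < (1 - b) ^ q := Real.rpow_pos_of_pos (by linarith) _
  -- The product is `(1 - b²)^q ≥ 1`, so the bound on the sum is the arithmetic-geometric mean
  -- inequality.
  have hxy : 1 ≤ (1 + b) ^ q * (1 - b) ^ q := by
    rw [← Real.mul_rpow (by linarith) (by linarith)]
    exact Real.one_le_rpow_of_pos_of_le_one_of_nonpos (by nlinarith) (by nlinarith) hq
  nlinarith [sq_nonneg ((1 + b) ^ q - (1 - b) ^ q)]

/-- The difference of the two sides vanishes at `b = 0` and has a nonnegative derivative by the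
preceding bound with `q = p - 2`. Up to the factor `p`, it is in turn the derivative of the function
in the next lemma. -/
theorem two_mul_le_rpow_sub_rpow {p b : ℝ} (hp1 : 1 < p) (hp2 : p ≤ 2) (hb : b ∈ Set.Icc (0 : ℝ) 1) :
    2 * (p - 1) * b ≤ (1 + b) ^ (p - 1) - (1 - b) ^ (p - 1) := by
  have hd : ∀ x ∈ Set.Ioo (0 : ℝ) 1, HasDerivAt
      (fun b : ℝ => (1 + b) ^ (p - 1) - (1 - b) ^ (p - 1) - 2 * (p - 1) * b)
      ((p - 1) * ((1 + x) ^ (p - 2) + (1 - x) ^ (p - 2) - 2)) x := by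
    intro x hx
    have h1 : HasDerivAt (fun b : ℝ => 1 + b) 1 x := by simpa using (hasDerivAt_id x).const_add 1
    have h2 : HasDerivAt (fun b : ℝ => 1 - b) (-1) x := by simpa using (hasDerivAt_id x).const_sub 1
    have h3 := h1.rpow_const (p := p - 1) (Or.inl (by linarith [hx.1] : (1 + x) ≠ 0))
    have h4 := h2.rpow_const (p := p - 1) (Or.inl (by linarith [hx.2] : (1 - x) ≠ 0))
    have h5 := (h3.sub h4).sub ((hasDerivAt_id x).const_mul (2 * (p - 1)))
    refine h5.congr_deriv ?_
    rw [show p - 1 - 1 = p - 2 by ring]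
    ring
  have hmono : MonotoneOn
      (fun b : ℝ => (1 + b) ^ (p - 1) - (1 - b) ^ (p - 1) - 2 * (p - 1) * b) (Set.Icc 0 1) := by
    refine monotoneOn_of_deriv_nonneg (convex_Icc 0 1) ?_ ?_ ?_
    · refine ContinuousOn.sub (ContinuousOn.sub ?_ ?_) (by fun_prop)
      · exact ContinuousOn.rpow_const (by fun_prop) fun x _ => Or.inr (by linarith)
      · exact ContinuousOn.rpow_const (by fun_prop) fun x _ => Or.inr (by linarith)
    · rw [interior_Icc]
      exact fun x hx => (hd x hx).differentiableAt.differentiableWithinAt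
    · rw [interior_Icc]
      intro x hx
      rw [(hd x hx).deriv]
      have := two_le_rpow_add_rpow_of_nonpos (q := p - 2) (by linarith) hx.1.le hx.2
      exact mul_nonneg (by linarith) (by linarith)
  have := hmono (Set.left_mem_Icc.2 zero_le_one) hb hb.1
  simp at this
  linarith

theorem one_add_mul_sq_le_rpow_add_rpow {p b : ℝ} (hp1 : 1 < p) (hp2 : p ≤ 2)
    (hb : b ∈ Set.Icc (0 : ℝ) 1) :
    1 + p / 2 * ((p - 1) * b ^ 2) ≤ ((1 + b) ^ p + (1 - b) ^ p) / 2 := by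
  have hd : ∀ x ∈ Set.Ioo (0 : ℝ) 1, HasDerivAt
      (fun b : ℝ => (1 + b) ^ p + (1 - b) ^ p - p * (p - 1) * b ^ 2)
      (p * ((1 + x) ^ (p - 1) - (1 - x) ^ (p - 1) - 2 * (p - 1) * x)) x := by
    intro x hx
    have h1 : HasDerivAt (fun b : ℝ => 1 + b) 1 x := by simpa using (hasDerivAt_id x).const_add 1
    have h2 : HasDerivAt (fun b : ℝ => 1 - b) (-1) x := by simpa using (hasDerivAt_id x).const_sub 1
    have h3 := h1.rpow_const (p := p) (Or.inl (by linarith [hx.1] : (1 + x) ≠ 0))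
    have h4 := h2.rpow_const (p := p) (Or.inl (by linarith [hx.2] : (1 - x) ≠ 0))
    have h5 := (h3.add h4).sub ((hasDerivAt_pow 2 x).const_mul (p * (p - 1)))
    refine h5.congr_deriv ?_
    simp
    ring
  have hmono : MonotoneOn
      (fun b : ℝ => (1 + b) ^ p + (1 - b) ^ p - p * (p - 1) * b ^ 2) (Set.Icc 0 1) := by
    refine monotoneOn_of_deriv_nonneg (convex_Icc 0 1) ?_ ?_ ?_
    · refine ContinuousOn.sub (ContinuousOn.add ?_ ?_) (by fun_prop)
      · exact ContinuousOn.rpow_const (by fun_prop) fun x _ => Or.inr (by linarith)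
      · exact ContinuousOn.rpow_const (by fun_prop) fun x _ => Or.inr (by linarith)
    · rw [interior_Icc]
      exact fun x hx => (hd x hx).differentiableAt.differentiableWithinAt
    · rw [interior_Icc]
      intro x hx
      rw [(hd x hx).deriv]
      have := two_mul_le_rpow_sub_rpow hp1 hp2 (Set.Ioo_subset_Icc_self hx)
      exact mul_nonneg (by linarith) (by linarith)
  have := hmono (Set.left_mem_Icc.2 zero_le_one) hb hb.1
  simp at this
  linarith

/-- By homogeneity one may take `a = 1`. Bernoulli's inequality for the exponent `p/2 ≤ 1` bounds
the left side by its first-order expansion in `b²`, and the second-order bound above puts the right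
side over that expansion. -/
theorem two_point_of_le {p a b : ℝ} (hp1 : 1 < p) (hp2 : p ≤ 2) (hb : 0 ≤ b) (hab : b ≤ a) :
    (a ^ 2 + (p - 1) * b ^ 2) ^ (p / 2) ≤ ((a + b) ^ p + (a - b) ^ p) / 2 := by
  rcases (hb.trans hab).eq_or_lt with h | ha
  · have hb' : b = 0 := by linarith
    subst hb'
    rw [← h]
    simp [Real.zero_rpow (show p / 2 ≠ 0 by linarith), Real.zero_rpow (show p ≠ 0 by linarith)]
  set t := b / a with ht
  have ht0 : t ∈ Set.Icc (0 : ℝ) 1 := ⟨by positivity, by rw [ht, div_le_one ha]; exact hab⟩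
  have hbt : b = a * t := by rw [ht]; field_simp
  have h1 := one_add_mul_sq_le_rpow_add_rpow hp1 hp2 ht0
  have h2 : (1 + (p - 1) * t ^ 2) ^ (p / 2) ≤ 1 + p / 2 * ((p - 1) * t ^ 2) :=
    rpow_one_add_le_one_add_mul_self
      (by linarith [mul_nonneg (by linarith : 0 ≤ p - 1) (sq_nonneg t)]) (by linarith) (by linarith)
  have e1 : (a ^ 2 + (p - 1) * b ^ 2) ^ (p / 2) = a ^ p * (1 + (p - 1) * t ^ 2) ^ (p / 2) := by
    have h0 : 0 ≤ 1 + (p - 1) * t ^ 2 := by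
      have := mul_nonneg (by linarith : 0 ≤ p - 1) (sq_nonneg t); linarith
    rw [hbt, show a ^ 2 + (p - 1) * (a * t) ^ 2 = a ^ 2 * (1 + (p - 1) * t ^ 2) by ring,
      Real.mul_rpow (by positivity) h0, ← Real.rpow_natCast a 2, ← Real.rpow_mul ha.le]
    congr 2
    push_cast; ring
  have e2 : (a + b) ^ p = a ^ p * (1 + t) ^ p := by
    rw [hbt, show a + a * t = a * (1 + t) by ring, Real.mul_rpow ha.le (by linarith [ht0.1])]
  have e3 : (a - b) ^ p = a ^ p * (1 - t) ^ p := by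
    rw [hbt, show a - a * t = a * (1 - t) by ring, Real.mul_rpow ha.le (by linarith [ht0.2])]
  rw [e1, e2, e3, ← mul_add, mul_div_assoc]
  exact mul_le_mul_of_nonneg_left (h2.trans h1) (by positivity)

/-- The two-point inequality of Bonami, Beckner and Gross, with the parameter `p - 1`. -/
theorem two_point {p : ℝ} (hp1 : 1 < p) (hp2 : p ≤ 2) (a b : ℝ) :
    (a ^ 2 + (p - 1) * b ^ 2) ^ (p / 2) ≤ (|a + b| ^ p + |a - b| ^ p) / 2 := by
  have key : ∀ a b : ℝ, 0 ≤ a → 0 ≤ b →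
      (a ^ 2 + (p - 1) * b ^ 2) ^ (p / 2) ≤ (|a + b| ^ p + |a - b| ^ p) / 2 := by
    intro a b ha hb
    rw [abs_of_nonneg (add_nonneg ha hb)]
    rcases le_total b a with h | h
    · rw [abs_of_nonneg (sub_nonneg.2 h)]
      exact two_point_of_le hp1 hp2 hb h
    -- Exchanging `a` and `b` only increases the left side when `a ≤ b`, because `p - 1 ≤ 1`.
    · rw [abs_sub_comm, abs_of_nonneg (sub_nonneg.2 h), add_comm a b]
      refine le_trans (Real.rpow_le_rpow ?_ ?_ (by linarith)) (two_point_of_le hp1 hp2 ha h)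
      · have := mul_nonneg (by linarith : 0 ≤ p - 1) (sq_nonneg b); positivity
      · have : a ^ 2 ≤ b ^ 2 := by gcongr
        nlinarith
  have h := key |a| |b| (abs_nonneg a) (abs_nonneg b)
  rw [sq_abs, sq_abs] at h
  refine h.trans (le_of_eq ?_)
  rcases abs_cases a with ⟨h1, -⟩ | ⟨h1, -⟩ <;> rcases abs_cases b with ⟨h2, -⟩ | ⟨h2, -⟩ <;>
    rw [h1, h2]
  · rw [← sub_eq_add_neg, sub_neg_eq_add]; ring
  · rw [show -a + b = -(a - b) by ring, show -a - b = -(a + b) by ring, abs_neg, abs_neg]; ring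
  · rw [show -a + -b = -(a + b) by ring, show -a - -b = -(a - b) by ring, abs_neg, abs_neg]

/-! ### The reverse Minkowski inequality -/

/-- This is the triangle inequality in the plane with the `ℓ_r` norm, applied to the vectors `(f i,
g i)` and added up by induction. -/
theorem rpow_sum_add_rpow_sum_le {ι : Type*} (s : Finset ι) {r : ℝ} (hr : 1 ≤ r) (f g : ι → ℝ)
    (hf : ∀ i, 0 ≤ f i) (hg : ∀ i, 0 ≤ g i) :
    (∑ i ∈ s, f i) ^ r + (∑ i ∈ s, g i) ^ r ≤ (∑ i ∈ s, (f i ^ r + g i ^ r) ^ (1 / r)) ^ r := by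
  classical
  have hr0 : 0 < r := by linarith
  have key : ((∑ i ∈ s, f i) ^ r + (∑ i ∈ s, g i) ^ r) ^ (1 / r)
      ≤ ∑ i ∈ s, (f i ^ r + g i ^ r) ^ (1 / r) := by
    induction s using Finset.induction_on with
    | empty =>
      simp [Real.zero_rpow hr0.ne', Real.zero_rpow (inv_pos.2 hr0).ne']
    | insert i s hi ih =>
      rw [Finset.sum_insert hi, Finset.sum_insert hi, Finset.sum_insert hi]
      have h := Real.Lp_add_le (Finset.univ : Finset (Fin 2)) ![f i, g i]
        ![∑ i ∈ s, f i, ∑ i ∈ s, g i] hr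
      have h1 : 0 ≤ ∑ i ∈ s, f i := Finset.sum_nonneg fun i _ => hf i
      have h2 : 0 ≤ ∑ i ∈ s, g i := Finset.sum_nonneg fun i _ => hg i
      simp only [Fin.sum_univ_two, Matrix.cons_val_zero, Matrix.cons_val_one,
        abs_of_nonneg (hf i), abs_of_nonneg (hg i), abs_of_nonneg h1, abs_of_nonneg h2,
        abs_of_nonneg (add_nonneg (hf i) h1), abs_of_nonneg (add_nonneg (hg i) h2)] at h
      linarith
  have h1 : 0 ≤ (∑ i ∈ s, f i) ^ r + (∑ i ∈ s, g i) ^ r :=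
    add_nonneg (Real.rpow_nonneg (Finset.sum_nonneg fun i _ => hf i) _)
      (Real.rpow_nonneg (Finset.sum_nonneg fun i _ => hg i) _)
  have h2 := Real.rpow_le_rpow (Real.rpow_nonneg h1 _) key hr0.le
  rwa [← Real.rpow_mul h1, one_div_mul_cancel hr0.ne', Real.rpow_one] at h2

/-! ### Strong convexity of the squared `ℓ_p` norm -/

theorem lp_nonneg {n : ℕ} (p : ℝ) (x : Vec n) : 0 ≤ lp p x :=
  Real.rpow_nonneg (Finset.sum_nonneg fun _ _ => Real.rpow_nonneg (abs_nonneg _) _) _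

theorem lp_sq {n : ℕ} (p : ℝ) (x : Vec n) : lp p x ^ 2 = (∑ i, |x i| ^ p) ^ (2 / p) := by
  rw [lp, ← Real.rpow_natCast, ← Real.rpow_mul
    (Finset.sum_nonneg fun _ _ => Real.rpow_nonneg (abs_nonneg _) _)]
  congr 1
  push_cast
  ring

/-- Two-uniform convexity of the `ℓ_p` norm, `1 < p ≤ 2`. -/
theorem lp_two_uniform_convex {n : ℕ} {p : ℝ} (hp1 : 1 < p) (hp2 : p ≤ 2) (x y : Vec n) :
    lp p x ^ 2 + (p - 1) * lp p y ^ 2 ≤ (lp p (x + y) ^ 2 + lp p (x - y) ^ 2) / 2 := by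
  have hp0 : 0 < p := by linarith
  have hr : 1 ≤ 2 / p := by rw [le_div_iff₀ hp0]; linarith
  have hsq : ∀ t : ℝ, (|t| ^ p) ^ (2 / p) = t ^ 2 := fun t => by
    rw [← Real.rpow_mul (abs_nonneg t), mul_div_cancel₀ _ hp0.ne', Real.rpow_ofNat, sq_abs]
  have hp' : 0 ≤ p - 1 := by linarith
  have hconst : ((p - 1) ^ (p / 2)) ^ (2 / p) = p - 1 := by
    rw [← Real.rpow_mul hp', show p / 2 * (2 / p) = 1 by field_simp, Real.rpow_one]
  -- With `r = 2/p` the left side becomes `‖x‖_p² + (p - 1)‖y‖_p²`, and each summand on the right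
  -- becomes `(x_i² + (p - 1) y_i²)^{p/2}`, to which the two-point inequality applies. Convexity of
  -- `t ↦ t^{2/p}` then separates `x + y` from `x - y`.
  have h1 := rpow_sum_add_rpow_sum_le (Finset.univ : Finset (Fin n)) hr (fun i => |x i| ^ p)
    (fun i => (p - 1) ^ (p / 2) * |y i| ^ p) (fun i => Real.rpow_nonneg (abs_nonneg _) _)
    (fun i => mul_nonneg (Real.rpow_nonneg hp' _) (Real.rpow_nonneg (abs_nonneg _) _))
  have hS : ∀ z : Vec n, 0 ≤ ∑ i, |z i| ^ p := fun z =>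
    Finset.sum_nonneg fun i _ => Real.rpow_nonneg (abs_nonneg _) _
  rw [← Finset.mul_sum, Real.mul_rpow (Real.rpow_nonneg hp' _) (hS y), hconst] at h1
  have h2 : ∑ i, ((|x i| ^ p) ^ (2 / p) + ((p - 1) ^ (p / 2) * |y i| ^ p) ^ (2 / p)) ^ (1 / (2 / p))
      ≤ (∑ i, |(x + y) i| ^ p + ∑ i, |(x - y) i| ^ p) / 2 := by
    rw [← Finset.sum_add_distrib, Finset.sum_div]
    refine Finset.sum_le_sum fun i _ => ?_
    rw [Real.mul_rpow (Real.rpow_nonneg hp' _) (Real.rpow_nonneg (abs_nonneg _) _), hconst,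
      hsq, hsq, one_div_div]
    exact two_point hp1 hp2 _ _
  have h3 : ((∑ i, |(x + y) i| ^ p + ∑ i, |(x - y) i| ^ p) / 2) ^ (2 / p)
      ≤ ((∑ i, |(x + y) i| ^ p) ^ (2 / p) + (∑ i, |(x - y) i| ^ p) ^ (2 / p)) / 2 := by
    have := (convexOn_rpow hr).2 (Set.mem_Ici.2 (hS (x + y))) (Set.mem_Ici.2 (hS (x - y)))
      (by norm_num : (0 : ℝ) ≤ 1 / 2) (by norm_num : (0 : ℝ) ≤ 1 / 2) (by norm_num)
    simp only [smul_eq_mul] at this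
    calc _ = (1 / 2 * ∑ i, |(x + y) i| ^ p + 1 / 2 * ∑ i, |(x - y) i| ^ p) ^ (2 / p) := by
          congr 1; ring
      _ ≤ _ := this
      _ = _ := by ring
  rw [lp_sq, lp_sq, lp_sq, lp_sq]
  refine h1.trans ((Real.rpow_le_rpow ?_ h2 (by linarith)).trans h3)
  exact Finset.sum_nonneg fun i _ => Real.rpow_nonneg (add_nonneg (Real.rpow_nonneg
    (Real.rpow_nonneg (abs_nonneg _) _) _) (Real.rpow_nonneg (mul_nonneg (Real.rpow_nonneg hp' _)
      (Real.rpow_nonneg (abs_nonneg _) _)) _)) _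

/-! ### The norms `‖·‖₁` and `‖·‖_∞` -/

section Norms

variable {n : ℕ}

theorem l1_nonneg (x : Vec n) : 0 ≤ l1 x := Finset.sum_nonneg fun _ _ => abs_nonneg _

theorem l1_neg (x : Vec n) : l1 (-x) = l1 x := by simp [l1]

theorem l1_sub_comm (x y : Vec n) : l1 (x - y) = l1 (y - x) := by rw [← l1_neg, neg_sub]

theorem l1_smul (t : ℝ) (x : Vec n) : l1 (t • x) = |t| * l1 x := by
  simp [l1, abs_mul, Finset.mul_sum]

theorem continuous_l1 : Continuous (l1 : Vec n → ℝ) := by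
  unfold l1; fun_prop

theorem norm_le_l1 (x : Vec n) : ‖x‖ ≤ l1 x := by
  rw [EuclideanSpace.norm_eq]
  refine Real.sqrt_le_iff.2 ⟨l1_nonneg x, ?_⟩
  simp only [Real.norm_eq_abs]
  exact Finset.sum_sq_le_sq_sum_of_nonneg fun _ _ => abs_nonneg _

/-- Cauchy-Schwarz on the support. This is where sparsity enters. -/
theorem l1_sq_le_card_mul (x : Vec n) :
    l1 x ^ 2 ≤ (Finset.univ.filter fun i => x i ≠ 0).card * ‖x‖ ^ 2 := by
  rw [EuclideanSpace.norm_sq_eq]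
  have h : l1 x = ∑ i ∈ Finset.univ.filter (fun i => x i ≠ 0), |x i| := by
    rw [l1, Finset.sum_filter_of_ne]
    intro i _ hi
    simpa using hi
  rw [h]
  refine (sq_sum_le_card_mul_sum_sq).trans ?_
  gcongr
  refine (Finset.sum_le_sum_of_subset_of_nonneg (Finset.filter_subset _ _) ?_)
  intros; positivity

theorem l1_sq_le (x : Vec n) : l1 x ^ 2 ≤ n * ‖x‖ ^ 2 := by
  refine (l1_sq_le_card_mul x).trans ?_
  gcongr
  exact (Finset.card_filter_le _ _).trans (by simp)

theorem linf_eq_norm (x : Vec n) : linf x = ‖WithLp.ofLp x‖ := by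
  rcases isEmpty_or_nonempty (Fin n) with h | h
  · simp [linf, Subsingleton.elim (WithLp.ofLp x) 0]
  · refine le_antisymm (ciSup_le fun i => norm_le_pi_norm (WithLp.ofLp x) i) ?_
    exact (pi_norm_le_iff_of_nonempty _).2 fun i =>
      le_ciSup (f := fun i => |x i|) (Set.finite_range _).bddAbove i

theorem abs_le_linf (x : Vec n) (i : Fin n) : |x i| ≤ linf x :=
  le_ciSup (f := fun i => |x i|) (Set.finite_range _).bddAbove i

theorem linf_nonneg (x : Vec n) : 0 ≤ linf x := by rw [linf_eq_norm]; positivity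

theorem linf_le {x : Vec n} {r : ℝ} (hr : 0 ≤ r) (h : ∀ i, |x i| ≤ r) : linf x ≤ r := by
  rw [linf_eq_norm]
  exact (pi_norm_le_iff_of_nonneg hr).2 h

theorem linf_add_le (x y : Vec n) : linf (x + y) ≤ linf x + linf y := by
  simp only [linf_eq_norm, WithLp.ofLp_add]
  exact norm_add_le _ _

theorem linf_neg (x : Vec n) : linf (-x) = linf x := by
  simp only [linf_eq_norm, WithLp.ofLp_neg, norm_neg]

theorem linf_smul (t : ℝ) (x : Vec n) : linf (t • x) = |t| * linf x := by
  simp only [linf_eq_norm, WithLp.ofLp_smul, norm_smul, Real.norm_eq_abs]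

theorem linf_le_norm (x : Vec n) : linf x ≤ ‖x‖ :=
  linf_le (norm_nonneg x) fun i => PiLp.norm_apply_le x i

theorem continuous_linf : Continuous (linf : Vec n → ℝ) := by
  have : (linf : Vec n → ℝ) = fun x => ‖WithLp.ofLp x‖ := funext linf_eq_norm
  rw [this]
  fun_prop

theorem abs_inner_le_linf_mul_l1 (x y : Vec n) : |inner ℝ x y| ≤ linf x * l1 y := by
  rw [PiLp.inner_apply, l1, Finset.mul_sum]
  refine (Finset.abs_sum_le_sum_abs _ _).trans (Finset.sum_le_sum fun i _ => ?_)
  simp only [RCLike.inner_apply, conj_trivial, abs_mul]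
  rw [mul_comm]
  exact mul_le_mul_of_nonneg_right (abs_le_linf x i) (abs_nonneg _)

end Norms

/-! ### The distance-generating function -/

section Dgf

variable {n : ℕ}

theorem one_lt_log (hn : 3 ≤ n) : 1 < Real.log n := by
  rw [Real.lt_log_iff_exp_lt (by positivity)]
  have : (3 : ℝ) ≤ n := by exact_mod_cast hn
  linarith [Real.exp_one_lt_d9]

theorem one_lt_pExp (hn : 3 ≤ n) : 1 < pExp n := by
  have := one_lt_log hn
  unfold pExp
  have : 0 < 1 / Real.log n := by positivity
  linarith

theorem pExp_lt_two (hn : 3 ≤ n) : pExp n < 2 := by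
  have h := one_lt_log hn
  have : 1 / Real.log n < 1 := by rw [div_lt_one] <;> linarith
  unfold pExp
  linarith

/-- The factor of `½ ‖x‖_p²` in `dgf`. -/
def dgfCoef (n : ℕ) : ℝ :=
  Real.exp 1 * Real.log n * (n : ℝ) ^ ((pExp n - 1) * (2 - pExp n) / pExp n)

theorem dgf_eq (x : Vec n) : dgf n x = 1 / 2 * dgfCoef n * lp (pExp n) x ^ 2 := by
  unfold dgf dgfCoef; ring

theorem dgfCoef_pos (hn : 3 ≤ n) : 0 < dgfCoef n := by
  have := one_lt_log hn
  unfold dgfCoef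
  positivity

/-- The purpose of the choice `p - 1 = 1 / ln n`: powers of `n` turn into constants free of the
dimension. -/
theorem natCast_rpow_pExp (hn : 3 ≤ n) (t : ℝ) : (n : ℝ) ^ ((pExp n - 1) * t) = Real.exp t := by
  have := one_lt_log hn
  rw [Real.rpow_def_of_pos (by positivity)]
  congr 1
  unfold pExp
  field_simp
  ring

/-- Since `‖x‖_p ≤ ‖x‖₁`, it remains to note that the power of `n` in the normalization equals
`e^{(2-p)/p} ≤ e`. -/
theorem dgf_le_Theta_mul (hn : 3 ≤ n) (x : Vec n) : dgf n x ≤ Theta n * l1 x ^ 2 := by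
  have hp1 := one_lt_pExp hn
  have hp2 := pExp_lt_two hn
  have hlog := one_lt_log hn
  have h1 : lp (pExp n) x ≤ l1 x := by
    have : ∑ i, |x i| ^ pExp n ≤ l1 x ^ pExp n := by
      have h := l1_nonneg x
      calc ∑ i, |x i| ^ pExp n ≤ ∑ i, |x i| * l1 x ^ (pExp n - 1) := by
            refine Finset.sum_le_sum fun i _ => ?_
            have hi : |x i| ≤ l1 x := Finset.single_le_sum
              (f := fun i => |x i|) (fun _ _ => abs_nonneg _) (Finset.mem_univ i)
            rcases (abs_nonneg (x i)).eq_or_lt with h0 | h0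
            · rw [← h0, Real.zero_rpow (by linarith)]; simp
            · calc |x i| ^ pExp n = |x i| * |x i| ^ (pExp n - 1) := by
                    rw [← Real.rpow_one_add' h0.le (by linarith)]; congr 1; ring
                _ ≤ _ := by gcongr
        _ = l1 x * l1 x ^ (pExp n - 1) := by rw [← Finset.sum_mul]; rfl
        _ = l1 x ^ pExp n := by
            rw [← Real.rpow_one_add' h (by linarith)]; congr 1; ring
    calc lp (pExp n) x ≤ (l1 x ^ pExp n) ^ (1 / pExp n) :=
          Real.rpow_le_rpow (Finset.sum_nonneg fun _ _ => Real.rpow_nonneg (abs_nonneg _) _) this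
            (by positivity)
      _ = l1 x := by
          rw [← Real.rpow_mul (l1_nonneg x), mul_one_div_cancel (by linarith), Real.rpow_one]
  have h2 : (n : ℝ) ^ ((pExp n - 1) * (2 - pExp n) / pExp n) ≤ Real.exp 1 := by
    rw [mul_div_assoc, natCast_rpow_pExp hn]
    refine Real.exp_le_exp.2 ?_
    rw [div_le_one (by linarith)]
    linarith
  have h3 : lp (pExp n) x ^ 2 ≤ l1 x ^ 2 := by
    have := lp_nonneg (pExp n) x
    gcongr
  unfold dgf Theta
  calc _ ≤ 1 / 2 * Real.exp 1 * Real.log n * Real.exp 1 * l1 x ^ 2 := by gcongr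
    _ = _ := by ring

/-- The power mean inequality gives `‖x‖₁² ≤ n^{2(p-1)/p} ‖x‖_p² = e^{2/p} ‖x‖_p²`. The
normalization is tuned to match this exactly: `(p - 1) ln n = 1` and `e · e^{(2-p)/p} = e^{2/p}`. -/
theorem l1_sq_le_dgfCoef_mul (hn : 3 ≤ n) (x : Vec n) :
    l1 x ^ 2 ≤ dgfCoef n * ((pExp n - 1) * lp (pExp n) x ^ 2) := by
  have hp1 := one_lt_pExp hn
  have hlog := one_lt_log hn
  have hn0 : (0 : ℝ) < n := by positivity
  have h1 := Real.rpow_sum_le_const_mul_sum_rpow Finset.univ (fun i => x i) hp1.le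
  have h2 := Real.rpow_le_rpow (Real.rpow_nonneg (l1_nonneg x) _) h1
    (by positivity : 0 ≤ 2 / pExp n)
  rw [← Real.rpow_mul (l1_nonneg x), mul_div_cancel₀ _ (by linarith),
    Real.rpow_ofNat, Real.mul_rpow (by positivity)
      (Finset.sum_nonneg fun _ _ => Real.rpow_nonneg (abs_nonneg _) _), ← lp_sq,
    ← Real.rpow_mul (by positivity)] at h2
  refine h2.trans (le_of_eq ?_)
  simp only [Finset.card_univ, Fintype.card_fin]
  rw [natCast_rpow_pExp hn, dgfCoef, mul_div_assoc (pExp n - 1), natCast_rpow_pExp hn]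
  have h3 : Real.log n * (pExp n - 1) = 1 := by unfold pExp; field_simp; ring
  have h4 : Real.exp (2 / pExp n) = Real.exp 1 * Real.exp ((2 - pExp n) / pExp n) := by
    rw [← Real.exp_add]; congr 1; field_simp; ring
  rw [h4]
  linear_combination (-(Real.exp 1 * Real.exp ((2 - pExp n) / pExp n)) * lp (pExp n) x ^ 2) * h3

/-- Midpoint strong convexity of `dgf` with respect to the `ℓ₁` norm. -/
theorem dgf_midpoint (hn : 3 ≤ n) (x y : Vec n) :
    dgf n x + 1 / 2 * l1 y ^ 2 ≤ (dgf n (x + y) + dgf n (x - y)) / 2 := by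
  have h1 := lp_two_uniform_convex (one_lt_pExp hn) (pExp_lt_two hn).le x y
  have h2 := l1_sq_le_dgfCoef_mul hn y
  have h3 := mul_le_mul_of_nonneg_left h1 (dgfCoef_pos hn).le
  simp only [dgf_eq]
  linarith

theorem dgf_nonneg (hn : 3 ≤ n) (x : Vec n) : 0 ≤ dgf n x := by
  rw [dgf_eq]
  have := dgfCoef_pos hn
  positivity

/-- At the origin the chain rule for `t ↦ t^{2/p}` is not applied, since its base vanishes there;
the quadratic upper bound gives the derivative directly. -/
theorem hasGradientAt_dgf_zero (hn : 3 ≤ n) : HasGradientAt (dgf n) 0 0 := by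
  rw [hasGradientAt_iff_hasFDerivAt, map_zero, hasFDerivAt_iff_isLittleO_nhds_zero]
  have h0 : dgf n 0 = 0 := le_antisymm ((dgf_le_Theta_mul hn 0).trans (by simp [l1]))
    (dgf_nonneg hn 0)
  simp only [zero_add, h0, sub_zero, _root_.zero_apply]
  refine Asymptotics.IsBigO.trans_isLittleO (g := fun h : Vec n => ‖h‖ ^ 2) ?_ ?_
  · refine Asymptotics.IsBigO.of_bound (Theta n * n) (Filter.Eventually.of_forall fun x => ?_)
    have hT : 0 ≤ Theta n := by have := one_lt_log hn; unfold Theta; positivity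
    rw [Real.norm_of_nonneg (dgf_nonneg hn x), Real.norm_of_nonneg (by positivity)]
    calc _ ≤ _ := dgf_le_Theta_mul hn x
      _ ≤ Theta n * (n * ‖x‖ ^ 2) := by gcongr; exact l1_sq_le x
      _ = _ := by ring
  · exact Asymptotics.isLittleO_norm_pow_id one_lt_two

theorem differentiable_dgf (hn : 3 ≤ n) : Differentiable ℝ (dgf n) := by
  intro x
  by_cases hx : x = 0
  · subst hx
    exact (hasGradientAt_dgf_zero hn).differentiableAt
  have hp1 := one_lt_pExp hn
  have hf : dgf n = fun x => 1 / 2 * dgfCoef n * (∑ i, |x i| ^ pExp n) ^ (2 / pExp n) := by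
    ext x; rw [dgf_eq, lp_sq]
  rw [hf]
  refine DifferentiableAt.const_mul (DifferentiableAt.rpow_const ?_ (Or.inl ?_)) _
  · refine DifferentiableAt.fun_sum fun i _ => ?_
    exact (hasDerivAt_abs_rpow (x i) hp1).differentiableAt.comp x
      (by fun_prop : DifferentiableAt ℝ (fun x : Vec n => x i) x)
  · intro h
    rw [Finset.sum_eq_zero_iff_of_nonneg fun _ _ => Real.rpow_nonneg (abs_nonneg _) _] at h
    refine hx (PiLp.ext fun i => ?_)
    have := h i (Finset.mem_univ i)
    rw [Real.rpow_eq_zero (abs_nonneg _) (by linarith)] at this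
    simpa using this

theorem hasGradientAt_dgf (hn : 3 ≤ n) (x : Vec n) :
    HasGradientAt (dgf n) (gradient (dgf n) x) x :=
  (differentiable_dgf hn x).hasGradientAt

theorem gradient_dgf_zero (hn : 3 ≤ n) : gradient (dgf n) 0 = 0 :=
  (hasGradientAt_dgf_zero hn).gradient

theorem measurable_gradient_dgf : Measurable (gradient (dgf n)) :=
  ((InnerProductSpace.toDual ℝ (Vec n)).symm.continuous.measurable).comp
    (measurable_fderiv ℝ (dgf n))

/-- A function that is midpoint strongly convex lies above its tangents by a quadratic. -/
theorem tangent_add_le_of_midpoint {f : Vec n → ℝ} (hf : ∀ x y : Vec n,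
      f x + 1 / 2 * l1 y ^ 2 ≤ (f (x + y) + f (x - y)) / 2) {x v : Vec n}
    (hx : HasGradientAt f v x) (h : Vec n) :
    f x + inner ℝ v h + 1 / 2 * l1 h ^ 2 ≤ f (x + h) := by
  have hstep : ∀ t : ℝ, 0 ≤ t → f (x + (t / 2) • h) + t ^ 2 / 8 * l1 h ^ 2
      ≤ (f (x + t • h) + f x) / 2 := by
    intro t ht
    have := hf (x + (t / 2) • h) ((t / 2) • h)
    rw [add_assoc, ← add_smul, add_halves, add_sub_cancel_right, l1_smul,
      abs_of_nonneg (by positivity)] at this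
    nlinarith
  -- Each halving of the step lowers the difference quotient along `h` by a quadratic amount. These
  -- gains form a geometric series with sum `½ ‖h‖₁²`, and the quotients tend to the directional
  -- derivative.
  have hk : ∀ k : ℕ, 2 ^ k * (f (x + ((1 : ℝ) / 2 ^ k) • h) - f x)
      ≤ f (x + h) - f x - 1 / 2 * (1 - 1 / 2 ^ k) * l1 h ^ 2 := by
    intro k
    induction k with
    | zero => simp
    | succ k ih =>
      have h2 := hstep (1 / 2 ^ k) (by positivity)
      rw [show (1 : ℝ) / 2 ^ k / 2 = 1 / 2 ^ (k + 1) by rw [pow_succ]; field_simp] at h2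
      have h3 := mul_le_mul_of_nonneg_left h2 (by positivity : (0 : ℝ) ≤ 2 ^ (k + 1))
      have e1 : (2 : ℝ) ^ (k + 1) * ((1 / 2 ^ k) ^ 2 / 8) = 1 / 4 * (1 / 2 ^ k) := by
        rw [pow_succ]; field_simp; ring
      have e2 : (1 : ℝ) / 2 ^ (k + 1) = 1 / 2 * (1 / 2 ^ k) := by rw [pow_succ]; field_simp
      rw [mul_add, ← mul_assoc, e1] at h3
      have e3 : (2 : ℝ) ^ (k + 1) = 2 * 2 ^ k := by ring
      rw [show (1 - 1 / (2 : ℝ) ^ (k + 1)) = 1 - 1 / 2 * (1 / 2 ^ k) by rw [e2]]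
      rw [e3] at h3 ⊢
      nlinarith
  have hlim : Filter.Tendsto (fun k : ℕ => (2 : ℝ) ^ k * (f (x + ((1 : ℝ) / 2 ^ k) • h) - f x))
      Filter.atTop (nhds (inner ℝ v h)) := by
    have hd := (hx.hasFDerivAt.hasLineDerivAt h).tendsto_slope_zero
    have ht : Filter.Tendsto (fun k : ℕ => (1 : ℝ) / 2 ^ k) Filter.atTop (nhdsWithin 0 {0}ᶜ) := by
      refine tendsto_nhdsWithin_iff.2 ⟨?_, Filter.Eventually.of_forall fun k => ?_⟩
      · simpa [one_div, inv_pow] using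
          tendsto_pow_atTop_nhds_zero_of_lt_one (r := (1 / 2 : ℝ)) (by norm_num) (by norm_num)
      · simp
    have := hd.comp ht
    simp only [Function.comp_def, one_div, inv_inv, smul_eq_mul,
      InnerProductSpace.toDual_apply_apply] at this
    simpa [one_div] using this
  have hlim2 : Filter.Tendsto (fun k : ℕ =>
      f (x + h) - f x - 1 / 2 * (1 - 1 / (2 : ℝ) ^ k) * l1 h ^ 2) Filter.atTop
      (nhds (f (x + h) - f x - 1 / 2 * (1 - 0) * l1 h ^ 2)) := by
    have ht : Filter.Tendsto (fun k : ℕ => (1 : ℝ) / 2 ^ k) Filter.atTop (nhds 0) := by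
      simpa [one_div, inv_pow] using
          tendsto_pow_atTop_nhds_zero_of_lt_one (r := (1 / 2 : ℝ)) (by norm_num) (by norm_num)
    exact tendsto_const_nhds.sub ((tendsto_const_nhds.mul (tendsto_const_nhds.sub ht)).mul_const _)
  have := le_of_tendsto_of_tendsto' hlim hlim2 hk
  linarith

theorem half_l1_sq_le_bregman (hn : 3 ≤ n) (x0 x z : Vec n) :
    1 / 2 * l1 (z - x) ^ 2 ≤ bregman x0 x z := by
  have := tangent_add_le_of_midpoint (dgf_midpoint hn) (hasGradientAt_dgf hn (x - x0)) (z - x)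
  rw [show x - x0 + (z - x) = z - x0 by abel] at this
  unfold bregman
  linarith

theorem bregman_nonneg (hn : 3 ≤ n) (x0 x z : Vec n) : 0 ≤ bregman x0 x z :=
  le_trans (by positivity) (half_l1_sq_le_bregman hn x0 x z)

/-- A stage is centred at its own starting point, where the gradient of the proximal function
vanishes, so the initial divergence costs only `Θ` times the squared `ℓ₁` error. -/
theorem bregman_self_le (hn : 3 ≤ n) (x0 z : Vec n) :
    bregman x0 x0 z ≤ Theta n * l1 (z - x0) ^ 2 := by
  unfold bregman
  rw [sub_self, gradient_dgf_zero hn, inner_zero_left]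
  linarith [dgf_le_Theta_mul hn (z - x0), dgf_nonneg hn (0 : Vec n)]

theorem bregman_three_point (x0 x y z : Vec n) :
    inner ℝ (gradient (dgf n) (y - x0) - gradient (dgf n) (x - x0)) (z - y)
      = bregman x0 x z - bregman x0 y z - bregman x0 x y := by
  unfold bregman
  rw [inner_sub_left, show z - x = (z - y) + (y - x) by abel, inner_add_right]
  ring

theorem measurable_bregman (hn : 3 ≤ n) (w : Vec n) :
    Measurable fun q : Vec n × Vec n => bregman q.1 q.2 w := by
  have h1 : Measurable (dgf n) := (differentiable_dgf hn).continuous.measurable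
  have h2 := measurable_gradient_dgf (n := n)
  unfold bregman
  have e1 : Measurable fun q : Vec n × Vec n => q.2 - q.1 := by fun_prop
  have e2 : Measurable fun q : Vec n × Vec n => w - q.1 := by fun_prop
  have e3 : Measurable fun q : Vec n × Vec n => w - q.2 := by fun_prop
  exact ((h1.comp e2).sub (h1.comp e1)).sub ((h2.comp e1).inner e3)

end Dgf

/-! ### The proximal mapping -/

/-- A map into a proper metric space with a closed graph is Borel measurable. -/
theorem measurable_of_isClosed_graph {T E : Type*} [TopologicalSpace T] [MeasurableSpace T]
    [BorelSpace T] [PseudoMetricSpace E] [ProperSpace E] [MeasurableSpace E] [BorelSpace E]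
    (e0 : E) {f : T → E} (hf : IsClosed {q : T × E | q.2 = f q.1}) : Measurable f := by
  refine measurable_of_isClosed fun C hC => ?_
  have hU : f ⁻¹' C = ⋃ k : ℕ, f ⁻¹' (C ∩ Metric.closedBall e0 k) := by
    rw [← Set.preimage_iUnion, ← Set.inter_iUnion, Metric.iUnion_closedBall_nat, Set.inter_univ]
  rw [hU]
  refine MeasurableSet.iUnion fun k => IsClosed.measurableSet ?_
  have hK : IsCompact (C ∩ Metric.closedBall e0 k) :=
    (isCompact_closedBall e0 (k : ℝ)).inter_left hC
  have : CompactSpace (C ∩ Metric.closedBall e0 k : Set E) := isCompact_iff_compactSpace.1 hK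
  have hG : IsClosed ((fun q : T × (C ∩ Metric.closedBall e0 k : Set E) => (q.1, (q.2 : E))) ⁻¹'
      {q : T × E | q.2 = f q.1}) := hf.preimage (by fun_prop)
  -- The preimage of a compact piece is the projection of a closed set along a compact factor, hence
  -- closed.
  convert isClosedMap_fst_of_compactSpace _ hG using 1
  ext t
  constructor
  · intro ht
    exact ⟨(t, ⟨f t, ht⟩), rfl, rfl⟩
  · rintro ⟨⟨t', z⟩, hz, rfl⟩
    have hz' : (z : E) = f t' := hz
    change f t' ∈ C ∩ Metric.closedBall e0 k
    rw [← hz']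
    exact z.2

section Prox

variable {n : ℕ} {X : Set (Vec n)} {β : ℝ}

/-- `z` minimizes `⟨b, z⟩ + β ϑ(z - x₀)` over `z ∈ X`. -/
def IsProxPt (X : Set (Vec n)) (β : ℝ) (b x0 z : Vec n) : Prop :=
  z ∈ X ∧ ∀ w ∈ X, inner ℝ b z + β * dgf n (z - x0) ≤ inner ℝ b w + β * dgf n (w - x0)

/-- Up to a constant, the gradient and the previous iterate enter only through the linear functional
`a - β∇ϑ(x - x₀)`. Existence, uniqueness and measurability can thus be studied with two parameters.
-/
theorem isProx_iff (a x x0 z : Vec n) :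
    IsProx X β a x x0 z ↔ IsProxPt X β (a - β • gradient (dgf n) (x - x0)) x0 z := by
  have h : ∀ z, inner ℝ a z + β * bregman x0 x z
      = inner ℝ (a - β • gradient (dgf n) (x - x0)) z + β * dgf n (z - x0)
        + β * (inner ℝ (gradient (dgf n) (x - x0)) x - dgf n (x - x0)) := by
    intro z
    unfold bregman
    rw [inner_sub_left, inner_sub_right, real_inner_smul_left]
    ring
  unfold IsProx IsProxPt
  simp only [h, add_le_add_iff_right]

/-- The objective is continuous and coercive, because `ϑ` dominates half the squared Euclidean norm.
-/
theorem exists_isProxPt (hn : 3 ≤ n) (hX : IsClosed X) (hne : X.Nonempty) (hβ : 0 < β)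
    (b x0 : Vec n) : ∃ z, IsProxPt X β b x0 z := by
  obtain ⟨w, hw⟩ := hne
  have hcont : Continuous fun z : Vec n => inner ℝ b z + β * dgf n (z - x0) := by
    have := (differentiable_dgf hn).continuous
    fun_prop
  obtain ⟨z, hz, hmin⟩ := hcont.continuousOn.exists_isMinOn' hX hw (by
    refine Filter.Eventually.filter_mono inf_le_left ?_
    have hbound : ∀ z : Vec n, -(‖b‖ * ‖x0‖) + ‖z - x0‖ * (β / 2 * ‖z - x0‖ - ‖b‖)
        ≤ inner ℝ b z + β * dgf n (z - x0) := by
      intro z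
      have h1 : -(‖b‖ * (‖z - x0‖ + ‖x0‖)) ≤ inner ℝ b z := by
        have h2 : ‖z‖ ≤ ‖z - x0‖ + ‖x0‖ := norm_le_norm_sub_add z x0
        have h3 := (abs_le.1 (abs_real_inner_le_norm b z)).1
        nlinarith [norm_nonneg b]
      have h4 : 1 / 2 * ‖z - x0‖ ^ 2 ≤ dgf n (z - x0) := by
        have h5 := tangent_add_le_of_midpoint (dgf_midpoint hn) (hasGradientAt_dgf_zero hn) (z - x0)
        rw [inner_zero_left, zero_add] at h5
        have h6 := dgf_nonneg hn (0 : Vec n)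
        have h7 : ‖z - x0‖ ^ 2 ≤ l1 (z - x0) ^ 2 := by
          gcongr; exact norm_le_l1 _
        linarith
      nlinarith
    have hnorm : Filter.Tendsto (fun z : Vec n => ‖z - x0‖) (Filter.cocompact (Vec n))
        Filter.atTop := by
      refine Filter.tendsto_atTop_mono (f := fun z : Vec n => ‖z‖ - ‖x0‖)
        (fun z => norm_sub_norm_le z x0) ?_
      exact Filter.tendsto_atTop_add_const_right _ _ (tendsto_norm_cocompact_atTop (E := Vec n))
    have hlim : Filter.Tendsto
        (fun z : Vec n => -(‖b‖ * ‖x0‖) + ‖z - x0‖ * (β / 2 * ‖z - x0‖ - ‖b‖))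
        (Filter.cocompact (Vec n)) Filter.atTop := by
      refine Filter.tendsto_atTop_add_const_left _ _ (hnorm.atTop_mul_atTop₀ ?_)
      exact Filter.tendsto_atTop_add_const_right _ _
        (hnorm.const_mul_atTop (by positivity : 0 < β / 2))
    exact (Filter.tendsto_atTop_mono hbound hlim).eventually_ge_atTop _)
  exact ⟨z, hz, fun w hw => hmin hw⟩

theorem IsProxPt.inner_nonneg (hn : 3 ≤ n) (hX : Convex ℝ X) {b x0 z w : Vec n}
    (h : IsProxPt X β b x0 z) (hw : w ∈ X) :
    0 ≤ inner ℝ (b + β • gradient (dgf n) (z - x0)) (w - z) := by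
  have hd : HasFDerivAt (fun z : Vec n => inner ℝ b z + β * dgf n (z - x0))
      (innerSL ℝ b + β • InnerProductSpace.toDual ℝ (Vec n) (gradient (dgf n) (z - x0))) z := by
    refine (innerSL ℝ b).hasFDerivAt.add (HasFDerivAt.const_mul ?_ β)
    have := (hasGradientAt_dgf hn (z - x0)).hasFDerivAt.comp z ((hasFDerivAt_id z).sub_const x0)
    rwa [ContinuousLinearMap.comp_id] at this
  have hmin : IsLocalMinOn (fun z : Vec n => inner ℝ b z + β * dgf n (z - x0)) X z :=
    IsMinOn.localize fun w hw => h.2 w hw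
  have := hmin.hasFDerivWithinAt_nonneg hd.hasFDerivWithinAt
    (y := w - z) (mem_posTangentConeAt_of_segment_subset (by
      rw [add_sub_cancel]; exact hX.segment_subset h.1 hw))
  simpa [inner_add_left, real_inner_smul_left] using this

/-- Testing the optimality condition of each minimizer against the other and adding cancels `b`;
strong convexity of `ϑ` then forces `‖z - w‖₁ = 0`. -/
theorem IsProxPt.unique (hn : 3 ≤ n) (hX : Convex ℝ X) (hβ : 0 < β) {b x0 z w : Vec n}
    (h : IsProxPt X β b x0 z) (h' : IsProxPt X β b x0 w) : z = w := by
  have h1 := h.inner_nonneg hn hX h'.1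
  have h2 := h'.inner_nonneg hn hX h.1
  have h3 := bregman_three_point x0 w z w
  have h4 := half_l1_sq_le_bregman hn x0 w z
  have h5 := half_l1_sq_le_bregman hn x0 z w
  have h6 : bregman x0 w w = 0 := by simp [bregman]
  rw [inner_sub_left, h6] at h3
  rw [inner_add_left, real_inner_smul_left] at h1 h2
  have e1 : inner ℝ b (z - w) = -inner ℝ b (w - z) := by rw [← inner_neg_right, neg_sub]
  have e2 : inner ℝ (gradient (dgf n) (w - x0)) (z - w)
      = -inner ℝ (gradient (dgf n) (w - x0)) (w - z) := by rw [← inner_neg_right, neg_sub]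
  rw [e1, e2] at h2
  have h7 : 0 ≤ β * (-(1 / 2 * l1 (z - w) ^ 2) - 1 / 2 * l1 (w - z) ^ 2) := by nlinarith
  have h8 : l1 (z - w) ^ 2 ≤ 0 := by
    rw [l1_sub_comm w z] at h7
    by_contra hc
    nlinarith
  have h9 : ‖z - w‖ ≤ 0 := (norm_le_l1 _).trans (by nlinarith [l1_nonneg (z - w)])
  exact sub_eq_zero.1 (norm_le_zero_iff.1 h9)

theorem isProx_prox (hn : 3 ≤ n) (hX : IsClosed X) (hne : X.Nonempty) (hβ : 0 < β)
    (a x x0 : Vec n) : IsProx X β a x x0 (prox X β a x x0) := by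
  obtain ⟨z, hz⟩ := exists_isProxPt hn hX hne hβ (a - β • gradient (dgf n) (x - x0)) x0
  exact Classical.epsilon_spec ⟨z, (isProx_iff a x x0 z).2 hz⟩

theorem prox_mem (hn : 3 ≤ n) (hX : IsClosed X) (hne : X.Nonempty) (hβ : 0 < β)
    (a x x0 : Vec n) : prox X β a x x0 ∈ X :=
  (isProx_prox hn hX hne hβ a x x0).1

/-- The basic inequality of mirror descent. -/
theorem inner_prox_sub_le (hn : 3 ≤ n) (hX : IsClosed X) (hconv : Convex ℝ X) (hβ : 0 < β)
    (a x x0 : Vec n) {z : Vec n} (hz : z ∈ X) :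
    inner ℝ a (prox X β a x x0 - z)
      ≤ β * (bregman x0 x z - bregman x0 (prox X β a x x0) z - bregman x0 x (prox X β a x x0)) := by
  have h := ((isProx_iff a x x0 _).1 (isProx_prox hn hX ⟨z, hz⟩ hβ a x x0)).inner_nonneg hn hconv hz
  rw [← bregman_three_point, inner_sub_left]
  rw [inner_add_left, inner_sub_left, real_inner_smul_left, real_inner_smul_left] at h
  have e : inner ℝ a (prox X β a x x0 - z) = -inner ℝ a (z - prox X β a x x0) := by
    rw [← inner_neg_right, neg_sub]
  linarith

/-- As a function of the linear functional and the centre, the minimizer has a closed graph by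
uniqueness, hence is measurable. Composing with `∇ϑ`, of which only measurability is needed, gives
the proximal map. -/
theorem measurable_prox (hn : 3 ≤ n) (hX : IsClosed X) (hconv : Convex ℝ X) (hne : X.Nonempty)
    (hβ : 0 < β) :
    Measurable fun q : Vec n × Vec n × Vec n => prox X β q.1 q.2.1 q.2.2 := by
  choose f hf using fun q : Vec n × Vec n => exists_isProxPt hn hX hne hβ q.1 q.2
  have hfm : Measurable f := by
    refine measurable_of_isClosed_graph 0 ?_
    have : {q : (Vec n × Vec n) × Vec n | q.2 = f q.1}
        = {q | IsProxPt X β q.1.1 q.1.2 q.2} := by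
      ext q
      refine ⟨fun h => ?_, fun h => h.unique hn hconv hβ (hf q.1)⟩
      have := hf q.1
      rw [← show q.2 = f q.1 from h] at this
      exact this
    rw [this]
    have hd := (differentiable_dgf hn).continuous
    refine IsClosed.inter (hX.preimage continuous_snd) ?_
    have : {q : (Vec n × Vec n) × Vec n | ∀ w ∈ X, inner ℝ q.1.1 q.2 + β * dgf n (q.2 - q.1.2)
          ≤ inner ℝ q.1.1 w + β * dgf n (w - q.1.2)}
        = ⋂ w ∈ X, {q | inner ℝ q.1.1 q.2 + β * dgf n (q.2 - q.1.2)
          ≤ inner ℝ q.1.1 w + β * dgf n (w - q.1.2)} := by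
      ext q; simp
    change IsClosed {q : (Vec n × Vec n) × Vec n | ∀ w ∈ X,
      inner ℝ q.1.1 q.2 + β * dgf n (q.2 - q.1.2) ≤ inner ℝ q.1.1 w + β * dgf n (w - q.1.2)}
    rw [this]
    refine isClosed_biInter fun w _ => isClosed_le ?_ ?_ <;> fun_prop
  have heq : (fun q : Vec n × Vec n × Vec n => prox X β q.1 q.2.1 q.2.2)
      = fun q => f (q.1 - β • gradient (dgf n) (q.2.1 - q.2.2), q.2.2) := by
    ext1 q
    exact ((isProx_iff _ _ _ _).1 (isProx_prox hn hX hne hβ _ _ _)).unique hn hconv hβ (hf _)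
  rw [heq]
  have hg := measurable_gradient_dgf (n := n)
  have e1 : Measurable fun q : Vec n × Vec n × Vec n => q.2.1 - q.2.2 := by fun_prop
  have e2 : Measurable fun q : Vec n × Vec n × Vec n => β • gradient (dgf n) (q.2.1 - q.2.2) :=
    (hg.comp e1).const_smul β
  exact hfm.comp ((measurable_fst.sub e2).prodMk (by fun_prop))

end Prox

/-! ### Mirror descent iterates -/

section Iterates

variable {n : ℕ} {X : Set (Vec n)} {β : ℝ} {u : ℝ → ℝ}

theorem measurable_stochGrad (hu : Continuous u) :
    Measurable fun q : Obs n × Vec n => stochGrad u q.1 q.2 := by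
  unfold stochGrad
  have : Continuous fun q : Obs n × Vec n => (u (inner ℝ q.1.1 q.2) - q.1.2) • q.1.1 := by
    fun_prop
  exact this.measurable

theorem smdIter_mem (hn : 3 ≤ n) (hX : IsClosed X) (hβ : 0 < β) {y : Vec n} (hy : y ∈ X)
    (d : ℕ → Obs n) (i : ℕ) : smdIter X u β y d i ∈ X := by
  cases i with
  | zero => exact hy
  | succ i => exact prox_mem hn hX ⟨y, hy⟩ hβ _ _ _

theorem smdAvg_mem (hn : 3 ≤ n) (hX : IsClosed X) (hconv : Convex ℝ X) (hβ : 0 < β) {y : Vec n}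
    (hy : y ∈ X) (d : ℕ → Obs n) {m : ℕ} (hm : 0 < m) : smdAvg X u β m y d ∈ X := by
  unfold smdAvg
  rw [Finset.smul_sum]
  refine hconv.sum_mem (fun _ _ => by positivity) ?_ fun i _ => smdIter_mem hn hX hβ hy d i
  simp
  field_simp

theorem measurable_proxStep (hn : 3 ≤ n) (hX : IsClosed X) (hconv : Convex ℝ X) (hne : X.Nonempty)
    (hβ : 0 < β) (hu : Continuous u) {Ω : Type*} [MeasurableSpace Ω] {o : Ω → Obs n}
    {v y : Ω → Vec n} (ho : Measurable o) (hv : Measurable v) (hy : Measurable y) :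
    Measurable fun ω => prox X β (stochGrad u (o ω) (v ω)) (v ω) (y ω) := by
  have hg : Measurable fun ω => stochGrad u (o ω) (v ω) :=
    Measurable.comp (g := fun q : Obs n × Vec n => stochGrad u q.1 q.2) (f := fun ω => (o ω, v ω))
      (measurable_stochGrad hu) (ho.prodMk hv)
  exact Measurable.comp (g := fun q : Vec n × Vec n × Vec n => prox X β q.1 q.2.1 q.2.2)
    (f := fun ω => (stochGrad u (o ω) (v ω), v ω, y ω)) (measurable_prox hn hX hconv hne hβ)
    (hg.prodMk (hv.prodMk hy))

theorem measurable_smdIter (hn : 3 ≤ n) (hX : IsClosed X) (hconv : Convex ℝ X) (hne : X.Nonempty)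
    (hβ : 0 < β) (hu : Continuous u) {Ω : Type*} [MeasurableSpace Ω] {y : Ω → Vec n}
    (hy : Measurable y) {d : Ω → ℕ → Obs n} (i : ℕ) (hd : ∀ j < i, Measurable fun ω => d ω j) :
    Measurable fun ω => smdIter X u β (y ω) (d ω) i := by
  induction i with
  | zero => exact hy
  | succ i ih =>
    have hi := ih fun j hj => hd j (by omega)
    simp only [smdIter]
    exact measurable_proxStep hn hX hconv hne hβ hu (hd i (by omega)) hi hy

theorem measurable_smdAvg (hn : 3 ≤ n) (hX : IsClosed X) (hconv : Convex ℝ X) (hne : X.Nonempty)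
    (hβ : 0 < β) (hu : Continuous u) {Ω : Type*} [MeasurableSpace Ω] {y : Ω → Vec n}
    (hy : Measurable y) {d : Ω → ℕ → Obs n} (m : ℕ) (hd : ∀ j < m, Measurable fun ω => d ω j) :
    Measurable fun ω => smdAvg X u β m (y ω) (d ω) := by
  unfold smdAvg
  have h : ∀ i ∈ Finset.Icc 1 m, Measurable fun ω => smdIter X u β (y ω) (d ω) i := fun i hi =>
    measurable_smdIter hn hX hconv hne hβ hu hy i fun j hj =>
      hd j (by have := (Finset.mem_Icc.1 hi).2; omega)
  exact (Finset.measurable_fun_sum _ h).const_smul (m : ℝ)⁻¹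

end Iterates

/-! ### Second moments -/

section SecondMoments

variable {Ω : Type*} [MeasurableSpace Ω] {P : Measure Ω}

theorem sq_integral_mul_le {f g : Ω → ℝ} (hf : MemLp f 2 P) (hg : MemLp g 2 P) :
    (∫ ω, f ω * g ω ∂P) ^ 2 ≤ (∫ ω, f ω ^ 2 ∂P) * ∫ ω, g ω ^ 2 ∂P := by
  have hfg : Integrable (fun ω => f ω * g ω) P := hf.integrable_mul hg
  have h := discrim_le_zero (a := ∫ ω, f ω ^ 2 ∂P) (b := 2 * ∫ ω, f ω * g ω ∂P)
    (c := ∫ ω, g ω ^ 2 ∂P) fun t => by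
      have h1 : 0 ≤ ∫ ω, (t * f ω + g ω) ^ 2 ∂P := integral_nonneg fun ω => sq_nonneg _
      have h2 : ∫ ω, (t * f ω + g ω) ^ 2 ∂P
          = ∫ ω, (t ^ 2 * f ω ^ 2 + 2 * t * (f ω * g ω) + g ω ^ 2) ∂P := by
        congr 1; ext ω; ring
      have h3 : Integrable (fun ω => t ^ 2 * f ω ^ 2 + 2 * t * (f ω * g ω)) P :=
        (hf.integrable_sq.const_mul _).add (hfg.const_mul _)
      rw [h2, integral_add h3 hg.integrable_sq, integral_add (hf.integrable_sq.const_mul _) (hfg.const_mul _),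
        integral_const_mul, integral_const_mul] at h1
      linarith
  rw [discrim] at h
  linarith

/-- The triangle inequality in `L²`, with bounds in place of the norms. -/
theorem integral_add_sq_le {f g : Ω → ℝ} (hf : MemLp f 2 P) (hg : MemLp g 2 P) {a b : ℝ}
    (ha : 0 ≤ a) (hb : 0 ≤ b) (hfa : ∫ ω, f ω ^ 2 ∂P ≤ a ^ 2) (hgb : ∫ ω, g ω ^ 2 ∂P ≤ b ^ 2) :
    ∫ ω, (f ω + g ω) ^ 2 ∂P ≤ (a + b) ^ 2 := by
  have hfg : Integrable (fun ω => f ω * g ω) P := hf.integrable_mul hg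
  have h1 : ∫ ω, f ω * g ω ∂P ≤ a * b := by
    refine abs_le_of_sq_le_sq' ?_ (by positivity) |>.2
    calc _ ≤ _ := sq_integral_mul_le hf hg
      _ ≤ a ^ 2 * b ^ 2 := by
          gcongr
      _ = _ := by ring
  have h2 : ∫ ω, (f ω + g ω) ^ 2 ∂P = ∫ ω, (f ω ^ 2 + 2 * (f ω * g ω) + g ω ^ 2) ∂P := by
    congr 1; ext ω; ring
  have h3 : Integrable (fun ω => f ω ^ 2 + 2 * (f ω * g ω)) P :=
    hf.integrable_sq.add (hfg.const_mul _)
  rw [h2, integral_add h3 hg.integrable_sq,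
    integral_add hf.integrable_sq (hfg.const_mul _), integral_const_mul]
  nlinarith

end SecondMoments

/-! ### The objective -/

section Primitive

variable {u : ℝ → ℝ}

theorem hasDerivAt_prim (hu : Continuous u) (t : ℝ) : HasDerivAt (prim u) (u t) t :=
  intervalIntegral.integral_hasDerivAt_right (hu.intervalIntegrable _ _)
    (hu.stronglyMeasurableAtFilter _ _) hu.continuousAt

theorem prim_sub (hu : Continuous u) (s t : ℝ) :
    prim u t - prim u s - u s * (t - s) = ∫ r in s..t, (u r - u s) := by
  unfold prim
  rw [intervalIntegral.integral_interval_sub_left (hu.intervalIntegrable _ _)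
    (hu.intervalIntegrable _ _), intervalIntegral.integral_sub (hu.intervalIntegrable _ _)
    (by simp)]
  simp
  ring

theorem integral_mul_sub_const (c s t : ℝ) :
    ∫ r in s..t, c * (r - s) = c / 2 * (t - s) ^ 2 := by
  simp
  ring

/-- Two-sided quadratic bounds for the remainder of the primitive of a monotone activation. -/
theorem prim_bounds (hu : Continuous u) {a b : ℝ}
    (hab : ∀ t' t : ℝ, t' ≤ t → a * (t - t') ≤ u t - u t' ∧ u t - u t' ≤ b * (t - t')) (s t : ℝ) :
    a / 2 * (t - s) ^ 2 ≤ prim u t - prim u s - u s * (t - s) ∧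
      prim u t - prim u s - u s * (t - s) ≤ b / 2 * (t - s) ^ 2 := by
  have hc : ∀ c : ℝ, ∀ x y : ℝ, IntervalIntegrable (fun r => c * (r - s)) volume x y := fun c x y =>
    Continuous.intervalIntegrable (by fun_prop) _ _
  have hi : ∀ x y : ℝ, IntervalIntegrable (fun r => u r - u s) volume x y := fun x y =>
    Continuous.intervalIntegrable (by fun_prop) _ _
  rw [prim_sub hu, ← integral_mul_sub_const a, ← integral_mul_sub_const b]
  rcases le_total s t with h | h
  · exact ⟨intervalIntegral.integral_mono_on h (hc _ _ _) (hi _ _) fun r hr => (hab s r hr.1).1,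
      intervalIntegral.integral_mono_on h (hi _ _) (hc _ _ _) fun r hr => (hab s r hr.1).2⟩
  -- Reversing the interval changes the sign of both integrals, and the slope bounds are used with
  -- the arguments exchanged.
  · simp only [intervalIntegral.integral_symm t s]
    constructor <;> refine neg_le_neg ?_
    · refine intervalIntegral.integral_mono_on h (hi _ _) (hc _ _ _) fun r hr => ?_
      linarith [(hab r s hr.2).1]
    · refine intervalIntegral.integral_mono_on h (hc _ _ _) (hi _ _) fun r hr => ?_
      linarith [(hab r s hr.2).2]

end Primitive

/-! ### Strong convexity, gradient and minimizer of the objective -/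

section Objective

variable {n : ℕ} {S : Params n} {Ω : Type*} [MeasurableSpace Ω] {P : Measure Ω}
  {φ : ℕ → Ω → Vec n} {ξ : ℕ → Ω → ℝ}

/-- The expected stochastic gradient `E{φ (u(φᵀx) - η)}`. -/
def meanGrad (S : Params n) (P : Measure Ω) (φ : ℕ → Ω → Vec n) (ξ : ℕ → Ω → ℝ) (xs x : Vec n) :
    Vec n :=
  ∫ ω, stochGrad S.u (obs S φ ξ xs ω 0) x ∂P

namespace Model

theorem uUp_pos (hM : Model S P φ ξ) : 0 < S.uUp := hM.uLow_pos.trans_le hM.uLow_le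

theorem kap_pos (hM : Model S P φ ξ) : 0 < S.kap := mul_pos hM.uLow_pos hM.kappaSigma_pos

theorem abs_u_sub_le (hM : Model S P φ ξ) (t t' : ℝ) : |S.u t - S.u t'| ≤ S.uUp * |t - t'| := by
  have h0 := hM.uLow_pos
  rcases le_total t' t with h | h
  · obtain ⟨h1, h2⟩ := hM.u_bounds t' t h
    rw [abs_of_nonneg (le_trans (mul_nonneg h0.le (sub_nonneg.2 h)) h1),
      abs_of_nonneg (sub_nonneg.2 h)]
    exact h2
  · obtain ⟨h1, h2⟩ := hM.u_bounds t t' h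
    rw [abs_sub_comm, abs_sub_comm t, abs_of_nonneg (le_trans (mul_nonneg h0.le (sub_nonneg.2 h)) h1),
      abs_of_nonneg (sub_nonneg.2 h)]
    exact h2

theorem continuous_u (hM : Model S P φ ξ) : Continuous S.u := by
  have : LipschitzWith S.uUp.toNNReal S.u := LipschitzWith.of_dist_le_mul fun x y => by
    rw [Real.dist_eq, Real.dist_eq, Real.coe_toNNReal _ hM.uUp_pos.le]
    exact hM.abs_u_sub_le x y
  exact this.continuous

theorem memLp_inner (hM : Model S P φ ξ) (x : Vec n) : MemLp (fun ω => inner ℝ (φ 0 ω) x) 2 P :=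
  hM.φ_memLp.inner_const x

theorem memLp_u_inner (hM : Model S P φ ξ) (x : Vec n) :
    MemLp (fun ω => S.u (inner ℝ (φ 0 ω) x)) 2 P := by
  have := hM.prob
  have h1 : MemLp (fun ω => |S.u 0| + S.uUp * |inner ℝ (φ 0 ω) x|) 2 P :=
    (memLp_const |S.u 0|).add ((hM.memLp_inner x).abs.const_mul S.uUp)
  refine h1.mono ?_ (Filter.Eventually.of_forall fun ω => ?_)
  · exact (hM.continuous_u.measurable.comp
      ((hM.φ_measurable 0).inner_const)).aestronglyMeasurable
  · rw [Real.norm_eq_abs, Real.norm_of_nonneg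
      (add_nonneg (abs_nonneg _) (mul_nonneg hM.uUp_pos.le (abs_nonneg _)))]
    have h2 := hM.abs_u_sub_le (inner ℝ (φ 0 ω) x) 0
    rw [sub_zero] at h2
    have h3 := abs_sub_abs_le_abs_sub (S.u (inner ℝ (φ 0 ω) x)) (S.u 0)
    linarith

theorem memLp_response (hM : Model S P φ ξ) (xs : Vec n) :
    MemLp (fun ω => (obs S φ ξ xs ω 0).2) 2 P :=
  (hM.memLp_u_inner xs).add (hM.ξ_memLp.const_mul S.sigma)

theorem integrable_stochGrad (hM : Model S P φ ξ) (xs x : Vec n) :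
    Integrable (fun ω => stochGrad S.u (obs S φ ξ xs ω 0) x) P :=
  memLp_one_iff_integrable.1
    (MemLp.smul (p := 2) (q := 2) hM.φ_memLp ((hM.memLp_u_inner x).sub (hM.memLp_response xs)))

theorem integrable_objective (hM : Model S P φ ξ) (xs x : Vec n) :
    Integrable (fun ω => prim S.u (inner ℝ (obs S φ ξ xs ω 0).1 x)
      - inner ℝ (obs S φ ξ xs ω 0).1 x * (obs S φ ξ xs ω 0).2) P := by
  have := hM.prob
  refine Integrable.sub ?_ ((hM.memLp_inner x).integrable_mul (hM.memLp_response xs))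
  have hc : Continuous (prim S.u) :=
    continuous_iff_continuousAt.2 fun t => (hasDerivAt_prim hM.continuous_u t).continuousAt
  have hi := hM.memLp_inner x
  refine Integrable.mono' (g := fun ω => |S.u 0| * |inner ℝ (φ 0 ω) x|
    + S.uUp / 2 * inner ℝ (φ 0 ω) x ^ 2) ?_ ?_ (Filter.Eventually.of_forall fun ω => ?_)
  · exact ((hi.integrable one_le_two).abs.const_mul _).add (hi.integrable_sq.const_mul _)
  · exact (hc.measurable.comp ((hM.φ_measurable 0).inner_const)).aestronglyMeasurable
  · have h := prim_bounds hM.continuous_u hM.u_bounds 0 (inner ℝ (φ 0 ω) x)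
    have h0 : prim S.u 0 = 0 := by simp [prim]
    rw [h0, sub_zero, sub_zero] at h
    have h1 : prim S.u (inner ℝ (φ 0 ω) x)
        = (prim S.u (inner ℝ (φ 0 ω) x) - S.u 0 * inner ℝ (φ 0 ω) x)
          + S.u 0 * inner ℝ (φ 0 ω) x := by ring
    change ‖prim S.u (inner ℝ (φ 0 ω) x)‖ ≤ _
    rw [Real.norm_eq_abs, h1, add_comm]
    refine (abs_add_le _ _).trans (add_le_add (le_of_eq (abs_mul _ _)) ?_)
    rw [abs_of_nonneg (le_trans (mul_nonneg (by have := hM.uLow_pos; positivity)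
      (sq_nonneg _)) h.1)]
    exact h.2

/-- The remainder of `gObj` at `x` is the expected remainder of the primitive of the activation. -/
theorem gObj_sub (hM : Model S P φ ξ) (xs x z : Vec n) :
    Integrable (fun ω => prim S.u (inner ℝ (φ 0 ω) z) - prim S.u (inner ℝ (φ 0 ω) x)
      - S.u (inner ℝ (φ 0 ω) x) * (inner ℝ (φ 0 ω) z - inner ℝ (φ 0 ω) x)) P ∧
    gObj S P φ ξ xs z - gObj S P φ ξ xs x - inner ℝ (meanGrad S P φ ξ xs x) (z - x)
      = ∫ ω, (prim S.u (inner ℝ (φ 0 ω) z) - prim S.u (inner ℝ (φ 0 ω) x)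
        - S.u (inner ℝ (φ 0 ω) x) * (inner ℝ (φ 0 ω) z - inner ℝ (φ 0 ω) x)) ∂P := by
  have h1 := hM.integrable_objective xs z
  have h2 := hM.integrable_objective xs x
  have h3 := hM.integrable_stochGrad xs x
  have h4 := h3.inner_const (z - x) (𝕜 := ℝ)
  have h5 : inner ℝ (meanGrad S P φ ξ xs x) (z - x)
      = ∫ ω, inner ℝ (stochGrad S.u (obs S φ ξ xs ω 0) x) (z - x) ∂P := by
    rw [real_inner_comm, meanGrad, ← integral_inner h3]
    simp only [real_inner_comm]
  have h6 : ∀ ω, (prim S.u (inner ℝ (obs S φ ξ xs ω 0).1 z)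
      - inner ℝ (obs S φ ξ xs ω 0).1 z * (obs S φ ξ xs ω 0).2)
      - (prim S.u (inner ℝ (obs S φ ξ xs ω 0).1 x)
      - inner ℝ (obs S φ ξ xs ω 0).1 x * (obs S φ ξ xs ω 0).2)
      - inner ℝ (stochGrad S.u (obs S φ ξ xs ω 0) x) (z - x)
      = prim S.u (inner ℝ (φ 0 ω) z) - prim S.u (inner ℝ (φ 0 ω) x)
        - S.u (inner ℝ (φ 0 ω) x) * (inner ℝ (φ 0 ω) z - inner ℝ (φ 0 ω) x) := by
    intro ω
    simp only [stochGrad, obs, real_inner_smul_left, inner_sub_right]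
    ring
  refine ⟨((h1.sub h2).sub h4).congr (Filter.Eventually.of_forall h6), ?_⟩
  rw [h5, gObj, gObj, ← integral_sub h1 h2]
  exact (integral_sub (h1.sub h2) h4).symm.trans
    (integral_congr_ae (Filter.Eventually.of_forall h6))

theorem integral_inner_sq (hM : Model S P φ ξ) (h : Vec n) :
    ∫ ω, inner ℝ (φ 0 ω) h ^ 2 ∂P = ∑ i, ∑ j, h i * Sig P φ i j * h j := by
  have hi : ∀ i, MemLp (fun ω => φ 0 ω i) 2 P := fun i => by
    have := hM.memLp_inner (EuclideanSpace.single i 1)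
    simpa [EuclideanSpace.inner_single_right] using this
  have hij : ∀ i j, Integrable (fun ω => φ 0 ω i * φ 0 ω j) P := fun i j =>
    (hi i).integrable_mul (hi j)
  have h1 : ∀ ω, inner ℝ (φ 0 ω) h ^ 2 = ∑ i, ∑ j, h i * (φ 0 ω i * φ 0 ω j) * h j := by
    intro ω
    rw [PiLp.inner_apply, sq, Finset.sum_mul_sum]
    refine Finset.sum_congr rfl fun i _ => Finset.sum_congr rfl fun j _ => ?_
    simp only [RCLike.inner_apply, conj_trivial]
    ring
  simp only [h1]
  rw [integral_finsetSum _ fun i _ => integrable_finsetSum _ fun j _ =>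
    ((hij i j).const_mul _).mul_const _]
  refine Finset.sum_congr rfl fun i _ => ?_
  rw [integral_finsetSum _ fun j _ => ((hij i j).const_mul _).mul_const _]
  refine Finset.sum_congr rfl fun j _ => ?_
  rw [integral_mul_const, integral_const_mul]
  rfl

theorem sigNorm_sq (hM : Model S P φ ξ) (h : Vec n) :
    sigNorm P φ h ^ 2 = ∫ ω, inner ℝ (φ 0 ω) h ^ 2 ∂P := by
  rw [sigNorm, ← hM.integral_inner_sq, Real.sq_sqrt (integral_nonneg fun _ => sq_nonneg _)]

theorem kappaSigma_mul_le (hM : Model S P φ ξ) (h : Vec n) :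
    S.kappaSigma * ‖h‖ ^ 2 ≤ ∫ ω, inner ℝ (φ 0 ω) h ^ 2 ∂P := by
  rw [hM.integral_inner_sq]
  have h1 := hM.Sig_lower.dotProduct_mulVec_nonneg (WithLp.ofLp h)
  have h2 : star (WithLp.ofLp h) ⬝ᵥ ((Sig P φ - S.kappaSigma • (1 : Matrix (Fin n) (Fin n) ℝ)).mulVec
      (WithLp.ofLp h)) = (∑ i, ∑ j, h i * Sig P φ i j * h j) - S.kappaSigma * ‖h‖ ^ 2 := by
    rw [Matrix.sub_mulVec, dotProduct_sub, Matrix.smul_mulVec, Matrix.one_mulVec, dotProduct_smul,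
      EuclideanSpace.norm_sq_eq]
    simp [dotProduct, Matrix.mulVec, Finset.mul_sum, mul_assoc, sq]
  linarith

/-- The pointwise remainder of the primitive is at least `u̲/2 · (φᵀ(z - x))²`; its mean is at least
`u̲ κ_Σ/2 · ‖z - x‖²` by the lower bound on `Σ`. -/
theorem gObj_ge (hM : Model S P φ ξ) (xs x z : Vec n) :
    gObj S P φ ξ xs x + inner ℝ (meanGrad S P φ ξ xs x) (z - x) + S.kap / 2 * ‖z - x‖ ^ 2
      ≤ gObj S P φ ξ xs z := by
  obtain ⟨h1, h2⟩ := hM.gObj_sub xs x z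
  have h3 : ∫ ω, S.uLow / 2 * inner ℝ (φ 0 ω) (z - x) ^ 2 ∂P
      ≤ ∫ ω, (prim S.u (inner ℝ (φ 0 ω) z) - prim S.u (inner ℝ (φ 0 ω) x)
        - S.u (inner ℝ (φ 0 ω) x) * (inner ℝ (φ 0 ω) z - inner ℝ (φ 0 ω) x)) ∂P := by
    refine integral_mono ((hM.memLp_inner (z - x)).integrable_sq.const_mul _) h1 fun ω => ?_
    simp only [inner_sub_right]
    exact (prim_bounds hM.continuous_u hM.u_bounds _ _).1
  rw [integral_const_mul, ← h2] at h3
  have h4 := mul_le_mul_of_nonneg_left (hM.kappaSigma_mul_le (z - x)) hM.uLow_pos.le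
  unfold Params.kap
  linarith

theorem gObj_le (hM : Model S P φ ξ) (xs x z : Vec n) :
    gObj S P φ ξ xs z ≤ gObj S P φ ξ xs x + inner ℝ (meanGrad S P φ ξ xs x) (z - x)
      + S.uUp / 2 * ∫ ω, inner ℝ (φ 0 ω) (z - x) ^ 2 ∂P := by
  obtain ⟨h1, h2⟩ := hM.gObj_sub xs x z
  have h3 : ∫ ω, (prim S.u (inner ℝ (φ 0 ω) z) - prim S.u (inner ℝ (φ 0 ω) x)
        - S.u (inner ℝ (φ 0 ω) x) * (inner ℝ (φ 0 ω) z - inner ℝ (φ 0 ω) x)) ∂P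
      ≤ ∫ ω, S.uUp / 2 * inner ℝ (φ 0 ω) (z - x) ^ 2 ∂P := by
    refine integral_mono h1 ((hM.memLp_inner (z - x)).integrable_sq.const_mul _) fun ω => ?_
    simp only [inner_sub_right]
    exact (prim_bounds hM.continuous_u hM.u_bounds _ _).2
  rw [integral_const_mul, ← h2] at h3
  linarith

theorem integrable_norm_sq (hM : Model S P φ ξ) : Integrable (fun ω => ‖φ 0 ω‖ ^ 2) P :=
  hM.φ_memLp.norm.integrable_sq

/-- The first-order remainder is squeezed between `0` and a multiple of `‖h‖²`, so no
differentiation under the integral sign is needed. -/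
theorem hasGradientAt_gObj (hM : Model S P φ ξ) (xs x : Vec n) :
    HasGradientAt (gObj S P φ ξ xs) (meanGrad S P φ ξ xs x) x := by
  rw [hasGradientAt_iff_hasFDerivAt, hasFDerivAt_iff_isLittleO_nhds_zero]
  refine Asymptotics.IsBigO.trans_isLittleO (g := fun h : Vec n => ‖h‖ ^ 2) ?_
    (Asymptotics.isLittleO_norm_pow_id one_lt_two)
  refine Asymptotics.IsBigO.of_bound (S.uUp / 2 * ∫ ω, ‖φ 0 ω‖ ^ 2 ∂P)
    (Filter.Eventually.of_forall fun h => ?_)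
  have h1 := hM.gObj_ge xs x (x + h)
  have h2 := hM.gObj_le xs x (x + h)
  rw [add_sub_cancel_left] at h1 h2
  have h3 : ∫ ω, inner ℝ (φ 0 ω) h ^ 2 ∂P ≤ (∫ ω, ‖φ 0 ω‖ ^ 2 ∂P) * ‖h‖ ^ 2 := by
    rw [← integral_mul_const]
    refine integral_mono (hM.memLp_inner h).integrable_sq (hM.integrable_norm_sq.mul_const _)
      fun ω => ?_
    rw [← mul_pow, ← sq_abs]
    exact pow_le_pow_left₀ (abs_nonneg _) (abs_real_inner_le_norm _ _) 2
  have h4 := hM.kap_pos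
  have h5 := mul_le_mul_of_nonneg_left h3 (by have := hM.uUp_pos; positivity : 0 ≤ S.uUp / 2)
  have h6 : 0 ≤ S.kap / 2 * ‖h‖ ^ 2 := by positivity
  rw [InnerProductSpace.toDual_apply_apply, Real.norm_of_nonneg (by linarith),
    Real.norm_of_nonneg (by positivity)]
  linarith

theorem gradient_gObj (hM : Model S P φ ξ) (xs x : Vec n) :
    gradient (gObj S P φ ξ xs) x = meanGrad S P φ ξ xs x :=
  (hM.hasGradientAt_gObj xs x).gradient

theorem continuous_gObj (hM : Model S P φ ξ) (xs : Vec n) : Continuous (gObj S P φ ξ xs) :=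
  continuous_iff_continuousAt.2 fun x => (hM.hasGradientAt_gObj xs x).differentiableAt.continuousAt

/-- At the signal the stochastic gradient reduces to `-σ ξ φ`, a product of independent factors, of
which `ξ` is centred. -/
theorem meanGrad_self (hM : Model S P φ ξ) (xs : Vec n) : meanGrad S P φ ξ xs xs = 0 := by
  have h1 : ∀ ω, stochGrad S.u (obs S φ ξ xs ω 0) xs = (-S.sigma) • (ξ 0 ω • φ 0 ω) := by
    intro ω
    simp only [stochGrad, obs, smul_smul]
    congr 1
    ring
  unfold meanGrad
  simp only [h1]
  rw [integral_smul, (hM.indep_pair 0).symm.integral_fun_smul_eq_smul_integral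
    (hM.ξ_measurable 0).aestronglyMeasurable (hM.φ_measurable 0).aestronglyMeasurable, hM.ξ_mean,
    zero_smul, smul_zero]

theorem gObj_self_add_le (hM : Model S P φ ξ) (xs x : Vec n) :
    gObj S P φ ξ xs xs + S.kap / 2 * ‖x - xs‖ ^ 2 ≤ gObj S P φ ξ xs x := by
  have := hM.gObj_ge xs xs x
  rwa [hM.meanGrad_self, inner_zero_left, add_zero] at this

/-- The mean gradient vanishes at the signal, so strong convexity makes the signal a minimizer of
`g` over the whole space, a fortiori over `X`. -/
theorem gStar_eq (hM : Model S P φ ξ) {xs : Vec n} (hxs : xs ∈ S.X) :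
    gStar S P φ ξ xs = gObj S P φ ξ xs xs := by
  refine IsLeast.csInf_eq ⟨⟨xs, hxs, rfl⟩, ?_⟩
  rintro _ ⟨x, -, rfl⟩
  have h1 := hM.gObj_self_add_le xs x
  have h2 := hM.kap_pos
  have h3 : 0 ≤ S.kap / 2 * ‖x - xs‖ ^ 2 := by positivity
  linarith

end Model

end Objective

/-! ### Smoothness, gradient noise and a single descent step -/

theorem stochGrad_obs {n : ℕ} {S : Params n} {Ω : Type*} {φ : ℕ → Ω → Vec n} {ξ : ℕ → Ω → ℝ}
    (xs x : Vec n) (ω : Ω) (i : ℕ) :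
    stochGrad S.u (obs S φ ξ xs ω i) x
      = (S.u (inner ℝ (φ i ω) x) - S.u (inner ℝ (φ i ω) xs)) • φ i ω
        - (S.sigma * ξ i ω) • φ i ω := by
  simp only [stochGrad, obs]
  rw [← sub_smul]
  congr 1
  ring

section Oracle

variable {n : ℕ} {S : Params n} {Ω : Type*} [MeasurableSpace Ω] {P : Measure Ω}
  {φ : ℕ → Ω → Vec n} {ξ : ℕ → Ω → ℝ}

namespace Model

/-- The descent inequality for an objective with a Lipschitz gradient. -/
theorem gObj_le_of_lipschitz (hM : Model S P φ ξ) {xs x z : Vec n} (hxs : xs ∈ S.signals)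
    (hx : x ∈ S.X) (hz : z ∈ S.X) :
    gObj S P φ ξ xs z ≤ gObj S P φ ξ xs x + inner ℝ (meanGrad S P φ ξ xs x) (z - x)
      + S.nu / 2 * l1 (z - x) ^ 2 := by
  set h := z - x with hh
  have hd : ∀ t : ℝ, HasDerivAt (fun t : ℝ => gObj S P φ ξ xs (x + t • h)
      - t * inner ℝ (meanGrad S P φ ξ xs x) h - S.nu / 2 * t ^ 2 * l1 h ^ 2)
      (inner ℝ (meanGrad S P φ ξ xs (x + t • h) - meanGrad S P φ ξ xs x) h
        - S.nu * t * l1 h ^ 2) t := by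
    intro t
    have h1 : HasDerivAt (fun t : ℝ => x + t • h) h t := by
      simpa using ((hasDerivAt_id t).smul_const h).const_add x
    have h2 : HasDerivAt (fun t : ℝ => gObj S P φ ξ xs (x + t • h))
        (inner ℝ (meanGrad S P φ ξ xs (x + t • h)) h) t := by
      have := (hM.hasGradientAt_gObj xs (x + t • h)).hasFDerivAt.comp_hasDerivAt t h1
      rwa [InnerProductSpace.toDual_apply_apply] at this
    have h3 := (h2.sub ((hasDerivAt_id t).mul_const (inner ℝ (meanGrad S P φ ξ xs x) h))).sub
      (((hasDerivAt_pow 2 t).const_mul (S.nu / 2)).mul_const (l1 h ^ 2))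
    refine h3.congr_deriv ?_
    rw [inner_sub_left]
    push_cast
    ring
  have hanti : AntitoneOn (fun t : ℝ => gObj S P φ ξ xs (x + t • h)
      - t * inner ℝ (meanGrad S P φ ξ xs x) h - S.nu / 2 * t ^ 2 * l1 h ^ 2) (Set.Icc 0 1) := by
    refine antitoneOn_of_deriv_nonpos (convex_Icc 0 1)
      (fun t _ => (hd t).continuousAt.continuousWithinAt)
      (fun t _ => (hd t).differentiableAt.differentiableWithinAt) fun t ht => ?_
    rw [interior_Icc] at ht
    rw [(hd t).deriv]
    have hxt : x + t • h ∈ S.X := by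
      have := hM.convex.add_smul_sub_mem hx hz ⟨ht.1.le, ht.2.le⟩
      exact this
    have h1 := hM.grad_lipschitz xs hxs _ hxt x hx
    rw [hM.gradient_gObj, hM.gradient_gObj, add_sub_cancel_left, l1_smul, abs_of_pos ht.1] at h1
    have h2 := (le_abs_self _).trans (abs_inner_le_linf_mul_l1
      (meanGrad S P φ ξ xs (x + t • h) - meanGrad S P φ ξ xs x) h)
    have h3 := mul_le_mul_of_nonneg_right h1 (l1_nonneg h)
    nlinarith
  have := hanti (Set.left_mem_Icc.2 zero_le_one) (Set.right_mem_Icc.2 zero_le_one) zero_le_one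
  simp only [one_smul, zero_smul, add_zero, one_pow, mul_one, one_mul, zero_mul, sub_zero,
    ne_eq, OfNat.ofNat_ne_zero, not_false_eq_true, zero_pow, mul_zero] at this
  rw [show x + h = z by rw [hh]; abel] at this
  linarith

/-- Near an interior point of `X`, the lower and upper quadratic bounds are compared along a
coordinate vector, for which `‖e‖₂ = ‖e‖₁ = 1`. This also shows that `ν` is positive, which is not
assumed; a signal is needed because the Lipschitz condition is imposed only for signals. -/
theorem kap_le_nu (hM : Model S P φ ξ) {xs : Vec n} (hxs : xs ∈ S.signals) : S.kap ≤ S.nu := by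
  obtain ⟨x, hx⟩ := hM.solid
  have hn := hM.dim
  let e : Vec n := EuclideanSpace.single ⟨0, by omega⟩ 1
  have he : ‖e‖ = 1 := by simp [e]
  have he1 : l1 e = 1 := by
    rw [l1, Finset.sum_eq_single ⟨0, by omega⟩]
    · simp [e]
    · intro i _ hi; simp [e, hi]
    · simp
  obtain ⟨δ, hδ, hball⟩ := Metric.isOpen_iff.1 isOpen_interior x hx
  have hz : x + (δ / 2) • e ∈ S.X := by
    refine interior_subset (hball ?_)
    rw [Metric.mem_ball, dist_eq_norm, add_sub_cancel_left, norm_smul, he, Real.norm_eq_abs,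
      abs_of_pos (by positivity)]
    linarith
  have h1 := hM.gObj_ge xs x (x + (δ / 2) • e)
  have h2 := hM.gObj_le_of_lipschitz hxs (interior_subset hx) hz
  rw [add_sub_cancel_left, norm_smul, he, Real.norm_eq_abs, abs_of_pos (by positivity)] at h1
  rw [add_sub_cancel_left, l1_smul, he1, abs_of_pos (by positivity)] at h2
  have h3 : S.kap * (δ / 2) ^ 2 ≤ S.nu * (δ / 2) ^ 2 := by linarith
  exact le_of_mul_le_mul_right h3 (by positivity)

theorem half_kap_mul_le_gap (hM : Model S P φ ξ) {xs : Vec n} (hxs : xs ∈ S.X) (x : Vec n) :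
    S.kap / 2 * ‖x - xs‖ ^ 2 ≤ gObj S P φ ξ xs x - gStar S P φ ξ xs := by
  have := hM.gObj_self_add_le xs x
  rw [hM.gStar_eq hxs]
  linarith

theorem gap_nonneg (hM : Model S P φ ξ) {xs : Vec n} (hxs : xs ∈ S.X) (x : Vec n) :
    0 ≤ gObj S P φ ξ xs x - gStar S P φ ξ xs :=
  le_trans (by have := hM.kap_pos; positivity) (hM.half_kap_mul_le_gap hxs x)

theorem gap_le (hM : Model S P φ ξ) {xs x : Vec n} (hxs : xs ∈ S.signals) (hx : x ∈ S.X) :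
    gObj S P φ ξ xs x - gStar S P φ ξ xs ≤ S.nu / 2 * l1 (x - xs) ^ 2 := by
  have := hM.gObj_le_of_lipschitz hxs hxs.1 hx
  rw [hM.meanGrad_self, inner_zero_left, add_zero] at this
  rw [hM.gStar_eq hxs.1]
  linarith

theorem nu_pos (hM : Model S P φ ξ) {xs : Vec n} (hxs : xs ∈ S.signals) : 0 < S.nu :=
  hM.kap_pos.trans_le (hM.kap_le_nu hxs)

/-- As the mean gradient vanishes at the signal, each coordinate is `E{(u(φᵀx) - u(φᵀx_*)) φ_j}`;
Cauchy-Schwarz with `E φ_j² ≤ υ` finishes. This accounts for the middle term of the moment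
condition. -/
theorem linf_meanGrad_le (hM : Model S P φ ξ) (xs x : Vec n) :
    linf (meanGrad S P φ ξ xs x) ≤ S.uUp * Real.sqrt S.upsilon * sigNorm P φ (x - xs) := by
  have := hM.prob
  have hU := hM.uUp_pos
  have hs : 0 ≤ sigNorm P φ (x - xs) := Real.sqrt_nonneg _
  refine linf_le (by positivity) fun j => ?_
  have hj : MemLp (fun ω => φ 0 ω j) 2 P := by
    have := hM.memLp_inner (EuclideanSpace.single j 1)
    simpa [EuclideanSpace.inner_single_right] using this
  have hdiff : meanGrad S P φ ξ xs x = ∫ ω, (stochGrad S.u (obs S φ ξ xs ω 0) x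
      - stochGrad S.u (obs S φ ξ xs ω 0) xs) ∂P := by
    rw [integral_sub (hM.integrable_stochGrad xs x) (hM.integrable_stochGrad xs xs)]
    change _ = meanGrad S P φ ξ xs x - meanGrad S P φ ξ xs xs
    rw [hM.meanGrad_self, sub_zero]
  have hcoord : meanGrad S P φ ξ xs x j
      = ∫ ω, (S.u (inner ℝ (φ 0 ω) x) - S.u (inner ℝ (φ 0 ω) xs)) * φ 0 ω j ∂P := by
    have h1 : meanGrad S P φ ξ xs x j
        = inner ℝ (EuclideanSpace.single j (1 : ℝ)) (meanGrad S P φ ξ xs x) := by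
      simp [EuclideanSpace.inner_single_left]
    rw [h1, hdiff]
    refine (integral_inner ((hM.integrable_stochGrad xs x).sub
      (hM.integrable_stochGrad xs xs)) _).symm.trans ?_
    refine integral_congr_ae (Filter.Eventually.of_forall fun ω => ?_)
    simp [stochGrad_obs, EuclideanSpace.inner_single_left]
  have hd : MemLp (fun ω => S.u (inner ℝ (φ 0 ω) x) - S.u (inner ℝ (φ 0 ω) xs)) 2 P :=
    (hM.memLp_u_inner x).sub (hM.memLp_u_inner xs)
  have h2 : ∫ ω, (S.u (inner ℝ (φ 0 ω) x) - S.u (inner ℝ (φ 0 ω) xs)) ^ 2 ∂P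
      ≤ S.uUp ^ 2 * sigNorm P φ (x - xs) ^ 2 := by
    rw [hM.sigNorm_sq, ← integral_const_mul]
    refine integral_mono hd.integrable_sq ((hM.memLp_inner (x - xs)).integrable_sq.const_mul _)
      fun ω => ?_
    have := hM.abs_u_sub_le (inner ℝ (φ 0 ω) x) (inner ℝ (φ 0 ω) xs)
    rw [← inner_sub_right] at this
    calc _ = |S.u (inner ℝ (φ 0 ω) x) - S.u (inner ℝ (φ 0 ω) xs)| ^ 2 := (sq_abs _).symm
      _ ≤ (S.uUp * |inner ℝ (φ 0 ω) (x - xs)|) ^ 2 := pow_le_pow_left₀ (abs_nonneg _) this 2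
      _ = _ := by rw [mul_pow, sq_abs]
  have h3 : ∫ ω, φ 0 ω j ^ 2 ∂P ≤ S.upsilon := by
    refine le_trans (le_of_eq ?_) ((le_abs_self _).trans (hM.Sig_upper j j))
    simp [Sig, sq]
  have hv : 0 ≤ S.upsilon := (integral_nonneg fun ω => sq_nonneg _).trans h3
  rw [hcoord]
  refine abs_le_of_sq_le_sq ?_ (by positivity)
  calc _ ≤ _ := sq_integral_mul_le hd hj
    _ ≤ (S.uUp ^ 2 * sigNorm P φ (x - xs) ^ 2) * S.upsilon := by
        gcongr
    _ = _ := by rw [mul_pow, mul_pow, Real.sq_sqrt hv]; ring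

/-- The stochastic gradient noise has a second moment controlled by the optimality gap. -/
theorem integral_noise_sq_le (hM : Model S P φ ξ) {xs x : Vec n} (hxs : xs ∈ S.signals)
    (hx : x ∈ S.X) :
    Integrable (fun ω => linf (stochGrad S.u (obs S φ ξ xs ω 0) x - meanGrad S P φ ξ xs x) ^ 2) P ∧
    ∫ ω, linf (stochGrad S.u (obs S φ ξ xs ω 0) x - meanGrad S P φ ξ xs x) ^ 2 ∂P
      ≤ S.vk * S.nu * (gObj S P φ ξ xs x - gStar S P φ ξ xs) + S.vk' * S.vs ^ 2 := by
  have := hM.prob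
  obtain ⟨hint, hmom⟩ := hM.moment xs hxs x hx
  have hU := hM.uUp_pos
  have hsig := hM.sigma_nonneg
  have hlm : Measurable fun ω => linf (φ 0 ω) :=
    continuous_linf.measurable.comp (hM.φ_measurable 0)
  have hlin : MemLp (fun ω => linf (φ 0 ω)) 2 P := by
    refine hM.φ_memLp.norm.mono hlm.aestronglyMeasurable (Filter.Eventually.of_forall fun ω => ?_)
    rw [Real.norm_of_nonneg (linf_nonneg _), norm_norm]
    exact linf_le_norm _
  have hA : MemLp (fun ω => linf (φ 0 ω) * |inner ℝ (φ 0 ω) (x - xs)|) 2 P := by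
    rw [memLp_two_iff_integrable_sq]
    · simpa only [mul_pow, sq_abs] using hint
    · exact (hlm.mul ((hM.φ_measurable 0).inner_const.abs)).aestronglyMeasurable
  have hind : IndepFun (fun ω => ξ 0 ω ^ 2) (fun ω => linf (φ 0 ω) ^ 2) P :=
    (hM.indep_pair 0).symm.comp (φ := fun t : ℝ => t ^ 2) (ψ := fun v : Vec n => linf v ^ 2)
      (by fun_prop) (continuous_linf.measurable.pow_const 2)
  have hC2 : Integrable (fun ω => ξ 0 ω ^ 2 * linf (φ 0 ω) ^ 2) P :=
    hind.integrable_mul hM.ξ_memLp.integrable_sq hlin.integrable_sq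
  have hC : MemLp (fun ω => |ξ 0 ω| * linf (φ 0 ω)) 2 P := by
    rw [memLp_two_iff_integrable_sq]
    · simpa only [mul_pow, sq_abs] using hC2
    · exact ((hM.ξ_measurable 0).abs.mul hlm).aestronglyMeasurable
  have hCint : ∫ ω, (|ξ 0 ω| * linf (φ 0 ω)) ^ 2 ∂P ≤ ∫ ω, linf (φ 0 ω) ^ 2 ∂P := by
    simp only [mul_pow, sq_abs]
    rw [hind.integral_fun_mul_eq_mul_integral hM.ξ_memLp.integrable_sq.aestronglyMeasurable
      hlin.integrable_sq.aestronglyMeasurable]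
    have h0 : 0 ≤ ∫ ω, linf (φ 0 ω) ^ 2 ∂P := integral_nonneg fun _ => sq_nonneg _
    nlinarith [hM.ξ_var]
  set b := S.uUp * Real.sqrt S.upsilon * sigNorm P φ (x - xs) with hb
  have hb0 : 0 ≤ b := by
    have : 0 ≤ sigNorm P φ (x - xs) := Real.sqrt_nonneg _
    positivity
  -- The three summands match those of the moment condition: the variation of `u`, the mean
  -- gradient, and the observation noise. It remains to apply the triangle inequality in `L²`.
  have hpt : ∀ ω, linf (stochGrad S.u (obs S φ ξ xs ω 0) x - meanGrad S P φ ξ xs x)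
      ≤ (S.uUp * (linf (φ 0 ω) * |inner ℝ (φ 0 ω) (x - xs)|) + b)
        + S.sigma * (|ξ 0 ω| * linf (φ 0 ω)) := by
    intro ω
    rw [stochGrad_obs, show ∀ a b c : Vec n, a - b - c = (a + -c) + -b by intros; abel]
    refine (linf_add_le _ _).trans (add_le_add ((linf_add_le _ _).trans (add_le_add ?_ ?_)) ?_)
    · rw [linf_smul]
      have := hM.abs_u_sub_le (inner ℝ (φ 0 ω) x) (inner ℝ (φ 0 ω) xs)
      rw [← inner_sub_right] at this
      calc _ ≤ S.uUp * |inner ℝ (φ 0 ω) (x - xs)| * linf (φ 0 ω) :=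
            mul_le_mul_of_nonneg_right this (linf_nonneg _)
        _ = _ := by ring
    · rw [linf_neg]
      exact hM.linf_meanGrad_le xs x
    · rw [linf_neg, linf_smul, abs_mul, abs_of_nonneg hsig, mul_assoc]
  have hAU := hA.const_mul S.uUp
  have hCs := hC.const_mul S.sigma
  have hAb : MemLp (fun ω => S.uUp * (linf (φ 0 ω) * |inner ℝ (φ 0 ω) (x - xs)|) + b) 2 P :=
    hAU.add (memLp_const b)
  have hsum : MemLp (fun ω => (S.uUp * (linf (φ 0 ω) * |inner ℝ (φ 0 ω) (x - xs)|) + b)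
        + S.sigma * (|ξ 0 ω| * linf (φ 0 ω))) 2 P := hAb.add hCs
  have hmeas : AEStronglyMeasurable (fun ω =>
      linf (stochGrad S.u (obs S φ ξ xs ω 0) x - meanGrad S P φ ξ xs x)) P :=
    continuous_linf.comp_aestronglyMeasurable
      ((hM.integrable_stochGrad xs x).aestronglyMeasurable.sub aestronglyMeasurable_const)
  have hz : MemLp (fun ω =>
      linf (stochGrad S.u (obs S φ ξ xs ω 0) x - meanGrad S P φ ξ xs x)) 2 P := by
    refine hsum.mono hmeas (Filter.Eventually.of_forall fun ω => ?_)
    rw [Real.norm_of_nonneg (linf_nonneg _)]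
    exact (hpt ω).trans (le_abs_self _)
  refine ⟨hz.integrable_sq, le_trans ?_ hmom⟩
  refine (integral_mono hz.integrable_sq hsum.integrable_sq fun ω =>
    pow_le_pow_left₀ (linf_nonneg _) (hpt ω) 2).trans ?_
  refine integral_add_sq_le hAb hCs (by positivity) (by positivity) ?_ ?_
  · refine integral_add_sq_le hAU (memLp_const b) (by positivity) hb0 ?_ (by simp)
    simp only [mul_pow, sq_abs]
    rw [integral_const_mul, Real.sq_sqrt (integral_nonneg fun _ => by positivity)]
  · rw [mul_pow, Real.sq_sqrt (integral_nonneg fun _ => sq_nonneg _)]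
    have h1 : ∀ ω, (S.sigma * (|ξ 0 ω| * linf (φ 0 ω))) ^ 2
        = S.sigma ^ 2 * (|ξ 0 ω| * linf (φ 0 ω)) ^ 2 := fun ω => mul_pow _ _ 2
    simp only [h1]
    rw [integral_const_mul, mul_comm]
    exact mul_le_mul_of_nonneg_right hCint (sq_nonneg _)

/-- The inner product of the noise with a fixed vector has mean zero. -/
theorem integral_inner_noise (hM : Model S P φ ξ) (xs x h : Vec n) :
    Integrable (fun ω =>
      inner ℝ (stochGrad S.u (obs S φ ξ xs ω 0) x - meanGrad S P φ ξ xs x) h) P ∧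
    ∫ ω, inner ℝ (stochGrad S.u (obs S φ ξ xs ω 0) x - meanGrad S P φ ξ xs x) h ∂P = 0 := by
  have := hM.prob
  have hi : Integrable (fun ω => stochGrad S.u (obs S φ ξ xs ω 0) x - meanGrad S P φ ξ xs x) P :=
    (hM.integrable_stochGrad xs x).sub (integrable_const _)
  refine ⟨hi.inner_const h, ?_⟩
  simp only [real_inner_comm h]
  rw [integral_inner hi, integral_sub (hM.integrable_stochGrad xs x) (integrable_const _)]
  simp [meanGrad]

/-- One step of mirror descent, before taking expectations. -/
theorem proxStep_le (hM : Model S P φ ξ) {xs x y : Vec n} (hxs : xs ∈ S.signals) (hx : x ∈ S.X)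
    {β : ℝ} (hβ : 2 * S.vk * S.nu ≤ β) (a : Vec n) :
    (gObj S P φ ξ xs (prox S.X β a x y) - gStar S P φ ξ xs)
        + β * bregman y (prox S.X β a x y) xs
      ≤ β * bregman y x xs - inner ℝ (a - meanGrad S P φ ξ xs x) (x - xs)
        + linf (a - meanGrad S P φ ξ xs x) ^ 2 / β := by
  have hnu := hM.nu_pos hxs
  have hvk := hM.one_le_vk
  have hβν : 2 * S.nu ≤ β := by nlinarith
  have hβ0 : 0 < β := by linarith
  rw [hM.gStar_eq hxs.1]
  have hp := prox_mem hM.dim hM.closed ⟨xs, hxs.1⟩ hβ0 a x y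
  have h1 := inner_prox_sub_le hM.dim hM.closed hM.convex hβ0 a x y hxs.1
  have h2 := half_l1_sq_le_bregman hM.dim y x (prox S.X β a x y)
  have h3 := hM.gObj_le_of_lipschitz hxs hx hp
  have h4 := hM.gObj_ge xs x xs
  have h4' : 0 ≤ S.kap / 2 * ‖xs - x‖ ^ 2 := by have := hM.kap_pos; positivity
  set z := prox S.X β a x y
  set G := meanGrad S P φ ξ xs x
  have h5 := (abs_le.1 (abs_inner_le_linf_mul_l1 (a - G) (z - x))).1
  set A := linf (a - G)
  set D := l1 (z - x)
  -- Strong convexity of the divergence provides `β/2 · D²`. One half of it pays for the noise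
  -- through Young's inequality, and the other half, since `β ≥ 2ν`, for the curvature of the
  -- objective.
  have h6 : A * D ≤ A ^ 2 / β + β / 4 * D ^ 2 := by
    have : 0 ≤ (A / β - D / 2) ^ 2 * β := by positivity
    have e : (A / β - D / 2) ^ 2 * β = A ^ 2 / β - A * D + β / 4 * D ^ 2 := by
      field_simp; ring
    linarith
  have e1 : inner ℝ a (z - xs) = inner ℝ (a - G) (z - x) + inner ℝ (a - G) (x - xs)
      + inner ℝ G (z - x) - inner ℝ G (xs - x) := by
    simp only [inner_sub_left, inner_sub_right]
    ring
  have h7 : S.nu / 2 * D ^ 2 ≤ β / 4 * D ^ 2 := by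
    have : 0 ≤ D ^ 2 := sq_nonneg D
    nlinarith
  have h8 := mul_le_mul_of_nonneg_left h2 hβ0.le
  linarith

/-- One step of mirror descent in expectation over a fresh observation. -/
theorem lintegral_proxStep_le (hM : Model S P φ ξ) {xs x y : Vec n} (hxs : xs ∈ S.signals)
    (hx : x ∈ S.X) {β : ℝ} (hβ : 2 * S.vk * S.nu ≤ β) :
    ∫⁻ ω, ENNReal.ofReal
        ((gObj S P φ ξ xs (prox S.X β (stochGrad S.u (obs S φ ξ xs ω 0) x) x y)
            - gStar S P φ ξ xs)
          + β * bregman y (prox S.X β (stochGrad S.u (obs S φ ξ xs ω 0) x) x y) xs) ∂P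
      ≤ ENNReal.ofReal (β * bregman y x xs
          + (1 / 2 * (gObj S P φ ξ xs x - gStar S P φ ξ xs) + S.vk' * S.vs ^ 2 / β)) := by
  have := hM.prob
  have hnu := hM.nu_pos hxs
  have hvk := hM.one_le_vk
  have hβ0 : 0 < β := by nlinarith
  obtain ⟨hn1, hn2⟩ := hM.integral_noise_sq_le hxs hx
  obtain ⟨hi1, hi2⟩ := hM.integral_inner_noise xs x (x - xs)
  have hd1 := hn1.div_const β
  have hc : Integrable (fun ω => β * bregman y x xs
      - inner ℝ (stochGrad S.u (obs S φ ξ xs ω 0) x - meanGrad S P φ ξ xs x) (x - xs)) P :=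
    (integrable_const _).sub hi1
  have hstep := fun ω => hM.proxStep_le (y := y) hxs hx hβ (stochGrad S.u (obs S φ ξ xs ω 0) x)
  have hle : ∫⁻ ω, ENNReal.ofReal
        ((gObj S P φ ξ xs (prox S.X β (stochGrad S.u (obs S φ ξ xs ω 0) x) x y)
            - gStar S P φ ξ xs)
          + β * bregman y (prox S.X β (stochGrad S.u (obs S φ ξ xs ω 0) x) x y) xs) ∂P
      ≤ ENNReal.ofReal (∫ ω, (β * bregman y x xs
        - inner ℝ (stochGrad S.u (obs S φ ξ xs ω 0) x - meanGrad S P φ ξ xs x) (x - xs)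
        + linf (stochGrad S.u (obs S φ ξ xs ω 0) x - meanGrad S P φ ξ xs x) ^ 2 / β) ∂P) := by
    refine le_of_le_of_eq (lintegral_mono fun ω => ENNReal.ofReal_le_ofReal (hstep ω))
      (ofReal_integral_eq_lintegral_ofReal (hc.add hd1) ?_).symm
    refine Filter.Eventually.of_forall fun ω => le_trans ?_ (hstep ω)
    exact add_nonneg (hM.gap_nonneg hxs.1 _) (mul_nonneg hβ0.le (bregman_nonneg hM.dim _ _ _))
  refine hle.trans (ENNReal.ofReal_le_ofReal ?_)
  rw [integral_add hc hd1, integral_sub (integrable_const _) hi1, hi2, integral_div]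
  simp only [integral_const, probReal_univ, smul_eq_mul, one_mul, sub_zero]
  have h1 : (∫ ω, linf (stochGrad S.u (obs S φ ξ xs ω 0) x - meanGrad S P φ ξ xs x) ^ 2 ∂P) / β
      ≤ (S.vk * S.nu * (gObj S P φ ξ xs x - gStar S P φ ξ xs) + S.vk' * S.vs ^ 2) / β := by
    gcongr
  rw [add_div] at h1
  -- This is the use of `β ≥ 2ϰν`: the part of the noise proportional to the gap is at most half of
  -- the gap.
  have h2 : S.vk * S.nu * (gObj S P φ ξ xs x - gStar S P φ ξ xs) / β
      ≤ 1 / 2 * (gObj S P φ ξ xs x - gStar S P φ ξ xs) := by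
    rw [div_le_iff₀ hβ0]
    nlinarith [hM.gap_nonneg hxs.1 x]
  linarith

end Model

end Oracle

/-! ### Independence of disjoint groups of observations -/

section Data

variable {n : ℕ} {S : Params n} {Ω : Type*} [MeasurableSpace Ω] {P : Measure Ω}
  {φ : ℕ → Ω → Vec n} {ξ : ℕ → Ω → ℝ}

/-- The σ-algebra generated by the pairs `(φ_i, ξ_i)`, `i ∈ T`. -/
@[reducible] def dataSigma {n : ℕ} {Ω : Type*} (φ : ℕ → Ω → Vec n) (ξ : ℕ → Ω → ℝ) (T : Set ℕ) :
    MeasurableSpace Ω :=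
  ⨆ i ∈ T, MeasurableSpace.comap (fun ω => (φ i ω, ξ i ω)) inferInstance

theorem dataSigma_mono {n : ℕ} {Ω : Type*} {φ : ℕ → Ω → Vec n} {ξ : ℕ → Ω → ℝ} {T T' : Set ℕ}
    (h : T ⊆ T') : dataSigma φ ξ T ≤ dataSigma φ ξ T' :=
  biSup_mono h

theorem measurable_pair_dataSigma {n : ℕ} {Ω : Type*} {φ : ℕ → Ω → Vec n} {ξ : ℕ → Ω → ℝ}
    {T : Set ℕ} {i : ℕ} (hi : i ∈ T) :
    Measurable[dataSigma φ ξ T] fun ω => (φ i ω, ξ i ω) := by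
  refine Measurable.mono (comap_measurable _) ?_ le_rfl
  exact le_iSup₂ (f := fun (i : ℕ) (_ : i ∈ T) =>
    MeasurableSpace.comap (fun ω => (φ i ω, ξ i ω)) inferInstance) i hi

/-- The observation as a function of the regressor and the noise. -/
def toObs (S : Params n) (xs : Vec n) (w : Vec n × ℝ) : Obs n :=
  (w.1, S.u (inner ℝ w.1 xs) + S.sigma * w.2)

namespace Model

theorem dataSigma_le (hM : Model S P φ ξ) (T : Set ℕ) : dataSigma φ ξ T ≤ ‹MeasurableSpace Ω› :=
  iSup₂_le fun i _ => ((hM.φ_measurable i).prodMk (hM.ξ_measurable i)).comap_le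

theorem indep_dataSigma (hM : Model S P φ ξ) {T T' : Set ℕ} (h : Disjoint T T') :
    Indep (dataSigma φ ξ T) (dataSigma φ ξ T') P :=
  indep_iSup_of_disjoint (fun i => ((hM.φ_measurable i).prodMk (hM.ξ_measurable i)).comap_le)
    hM.indep h

theorem measurable_toObs (hM : Model S P φ ξ) (xs : Vec n) : Measurable (toObs S xs) := by
  have hu := hM.continuous_u
  have : Continuous (toObs S xs) := by unfold toObs; fun_prop
  exact this.measurable

theorem measurable_obs (hM : Model S P φ ξ) (xs : Vec n) {T : Set ℕ} {i : ℕ} (hi : i ∈ T) :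
    Measurable[dataSigma φ ξ T] fun ω => obs S φ ξ xs ω i :=
  (hM.measurable_toObs xs).comp (measurable_pair_dataSigma hi)

theorem map_pair_eq (hM : Model S P φ ξ) (i : ℕ) :
    P.map (fun ω => (φ i ω, ξ i ω)) = P.map (fun ω => (φ 0 ω, ξ 0 ω)) := by
  have := hM.prob
  have h : ∀ j, P.map (fun ω => (φ j ω, ξ j ω)) = (P.map (φ j)).prod (P.map (ξ j)) := fun j =>
    (indepFun_iff_map_prod_eq_prod_map_map (hM.φ_measurable j).aemeasurable
      (hM.ξ_measurable j).aemeasurable).1 (hM.indep_pair j)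
  rw [h i, h 0, (hM.φ_ident i).map_eq, (hM.ξ_ident i).map_eq]

/-- Integration over a fresh observation with the past frozen. -/
theorem lintegral_fresh (hM : Model S P φ ξ) {E : Type*} [MeasurableSpace E] {k : ℕ} {Y : Ω → E}
    (hY : Measurable[dataSigma φ ξ (Set.Iio k)] Y) {f : E × (Vec n × ℝ) → ℝ≥0∞}
    (hf : Measurable f) :
    ∫⁻ ω, f (Y ω, (φ k ω, ξ k ω)) ∂P = ∫⁻ ω, ∫⁻ ω', f (Y ω, (φ 0 ω', ξ 0 ω')) ∂P ∂P := by
  have := hM.prob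
  have hW : ∀ i, Measurable fun ω => (φ i ω, ξ i ω) := fun i =>
    (hM.φ_measurable i).prodMk (hM.ξ_measurable i)
  have hYm : Measurable Y := hY.mono (hM.dataSigma_le _) le_rfl
  -- `Y` depends only on the pairs with index below `k`, a group disjoint from `{k}`. The rest is
  -- Tonelli's theorem on the product law.
  have hind : IndepFun Y (fun ω => (φ k ω, ξ k ω)) P := by
    rw [IndepFun_iff_Indep]
    refine indep_of_indep_of_le_left (indep_of_indep_of_le_right
      (hM.indep_dataSigma (T := Set.Iio k) (T' := {k}) (by simp)) ?_) hY.comap_le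
    exact (measurable_pair_dataSigma (Set.mem_singleton k)).comap_le
  have hmap := (indepFun_iff_map_prod_eq_prod_map_map hYm.aemeasurable
    (hW k).aemeasurable).1 hind
  calc ∫⁻ ω, f (Y ω, (φ k ω, ξ k ω)) ∂P
      = ∫⁻ q, f q ∂(P.map fun ω => (Y ω, (φ k ω, ξ k ω))) :=
        (lintegral_map hf (hYm.prodMk (hW k))).symm
    _ = ∫⁻ e, ∫⁻ w, f (e, w) ∂(P.map fun ω => (φ 0 ω, ξ 0 ω)) ∂(P.map Y) := by
        have : IsProbabilityMeasure (P.map fun ω => (φ 0 ω, ξ 0 ω)) :=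
          Measure.isProbabilityMeasure_map (hW 0).aemeasurable
        rw [hmap, hM.map_pair_eq, lintegral_prod _ hf.aemeasurable]
    _ = ∫⁻ e, ∫⁻ ω', f (e, (φ 0 ω', ξ 0 ω')) ∂P ∂(P.map Y) := by
        refine lintegral_congr fun e => ?_
        exact lintegral_map (hf.comp (measurable_const.prodMk measurable_id)) (hW 0)
    _ = _ := by
        refine lintegral_map ?_ hYm
        have h2 : Measurable fun q : E × Ω => f (q.1, (φ 0 q.2, ξ 0 q.2)) :=
          hf.comp (measurable_fst.prodMk ((hW 0).comp measurable_snd))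
        exact h2.lintegral_prod_right'

end Model

end Data

/-! ### One stage of mirror descent -/

section Stage

variable {n : ℕ} {S : Params n} {Ω : Type*} [MeasurableSpace Ω] {P : Measure Ω}
  {φ : ℕ → Ω → Vec n} {ξ : ℕ → Ω → ℝ}

namespace Model

theorem measurable_smdIter_obs (hM : Model S P φ ξ) (xs : Vec n) {β : ℝ} (hβ : 0 < β) {T : Set ℕ}
    {y : Ω → Vec n} (hy : Measurable[dataSigma φ ξ T] y) (k i : ℕ)
    (hT : ∀ j < i, k + j ∈ T) :
    Measurable[dataSigma φ ξ T]
      fun ω => smdIter S.X S.u β (y ω) (drop k (obs S φ ξ xs ω)) i :=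
  @measurable_smdIter n S.X β S.u hM.dim hM.closed hM.convex ⟨_, hM.start⟩ hβ hM.continuous_u Ω
    (dataSigma φ ξ T) y hy (fun ω => drop k (obs S φ ξ xs ω)) i
    fun j hj => hM.measurable_obs xs (hT j hj)

theorem measurable_smdAvg_obs (hM : Model S P φ ξ) (xs : Vec n) {β : ℝ} (hβ : 0 < β) {T : Set ℕ}
    {y : Ω → Vec n} (hy : Measurable[dataSigma φ ξ T] y) (k m : ℕ)
    (hT : ∀ j < m, k + j ∈ T) :
    Measurable[dataSigma φ ξ T]
      fun ω => smdAvg S.X S.u β m (y ω) (drop k (obs S φ ξ xs ω)) :=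
  @measurable_smdAvg n S.X β S.u hM.dim hM.closed hM.convex ⟨_, hM.start⟩ hβ hM.continuous_u Ω
    (dataSigma φ ξ T) y hy (fun ω => drop k (obs S φ ξ xs ω)) m
    fun j hj => hM.measurable_obs xs (hT j hj)

theorem measurable_gap (hM : Model S P φ ξ) (xs : Vec n) :
    Measurable fun x => gObj S P φ ξ xs x - gStar S P φ ξ xs :=
  (hM.continuous_gObj xs).measurable.sub_const _

theorem measurable_ofReal_gap (hM : Model S P φ ξ) (xs : Vec n) {x : Ω → Vec n}
    (hx : Measurable x) :
    Measurable fun ω => ENNReal.ofReal (gObj S P φ ξ xs (x ω) - gStar S P φ ξ xs) :=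
  ((hM.measurable_gap xs).comp hx).ennreal_ofReal

/-- The one-step inequality with the stage start and the current iterate frozen: both are functions
of the first `k + i` pairs, and the step uses pair `k + i`. Lower integrals of nonnegative
quantities spare all integrability questions about the iterates. -/
theorem lintegral_smdIter_succ_le (hM : Model S P φ ξ) {xs : Vec n} (hxs : xs ∈ S.signals) {β : ℝ}
    (hβ : 2 * S.vk * S.nu ≤ β) {k : ℕ} {y : Ω → Vec n}
    (hy : Measurable[dataSigma φ ξ (Set.Iio k)] y) (hyX : ∀ ω, y ω ∈ S.X) (i : ℕ) :
    ∫⁻ ω, ENNReal.ofReal (gObj S P φ ξ xs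
          (smdIter S.X S.u β (y ω) (drop k (obs S φ ξ xs ω)) (i + 1)) - gStar S P φ ξ xs) ∂P
        + ∫⁻ ω, ENNReal.ofReal (β * bregman (y ω)
          (smdIter S.X S.u β (y ω) (drop k (obs S φ ξ xs ω)) (i + 1)) xs) ∂P
      ≤ ∫⁻ ω, ENNReal.ofReal (β * bregman (y ω)
          (smdIter S.X S.u β (y ω) (drop k (obs S φ ξ xs ω)) i) xs) ∂P
        + (ENNReal.ofReal (1 / 2) * ∫⁻ ω, ENNReal.ofReal (gObj S P φ ξ xs
          (smdIter S.X S.u β (y ω) (drop k (obs S φ ξ xs ω)) i) - gStar S P φ ξ xs) ∂P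
        + ENNReal.ofReal (S.vk' * S.vs ^ 2 / β)) := by
  have := hM.prob
  have hnu := hM.nu_pos hxs
  have hvk := hM.one_le_vk
  have hvk' := hM.one_le_vk'
  have hβ0 : 0 < β := by nlinarith
  have hyk := hy.mono (dataSigma_mono (Set.Iio_subset_Iio (Nat.le_add_right k i))) le_rfl
  have hx : Measurable[dataSigma φ ξ (Set.Iio (k + i))]
      fun ω => smdIter S.X S.u β (y ω) (drop k (obs S φ ξ xs ω)) i :=
    hM.measurable_smdIter_obs xs hβ0 hyk k i fun j hj => by simpa using hj
  have hyk1 := hy.mono (dataSigma_mono (Set.Iio_subset_Iio (Nat.le_add_right k (i + 1)))) le_rfl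
  have hx1 : Measurable fun ω => smdIter S.X S.u β (y ω) (drop k (obs S φ ξ xs ω)) (i + 1) :=
    (hM.measurable_smdIter_obs xs hβ0 hyk1 k (i + 1)
      fun j hj => by simpa using hj).mono (hM.dataSigma_le _) le_rfl
  have hx0 := hx.mono (hM.dataSigma_le _) le_rfl
  have hy0 := hy.mono (hM.dataSigma_le _) le_rfl
  have hgm := hM.measurable_gap xs
  have hbm := measurable_bregman hM.dim xs
  rw [← lintegral_add_left (hM.measurable_ofReal_gap xs hx1)]
  have hstep : Measurable fun q : (Vec n × Vec n) × (Vec n × ℝ) =>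
      prox S.X β (stochGrad S.u (toObs S xs q.2) q.1.2) q.1.2 q.1.1 :=
    measurable_proxStep hM.dim hM.closed hM.convex ⟨_, hM.start⟩ hβ0 hM.continuous_u
      ((hM.measurable_toObs xs).comp measurable_snd) (measurable_snd.comp measurable_fst)
      (measurable_fst.comp measurable_fst)
  have hf : Measurable fun q : (Vec n × Vec n) × (Vec n × ℝ) => ENNReal.ofReal
      ((gObj S P φ ξ xs (prox S.X β (stochGrad S.u (toObs S xs q.2) q.1.2) q.1.2 q.1.1)
            - gStar S P φ ξ xs)
          + β * bregman q.1.1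
            (prox S.X β (stochGrad S.u (toObs S xs q.2) q.1.2) q.1.2 q.1.1) xs) := by
    refine ((hgm.comp hstep).add (Measurable.const_mul ?_ β)).ennreal_ofReal
    exact hbm.comp ((measurable_fst.comp measurable_fst).prodMk hstep)
  have hfresh := hM.lintegral_fresh (k := k + i)
    (Y := fun ω => (y ω, smdIter S.X S.u β (y ω) (drop k (obs S φ ξ xs ω)) i))
    (hyk.prodMk hx) hf
  have hL : ∫⁻ ω, (ENNReal.ofReal (gObj S P φ ξ xs
          (smdIter S.X S.u β (y ω) (drop k (obs S φ ξ xs ω)) (i + 1)) - gStar S P φ ξ xs)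
        + ENNReal.ofReal (β * bregman (y ω)
          (smdIter S.X S.u β (y ω) (drop k (obs S φ ξ xs ω)) (i + 1)) xs)) ∂P
      = ∫⁻ ω, ENNReal.ofReal
      ((gObj S P φ ξ xs (prox S.X β (stochGrad S.u (toObs S xs (φ (k + i) ω, ξ (k + i) ω))
          (smdIter S.X S.u β (y ω) (drop k (obs S φ ξ xs ω)) i))
          (smdIter S.X S.u β (y ω) (drop k (obs S φ ξ xs ω)) i) (y ω)) - gStar S P φ ξ xs)
        + β * bregman (y ω) (prox S.X β (stochGrad S.u (toObs S xs (φ (k + i) ω, ξ (k + i) ω))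
          (smdIter S.X S.u β (y ω) (drop k (obs S φ ξ xs ω)) i))
          (smdIter S.X S.u β (y ω) (drop k (obs S φ ξ xs ω)) i) (y ω)) xs) ∂P := by
    refine lintegral_congr fun ω => ?_
    rw [← ENNReal.ofReal_add (hM.gap_nonneg hxs.1 _)
      (mul_nonneg hβ0.le (bregman_nonneg hM.dim _ _ _))]
    rfl
  refine (hL.trans hfresh).le.trans ?_
  have hR : ∫⁻ ω, ENNReal.ofReal (β * bregman (y ω)
          (smdIter S.X S.u β (y ω) (drop k (obs S φ ξ xs ω)) i) xs) ∂P
        + (ENNReal.ofReal (1 / 2) * ∫⁻ ω, ENNReal.ofReal (gObj S P φ ξ xs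
          (smdIter S.X S.u β (y ω) (drop k (obs S φ ξ xs ω)) i) - gStar S P φ ξ xs) ∂P
        + ENNReal.ofReal (S.vk' * S.vs ^ 2 / β))
      = ∫⁻ ω, ENNReal.ofReal (β * bregman (y ω)
          (smdIter S.X S.u β (y ω) (drop k (obs S φ ξ xs ω)) i) xs
        + (1 / 2 * (gObj S P φ ξ xs
          (smdIter S.X S.u β (y ω) (drop k (obs S φ ξ xs ω)) i) - gStar S P φ ξ xs)
          + S.vk' * S.vs ^ 2 / β)) ∂P := by
    rw [← lintegral_const_mul _ (hM.measurable_ofReal_gap xs hx0)]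
    have hc : ENNReal.ofReal (S.vk' * S.vs ^ 2 / β)
        = ∫⁻ _ : Ω, ENNReal.ofReal (S.vk' * S.vs ^ 2 / β) ∂P := by simp
    rw [hc, ← lintegral_add_right _ measurable_const, ← lintegral_add_left]
    · refine lintegral_congr fun ω => ?_
      have h1 := hM.gap_nonneg hxs.1 (smdIter S.X S.u β (y ω) (drop k (obs S φ ξ xs ω)) i)
      have h2 := bregman_nonneg hM.dim (y ω)
        (smdIter S.X S.u β (y ω) (drop k (obs S φ ξ xs ω)) i) xs
      rw [ENNReal.ofReal_add (by positivity) (by positivity),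
        ENNReal.ofReal_add (by positivity) (by positivity), ENNReal.ofReal_mul (p := 1 / 2)
        (by positivity)]
    · exact ((hbm.comp (hy0.prodMk hx0)).const_mul β).ennreal_ofReal
  rw [hR]
  exact lintegral_mono fun ω => hM.lintegral_proxStep_le hxs
    (smdIter_mem hM.dim hM.closed hβ0 (hyX ω) _ i) hβ

/-- Jensen's inequality: in the sum of the tangent bounds at the average, the linear terms cancel.
-/
theorem gap_smdAvg_le (hM : Model S P φ ξ) {xs : Vec n} {β : ℝ} (y : Vec n) (d : ℕ → Obs n)
    {m : ℕ} (hm : 0 < m) :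
    m * (gObj S P φ ξ xs (smdAvg S.X S.u β m y d) - gStar S P φ ξ xs)
      ≤ ∑ i ∈ Finset.Icc 1 m, (gObj S P φ ξ xs (smdIter S.X S.u β y d i) - gStar S P φ ξ xs) := by
  set a := smdAvg S.X S.u β m y d with ha
  have hm' : (m : ℝ) ≠ 0 := by positivity
  have h1 : ∀ i ∈ Finset.Icc 1 m, gObj S P φ ξ xs a - gStar S P φ ξ xs
      + inner ℝ (meanGrad S P φ ξ xs a) (smdIter S.X S.u β y d i - a)
      ≤ gObj S P φ ξ xs (smdIter S.X S.u β y d i) - gStar S P φ ξ xs := by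
    intro i _
    have h2 := hM.gObj_ge xs a (smdIter S.X S.u β y d i)
    have h3 : 0 ≤ S.kap / 2 * ‖smdIter S.X S.u β y d i - a‖ ^ 2 := by
      have := hM.kap_pos; positivity
    linarith
  refine le_trans (le_of_eq ?_) (Finset.sum_le_sum h1)
  rw [Finset.sum_add_distrib, ← inner_sum, Finset.sum_sub_distrib (fun i => smdIter S.X S.u β y d i)]
  have h4 : ∑ i ∈ Finset.Icc 1 m, smdIter S.X S.u β y d i = (m : ℝ) • a := by
    rw [ha, smdAvg, smul_smul, mul_inv_cancel₀ hm', one_smul]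
  rw [h4]
  simp [Nat.cast_smul_eq_nsmul]
  ring

/-- The expected optimality gap after one stage of mirror descent. -/
theorem lintegral_gap_smdAvg_le (hM : Model S P φ ξ) {xs : Vec n} (hxs : xs ∈ S.signals) {β : ℝ}
    (hβ : 2 * S.vk * S.nu ≤ β) {k : ℕ} {y : Ω → Vec n}
    (hy : Measurable[dataSigma φ ξ (Set.Iio k)] y) (hyX : ∀ ω, y ω ∈ S.X) {m : ℕ} (hm : 0 < m) :
    ∫⁻ ω, ENNReal.ofReal (gObj S P φ ξ xs
        (smdAvg S.X S.u β m (y ω) (drop k (obs S φ ξ xs ω))) - gStar S P φ ξ xs) ∂P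
      ≤ ENNReal.ofReal ((2 * β * Theta n + S.nu / 2) / m)
          * ∫⁻ ω, ENNReal.ofReal (l1 (y ω - xs) ^ 2) ∂P
        + ENNReal.ofReal (2 * (S.vk' * S.vs ^ 2) / β) := by
  have := hM.prob
  have hnu := hM.nu_pos hxs
  have hvk := hM.one_le_vk
  have hvk' := hM.one_le_vk'
  have hβ0 : 0 < β := by nlinarith
  have hT : 0 ≤ Theta n := by have := one_lt_log hM.dim; unfold Theta; positivity
  set A : ℕ → ℝ≥0∞ := fun i => ∫⁻ ω, ENNReal.ofReal (gObj S P φ ξ xs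
    (smdIter S.X S.u β (y ω) (drop k (obs S φ ξ xs ω)) i) - gStar S P φ ξ xs) ∂P with hA
  set B : ℕ → ℝ≥0∞ := fun i => ∫⁻ ω, ENNReal.ofReal (β * bregman (y ω)
    (smdIter S.X S.u β (y ω) (drop k (obs S φ ξ xs ω)) i) xs) ∂P with hB
  set h : ℝ≥0∞ := ENNReal.ofReal (1 / 2) with hh
  have hhalf : ∀ a : ℝ≥0∞, a = h * a + h * a := fun a => by
    rw [← add_mul, hh, ← ENNReal.ofReal_add (by norm_num) (by norm_num)]; norm_num
  set c := ENNReal.ofReal (S.vk' * S.vs ^ 2 / β) with hc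
  have hstep : ∀ i, A (i + 1) + B (i + 1) ≤ B i + (h * A i + c) := fun i =>
    hM.lintegral_smdIter_succ_le hxs hβ hy hyX i
  -- The potential is half of the current gap plus `β` times the divergence. A step creates a whole
  -- gap on the left and only half of the old one on the right, so half of every gap can be
  -- collected.
  have hpot : ∀ j : ℕ, h * ∑ i ∈ Finset.Icc 1 j, A i + (h * A j + B j)
      ≤ (h * A 0 + B 0) + j * c := by
    intro j
    induction j with
    | zero => simp
    | succ j ih =>
      rw [Finset.sum_Icc_succ_top (by omega)]
      calc _ = h * ∑ i ∈ Finset.Icc 1 j, A i + ((h * A (j + 1) + h * A (j + 1)) + B (j + 1)) := by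
            ring
        _ = h * ∑ i ∈ Finset.Icc 1 j, A i + (A (j + 1) + B (j + 1)) := by rw [← hhalf]
        _ ≤ h * ∑ i ∈ Finset.Icc 1 j, A i + (B j + (h * A j + c)) :=
            add_le_add le_rfl (hstep j)
        _ = (h * ∑ i ∈ Finset.Icc 1 j, A i + (h * A j + B j)) + c := by ring
        _ ≤ ((h * A 0 + B 0) + j * c) + c := by gcongr
        _ = _ := by push_cast; ring
  -- The initial gap is at most `ν/2 · ‖y - x_*‖₁²`, half of which gives `ν/4`; the initial
  -- divergence is at most `Θ‖y - x_*‖₁²`.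
  have hstart : h * A 0 + B 0 ≤ ENNReal.ofReal (β * Theta n + S.nu / 4)
      * ∫⁻ ω, ENNReal.ofReal (l1 (y ω - xs) ^ 2) ∂P := by
    have hy0 := hy.mono (hM.dataSigma_le _) le_rfl
    have hlm : Measurable fun ω => ENNReal.ofReal (l1 (y ω - xs) ^ 2) :=
      ((continuous_l1.measurable.comp (hy0.sub_const xs)).pow_const 2).ennreal_ofReal
    rw [hA, hB]
    simp only [smdIter]
    rw [← lintegral_const_mul _ (hM.measurable_ofReal_gap xs hy0),
      ← lintegral_add_left ((hM.measurable_ofReal_gap xs hy0).const_mul _),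
      ← lintegral_const_mul _ hlm]
    refine lintegral_mono fun ω => ?_
    have h1 := hM.gap_le hxs (hyX ω)
    have h2 := bregman_self_le hM.dim (y ω) xs
    rw [l1_sub_comm] at h2
    have h3 := hM.gap_nonneg hxs.1 (y ω)
    have h4 := bregman_nonneg hM.dim (y ω) (y ω) xs
    rw [hh, ← ENNReal.ofReal_mul (by norm_num), ← ENNReal.ofReal_add (by positivity)
      (by positivity), ← ENNReal.ofReal_mul (by positivity)]
    refine ENNReal.ofReal_le_ofReal ?_
    nlinarith [mul_le_mul_of_nonneg_left h2 hβ0.le]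
  have havg : (m : ℝ≥0∞) * ∫⁻ ω, ENNReal.ofReal (gObj S P φ ξ xs
        (smdAvg S.X S.u β m (y ω) (drop k (obs S φ ξ xs ω))) - gStar S P φ ξ xs) ∂P
      ≤ ∑ i ∈ Finset.Icc 1 m, A i := by
    rw [hA]
    rw [← lintegral_const_mul' _ _ (ENNReal.natCast_ne_top m), ← lintegral_finsetSum']
    · refine lintegral_mono fun ω => ?_
      rw [← ENNReal.ofReal_natCast, ← ENNReal.ofReal_mul (by positivity),
        ← ENNReal.ofReal_sum_of_nonneg fun i _ => hM.gap_nonneg hxs.1 _]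
      exact ENNReal.ofReal_le_ofReal (hM.gap_smdAvg_le _ _ hm)
    · intro i _
      have hyk := hy.mono (dataSigma_mono (Set.Iio_subset_Iio (Nat.le_add_right k i))) le_rfl
      exact (hM.measurable_ofReal_gap xs ((hM.measurable_smdIter_obs xs hβ0 hyk k i
        fun j hj => by simpa using hj).mono (hM.dataSigma_le _) le_rfl)).aemeasurable
  have htot : h * ((m : ℝ≥0∞) * ∫⁻ ω, ENNReal.ofReal (gObj S P φ ξ xs
        (smdAvg S.X S.u β m (y ω) (drop k (obs S φ ξ xs ω))) - gStar S P φ ξ xs) ∂P)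
      ≤ ENNReal.ofReal (β * Theta n + S.nu / 4)
          * ∫⁻ ω, ENNReal.ofReal (l1 (y ω - xs) ^ 2) ∂P + m * c := by
    refine (mul_le_mul_right havg h).trans (le_trans ?_ ((hpot m).trans (by gcongr)))
    exact le_self_add
  have hm' : (0 : ℝ) < m := by positivity
  have h2 := mul_le_mul_right htot (ENNReal.ofReal (2 / m))
  rw [← mul_assoc, ← mul_assoc, mul_add, ← mul_assoc, hh, hc, ← ENNReal.ofReal_natCast m,
    ← mul_assoc, ← ENNReal.ofReal_mul (by positivity), ← ENNReal.ofReal_mul (by positivity),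
    ← ENNReal.ofReal_mul (by positivity), ← ENNReal.ofReal_mul (by positivity),
    ← ENNReal.ofReal_mul (by positivity)] at h2
  convert h2 using 1
  · rw [show (2 / (m : ℝ) * (1 / 2) * m) = 1 by field_simp]; simp
  · congr 2
    · congr 1; field_simp; ring
    · field_simp

end Model

end Stage

/-! ### Sparsification -/

theorem IsSparse.sub {n s : ℕ} {x y : Vec n} (hx : IsSparse s x) (hy : IsSparse s y) :
    (Finset.univ.filter fun i => (x - y) i ≠ 0).card ≤ 2 * s := by
  classical
  have : (Finset.univ.filter fun i => (x - y) i ≠ 0)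
      ⊆ (Finset.univ.filter fun i => x i ≠ 0) ∪ (Finset.univ.filter fun i => y i ≠ 0) := by
    intro i
    simp only [Finset.mem_filter, Finset.mem_univ, true_and, Finset.mem_union]
    intro h
    by_contra! hc
    exact h (by rw [PiLp.sub_apply, hc.1, hc.2, sub_zero])
  refine (Finset.card_le_card this).trans ((Finset.card_union_le _ _).trans ?_)
  unfold IsSparse at hx hy
  omega

theorem drop_drop {n : ℕ} (a b : ℕ) (d : ℕ → Obs n) : drop a (drop b d) = drop (b + a) d := by
  ext1 i
  simp [drop, add_assoc]

section MultiStage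

variable {n : ℕ} {S : Params n} {Ω : Type*} [MeasurableSpace Ω] {P : Measure Ω}
  {φ : ℕ → Ω → Vec n} {ξ : ℕ → Ω → ℝ}

namespace Model

theorem l1_sp_sub_le (hM : Model S P φ ξ) {xs x : Vec n} (hxs : xs ∈ S.signals) (hx : x ∈ S.X) :
    l1 (S.sp x - xs) ≤ Real.sqrt (2 * S.s) * ‖S.sp x - xs‖ := by
  have h1 := l1_sq_le_card_mul (S.sp x - xs)
  have h2 := (hM.sp_best x hx).2.1.sub hxs.2.1
  refine abs_le_of_sq_le_sq' ?_ (by positivity) |>.2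
  rw [mul_pow, Real.sq_sqrt (by positivity)]
  refine h1.trans (mul_le_mul_of_nonneg_right ?_ (sq_nonneg _))
  exact_mod_cast h2

theorem norm_sp_sub_le (hM : Model S P φ ξ) {xs x : Vec n} (hxs : xs ∈ S.signals) (hx : x ∈ S.X) :
    ‖S.sp x - xs‖ ≤ 2 * ‖x - xs‖ := by
  have h1 := (hM.sp_best x hx).2.2 xs hxs.1 hxs.2.1
  have h2 := norm_sub_le_norm_sub_add_norm_sub (S.sp x) x xs
  rw [norm_sub_rev (S.sp x) x] at h2
  linarith

theorem l1_sp_sub_le_two_mul (hM : Model S P φ ξ) {xs x : Vec n} (hxs : xs ∈ S.signals)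
    (hx : x ∈ S.X) : l1 (S.sp x - xs) ≤ 2 * Real.sqrt (2 * S.s) * ‖x - xs‖ := by
  have h1 := hM.l1_sp_sub_le hxs hx
  have h2 := mul_le_mul_of_nonneg_left (hM.norm_sp_sub_le hxs hx) (Real.sqrt_nonneg (2 * S.s))
  linarith

/-- The factor 16 is `(2√2)²` times 2: two from replacing a point by its nearest sparse point,
`√(2s)` from comparing `ℓ₁` with `ℓ₂` for a difference of two sparse vectors, and `2/(u̲ κ_Σ)` from
strong convexity. -/
theorem l1_sp_sub_sq_le (hM : Model S P φ ξ) {xs x : Vec n} (hxs : xs ∈ S.signals)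
    (hx : x ∈ S.X) :
    l1 (S.sp x - xs) ^ 2 ≤ 16 * S.sbar / S.kap * (gObj S P φ ξ xs x - gStar S P φ ξ xs) := by
  have hk := hM.kap_pos
  have h1 := pow_le_pow_left₀ (l1_nonneg _) (hM.l1_sp_sub_le_two_mul hxs hx) 2
  rw [mul_pow, mul_pow, Real.sq_sqrt (by positivity)] at h1
  have h2 := hM.half_kap_mul_le_gap hxs.1 x
  have h3 := hM.s_le
  calc _ ≤ _ := h1
    _ ≤ 8 * S.sbar * ‖x - xs‖ ^ 2 := by
        have : 0 ≤ ‖x - xs‖ ^ 2 := sq_nonneg _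
        nlinarith
    _ = 16 * S.sbar / S.kap * (S.kap / 2 * ‖x - xs‖ ^ 2) := by field_simp; ring
    _ ≤ _ := by
        have := hM.one_le_sbar
        gcongr

theorem m0_pos (hM : Model S P φ ξ) {xs : Vec n} (hxs : xs ∈ S.signals) : 0 < S.m0 := by
  have h1 := hM.nu_pos hxs
  have h2 := hM.kap_pos
  have h3 := hM.one_le_sbar
  have h4 := one_lt_log hM.dim
  have h5 := hM.one_le_vk
  unfold Params.m0
  rw [Nat.ceil_pos]
  positivity

theorem mA_pos (hM : Model S P φ ξ) {xs : Vec n} (hxs : xs ∈ S.signals) (k : ℕ) : 0 < S.mA k := by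
  have h1 := hM.nu_pos hxs
  have h2 := hM.kap_pos
  have h3 := hM.one_le_sbar
  have h4 := one_lt_log hM.dim
  have h5 := hM.one_le_vk
  unfold Params.mA Theta
  rw [Nat.ceil_pos]
  positivity

theorem beta0_pos (hM : Model S P φ ξ) {xs : Vec n} (hxs : xs ∈ S.signals) : 0 < S.beta0 := by
  have h1 := hM.nu_pos hxs
  have h5 := hM.one_le_vk
  unfold Params.beta0
  positivity

theorem betaA_pos (hM : Model S P φ ξ) {xs : Vec n} (hxs : xs ∈ S.signals) (k : ℕ) :
    0 < S.betaA k := by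
  have h1 := hM.nu_pos hxs
  have h5 := hM.one_le_vk
  unfold Params.betaA
  positivity

end Model

/-- The noise-induced level of the squared `ℓ₁` error at the preliminary phase. -/
def noiseLevel (S : Params n) : ℝ :=
  32 * S.sbar * S.vk' * S.vs ^ 2 / (S.kap * S.vk * S.nu)

namespace Model

theorem noiseLevel_nonneg (hM : Model S P φ ξ) {xs : Vec n} (hxs : xs ∈ S.signals) :
    0 ≤ noiseLevel S := by
  have h1 := hM.nu_pos hxs
  have h2 := hM.kap_pos
  have h3 := hM.one_le_sbar
  have h5 := hM.one_le_vk
  have h6 := hM.one_le_vk'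
  unfold noiseLevel
  positivity

/-- A stage of the algorithm contracts the expected squared `ℓ₁` error. -/
theorem stage_le (hM : Model S P φ ξ) {xs : Vec n} (hxs : xs ∈ S.signals) {β : ℝ}
    (hβ : 2 * S.vk * S.nu ≤ β) {k : ℕ} {y : Ω → Vec n}
    (hy : Measurable[dataSigma φ ξ (Set.Iio k)] y) (hyX : ∀ ω, y ω ∈ S.X) {m : ℕ} (hm : 0 < m)
    {r t : ℝ} (hr : ∫⁻ ω, ENNReal.ofReal (l1 (y ω - xs) ^ 2) ∂P ≤ ENNReal.ofReal r) (hr0 : 0 ≤ r)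
    (ht : (2 * β * Theta n + S.nu / 2) / m * r + 2 * (S.vk' * S.vs ^ 2) / β
      ≤ S.kap / (16 * S.sbar) * t) :
    ∫⁻ ω, ENNReal.ofReal (gObj S P φ ξ xs
        (smdAvg S.X S.u β m (y ω) (drop k (obs S φ ξ xs ω))) - gStar S P φ ξ xs) ∂P
      ≤ ENNReal.ofReal (S.kap / (16 * S.sbar) * t) ∧
    ∫⁻ ω, ENNReal.ofReal (l1 (S.sp
        (smdAvg S.X S.u β m (y ω) (drop k (obs S φ ξ xs ω))) - xs) ^ 2) ∂P
      ≤ ENNReal.ofReal t := by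
  have hnu := hM.nu_pos hxs
  have hk := hM.kap_pos
  have hs := hM.one_le_sbar
  have hvk := hM.one_le_vk
  have hvk' := hM.one_le_vk'
  have hβ0 : 0 < β := by nlinarith
  have hT : 0 ≤ Theta n := by have := one_lt_log hM.dim; unfold Theta; positivity
  have h1 : ∫⁻ ω, ENNReal.ofReal (gObj S P φ ξ xs
        (smdAvg S.X S.u β m (y ω) (drop k (obs S φ ξ xs ω))) - gStar S P φ ξ xs) ∂P
      ≤ ENNReal.ofReal (S.kap / (16 * S.sbar) * t) := by
    refine (hM.lintegral_gap_smdAvg_le hxs hβ hy hyX hm).trans ?_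
    refine (add_le_add (mul_le_mul_right hr _) le_rfl).trans ?_
    rw [← ENNReal.ofReal_mul (by positivity), ← ENNReal.ofReal_add (by positivity) (by positivity)]
    exact ENNReal.ofReal_le_ofReal ht
  refine ⟨h1, ?_⟩
  calc _ ≤ ∫⁻ ω, ENNReal.ofReal (16 * S.sbar / S.kap) * ENNReal.ofReal (gObj S P φ ξ xs
        (smdAvg S.X S.u β m (y ω) (drop k (obs S φ ξ xs ω))) - gStar S P φ ξ xs) ∂P := by
        refine lintegral_mono fun ω => ?_
        rw [← ENNReal.ofReal_mul (by positivity)]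
        exact ENNReal.ofReal_le_ofReal (hM.l1_sp_sub_sq_le hxs
          (smdAvg_mem hM.dim hM.closed hM.convex hβ0 (hyX ω) _ hm))
    _ = ENNReal.ofReal (16 * S.sbar / S.kap) * _ :=
        lintegral_const_mul' _ _ ENNReal.ofReal_ne_top
    _ ≤ ENNReal.ofReal (16 * S.sbar / S.kap) * ENNReal.ofReal (S.kap / (16 * S.sbar) * t) := by
        gcongr
    _ = ENNReal.ofReal t := by
        rw [← ENNReal.ofReal_mul (by positivity)]
        congr 1
        field_simp

/-! ### The preliminary phase -/

theorem yPre_mem (hM : Model S P φ ξ) {xs : Vec n} (hxs : xs ∈ S.signals) (d : ℕ → Obs n) (k : ℕ) :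
    S.yPre d k ∈ S.X := by
  induction k with
  | zero => exact hM.start
  | succ k ih =>
    exact (hM.sp_best _ (smdAvg_mem hM.dim hM.closed hM.convex (hM.beta0_pos hxs) ih _
      (hM.m0_pos hxs))).1

theorem xPre_mem (hM : Model S P φ ξ) {xs : Vec n} (hxs : xs ∈ S.signals) (d : ℕ → Obs n) (k : ℕ) :
    S.xPre d k ∈ S.X :=
  smdAvg_mem hM.dim hM.closed hM.convex (hM.beta0_pos hxs) (hM.yPre_mem hxs d _) _ (hM.m0_pos hxs)

theorem measurable_yPre (hM : Model S P φ ξ) {xs : Vec n} (hxs : xs ∈ S.signals) (o k : ℕ) :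
    Measurable[dataSigma φ ξ (Set.Ico o (o + k * S.m0))]
      fun ω => S.yPre (drop o (obs S φ ξ xs ω)) k := by
  induction k with
  | zero => exact @measurable_const _ _ _ (_) S.x0
  | succ k ih =>
    have hsub : Set.Ico o (o + k * S.m0) ⊆ Set.Ico o (o + (k + 1) * S.m0) :=
      Set.Ico_subset_Ico_right (by rw [add_mul]; omega)
    have h := hM.measurable_smdAvg_obs xs (hM.beta0_pos hxs)
      (ih.mono (dataSigma_mono hsub) le_rfl) (o + k * S.m0) S.m0
      fun j hj => ⟨by omega, by rw [add_mul]; omega⟩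
    simp only [Params.yPre, drop_drop]
    exact hM.sp_measurable.comp h

theorem measurable_xPre (hM : Model S P φ ξ) {xs : Vec n} (hxs : xs ∈ S.signals) (o k : ℕ) :
    Measurable[dataSigma φ ξ (Set.Ico o (o + (k + 1) * S.m0))]
      fun ω => S.xPre (drop o (obs S φ ξ xs ω)) (k + 1) := by
  have hsub : Set.Ico o (o + k * S.m0) ⊆ Set.Ico o (o + (k + 1) * S.m0) :=
    Set.Ico_subset_Ico_right (by rw [add_mul]; omega)
  have h := hM.measurable_smdAvg_obs xs (hM.beta0_pos hxs)
    ((hM.measurable_yPre hxs o k).mono (dataSigma_mono hsub) le_rfl) (o + k * S.m0) S.m0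
    fun j hj => ⟨by omega, by rw [add_mul]; omega⟩
  simpa only [Params.xPre, drop_drop, Nat.add_sub_cancel] using h

/-- The length `m₀` is defined so that this is an equality before rounding up. -/
theorem m0_contraction (hM : Model S P φ ξ) {xs : Vec n} (hxs : xs ∈ S.signals) :
    (2 * S.beta0 * Theta n + S.nu / 2) / S.m0 ≤ S.kap / (32 * S.sbar) := by
  have hnu := hM.nu_pos hxs
  have hk := hM.kap_pos
  have hs := hM.one_le_sbar
  have hm : (0 : ℝ) < S.m0 := by exact_mod_cast hM.m0_pos hxs
  rw [div_le_iff₀ hm]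
  have h1 : 16 * S.nu * S.sbar / S.kap * (4 * Real.exp 1 ^ 2 * S.vk * Real.log n + 1) ≤ S.m0 :=
    Nat.le_ceil _
  refine le_trans (le_of_eq ?_) (mul_le_mul_of_nonneg_left h1 (by positivity))
  unfold Params.beta0 Theta
  field_simp
  ring

/-- `noiseLevel` is the level at which the variance term `2ϰ'ς_*²/β₀` equals `κ/(32 s̄)` times it,
`κ = u̲ κ_Σ`. It is therefore the fixed point of the stage recursion `ρ ↦ ρ/2 + noiseLevel/2` for
the squared `ℓ₁` error. -/
theorem preliminary_step (hM : Model S P φ ξ) {xs : Vec n} (hxs : xs ∈ S.signals) (r : ℝ) (hr : 0 ≤ r) :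
    (2 * S.beta0 * Theta n + S.nu / 2) / S.m0 * (r + noiseLevel S)
        + 2 * (S.vk' * S.vs ^ 2) / S.beta0
      ≤ S.kap / (16 * S.sbar) * (r / 2 + noiseLevel S) := by
  have hnu := hM.nu_pos hxs
  have hk := hM.kap_pos
  have hs := hM.one_le_sbar
  have hvk := hM.one_le_vk
  have h1 := mul_le_mul_of_nonneg_right (hM.m0_contraction hxs)
    (add_nonneg hr (hM.noiseLevel_nonneg hxs))
  have h2 : 2 * (S.vk' * S.vs ^ 2) / S.beta0 = S.kap / (32 * S.sbar) * noiseLevel S := by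
    unfold Params.beta0 noiseLevel
    field_simp
  have h3 : S.kap / (16 * S.sbar) * (r / 2 + noiseLevel S)
      = S.kap / (32 * S.sbar) * (r + noiseLevel S) + S.kap / (32 * S.sbar) * noiseLevel S := by
    field_simp; ring
  rw [h2, h3]
  linarith

/-- The offset `o` lets the same bound serve the subsamples of the reliable solutions. -/
theorem preliminary_le (hM : Model S P φ ξ) {xs : Vec n} (hxs : xs ∈ S.signals) (o k : ℕ) :
    ∫⁻ ω, ENNReal.ofReal (l1 (S.yPre (drop o (obs S φ ξ xs ω)) k - xs) ^ 2) ∂P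
      ≤ ENNReal.ofReal (S.R ^ 2 / 2 ^ k + noiseLevel S) ∧
    ∫⁻ ω, ENNReal.ofReal (gObj S P φ ξ xs (S.xPre (drop o (obs S φ ξ xs ω)) (k + 1))
        - gStar S P φ ξ xs) ∂P
      ≤ ENNReal.ofReal (S.kap / (16 * S.sbar) * (S.R ^ 2 / 2 ^ (k + 1) + noiseLevel S)) := by
  have := hM.prob
  have hB := hM.noiseLevel_nonneg hxs
  have key : ∀ k : ℕ, ∫⁻ ω, ENNReal.ofReal (l1 (S.yPre (drop o (obs S φ ξ xs ω)) k - xs) ^ 2) ∂P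
      ≤ ENNReal.ofReal (S.R ^ 2 / 2 ^ k + noiseLevel S) →
    ∫⁻ ω, ENNReal.ofReal (gObj S P φ ξ xs (S.xPre (drop o (obs S φ ξ xs ω)) (k + 1))
        - gStar S P φ ξ xs) ∂P
      ≤ ENNReal.ofReal (S.kap / (16 * S.sbar) * (S.R ^ 2 / 2 ^ (k + 1) + noiseLevel S)) ∧
    ∫⁻ ω, ENNReal.ofReal (l1 (S.yPre (drop o (obs S φ ξ xs ω)) (k + 1) - xs) ^ 2) ∂P
      ≤ ENNReal.ofReal (S.R ^ 2 / 2 ^ (k + 1) + noiseLevel S) := by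
    intro k hk
    have h := hM.stage_le hxs (β := S.beta0) le_rfl (k := o + k * S.m0)
      ((hM.measurable_yPre hxs o k).mono (dataSigma_mono fun i hi => hi.2) le_rfl)
      (fun ω => hM.yPre_mem hxs _ k) (hM.m0_pos hxs) hk (by positivity)
      (t := S.R ^ 2 / 2 ^ (k + 1) + noiseLevel S)
      (by
        refine (hM.preliminary_step hxs _ (by positivity)).trans (le_of_eq ?_)
        rw [pow_succ 2 k, div_div])
    simpa only [Params.yPre, Params.xPre, drop_drop, Nat.add_sub_cancel] using h
  have hall : ∀ k : ℕ, ∫⁻ ω, ENNReal.ofReal (l1 (S.yPre (drop o (obs S φ ξ xs ω)) k - xs) ^ 2) ∂P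
      ≤ ENNReal.ofReal (S.R ^ 2 / 2 ^ k + noiseLevel S) := by
    intro k
    induction k with
    | zero =>
      have h1 : l1 (S.x0 - xs) ^ 2 ≤ S.R ^ 2 := by
        rw [l1_sub_comm]
        exact pow_le_pow_left₀ (l1_nonneg _) hxs.2.2 2
      simp only [Params.yPre, lintegral_const, measure_univ, mul_one, pow_zero, div_one]
      exact ENNReal.ofReal_le_ofReal (by linarith)
    | succ k ih => exact (key k ih).2
  exact ⟨hall k, (key k (hall k)).1⟩

/-! ### The asymptotic phase -/

theorem yAs_mem (hM : Model S P φ ξ) {xs : Vec n} (hxs : xs ∈ S.signals) (N : ℕ) (d : ℕ → Obs n)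
    (k : ℕ) : S.yAs N d k ∈ S.X := by
  induction k with
  | zero => exact hM.yPre_mem hxs d _
  | succ k ih =>
    exact (hM.sp_best _ (smdAvg_mem hM.dim hM.closed hM.convex (hM.betaA_pos hxs _) ih _
      (hM.mA_pos hxs _))).1

theorem xAs_mem (hM : Model S P φ ξ) {xs : Vec n} (hxs : xs ∈ S.signals) (N : ℕ) (d : ℕ → Obs n)
    (k : ℕ) : S.xAs N d k ∈ S.X :=
  smdAvg_mem hM.dim hM.closed hM.convex (hM.betaA_pos hxs _) (hM.yAs_mem hxs N d _) _
    (hM.mA_pos hxs _)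

theorem measurable_yAs (hM : Model S P φ ξ) {xs : Vec n} (hxs : xs ∈ S.signals) (N o k : ℕ) :
    Measurable[dataSigma φ ξ (Set.Ico o (o + (S.K N * S.m0 + ∑ i ∈ Finset.Icc 1 k, S.mA i)))]
      fun ω => S.yAs N (drop o (obs S φ ξ xs ω)) k := by
  induction k with
  | zero =>
    rw [show ∑ i ∈ Finset.Icc 1 0, S.mA i = 0 by simp, add_zero]
    exact hM.measurable_yPre hxs o (S.K N)
  | succ k ih =>
    have hsum := Finset.sum_Icc_succ_top (by omega : 1 ≤ k + 1) S.mA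
    have h := hM.measurable_smdAvg_obs xs (hM.betaA_pos hxs (k + 1))
      (ih.mono (dataSigma_mono (Set.Ico_subset_Ico_right (by omega :
        _ ≤ o + (S.K N * S.m0 + ∑ i ∈ Finset.Icc 1 (k + 1), S.mA i)))) le_rfl)
      (o + (S.K N * S.m0 + ∑ i ∈ Finset.Icc 1 k, S.mA i)) (S.mA (k + 1))
      fun j hj => ⟨by omega, by omega⟩
    simp only [Params.yAs, drop_drop]
    exact hM.sp_measurable.comp h

theorem measurable_xAs (hM : Model S P φ ξ) {xs : Vec n} (hxs : xs ∈ S.signals) (N o k : ℕ) :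
    Measurable[dataSigma φ ξ
        (Set.Ico o (o + (S.K N * S.m0 + ∑ i ∈ Finset.Icc 1 (k + 1), S.mA i)))]
      fun ω => S.xAs N (drop o (obs S φ ξ xs ω)) (k + 1) := by
  have hsum := Finset.sum_Icc_succ_top (by omega : 1 ≤ k + 1) S.mA
  have h := hM.measurable_smdAvg_obs xs (hM.betaA_pos hxs (k + 1))
    ((hM.measurable_yAs hxs N o k).mono (dataSigma_mono (Set.Ico_subset_Ico_right (by omega :
      _ ≤ o + (S.K N * S.m0 + ∑ i ∈ Finset.Icc 1 (k + 1), S.mA i)))) le_rfl)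
    (o + (S.K N * S.m0 + ∑ i ∈ Finset.Icc 1 k, S.mA i)) (S.mA (k + 1))
    fun j hj => ⟨by omega, by omega⟩
  simpa only [Params.xAs, drop_drop, Nat.add_sub_cancel] using h

/-- Write `w` for the variance term, which halves from stage to stage as `β` doubles. Since `m_k`
doubles with `β_k`, the contraction factor stays below `κ/(128 s̄)`, `κ = u̲ κ_Σ`, so the bias costs
at most `w/2`, while the target leaves room for `2w`. -/
theorem asymptotic_step (hM : Model S P φ ξ) {xs : Vec n} (hxs : xs ∈ S.signals) (k : ℕ) :
    (2 * S.betaA (k + 1) * Theta n + S.nu / 2) / S.mA (k + 1) * (2 * noiseLevel S / 2 ^ k)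
        + 2 * (S.vk' * S.vs ^ 2) / S.betaA (k + 1)
      ≤ S.kap / (16 * S.sbar) * (2 * noiseLevel S / 2 ^ (k + 1)) := by
  have hnu := hM.nu_pos hxs
  have hk := hM.kap_pos
  have hs := hM.one_le_sbar
  have hvk := hM.one_le_vk
  have hB := hM.noiseLevel_nonneg hxs
  have hT : 1 ≤ Theta n := by
    have h1 := one_lt_log hM.dim
    have h2 : 2 ≤ Real.exp 1 := by linarith [Real.add_one_le_exp 1]
    unfold Theta
    nlinarith [sq_nonneg (Real.exp 1)]
  have hm : (0 : ℝ) < S.mA (k + 1) := by exact_mod_cast hM.mA_pos hxs _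
  have h1 : 512 * (S.sbar * Theta n * S.nu * S.vk / S.kap) * 2 ^ (k + 1) ≤ S.mA (k + 1) :=
    Nat.le_ceil _
  have h2 : (2 * S.betaA (k + 1) * Theta n + S.nu / 2) / S.mA (k + 1) ≤ S.kap / (128 * S.sbar) := by
    rw [div_le_iff₀ hm]
    refine le_trans ?_ (mul_le_mul_of_nonneg_left h1 (by positivity))
    have e : S.kap / (128 * S.sbar) * (512 * (S.sbar * Theta n * S.nu * S.vk / S.kap) * 2 ^ (k + 1))
        = 4 * (S.nu * Theta n * S.vk * 2 ^ (k + 1)) := by field_simp; ring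
    rw [e]
    unfold Params.betaA
    have h3 : S.nu ≤ S.nu * (Theta n * S.vk * 2 ^ (k + 1)) := by
      refine le_mul_of_one_le_right hnu.le ?_
      exact one_le_mul_of_one_le_of_one_le (one_le_mul_of_one_le_of_one_le hT hvk)
        (one_le_pow₀ one_le_two)
    linarith
  have h3 : 2 * (S.vk' * S.vs ^ 2) / S.betaA (k + 1)
      = S.kap / (16 * S.sbar) * (noiseLevel S / 2 ^ (k + 1)) := by
    unfold Params.betaA noiseLevel
    field_simp
    ring
  have h4 := mul_le_mul_of_nonneg_right h2 (by positivity : 0 ≤ 2 * noiseLevel S / 2 ^ k)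
  have h5 : S.kap / (128 * S.sbar) * (2 * noiseLevel S / 2 ^ k)
      = 1 / 2 * (S.kap / (16 * S.sbar) * (noiseLevel S / 2 ^ (k + 1))) := by
    rw [pow_succ]; field_simp; ring
  have h6 : 0 ≤ S.kap / (16 * S.sbar) * (noiseLevel S / 2 ^ (k + 1)) := by positivity
  have h7 : S.kap / (16 * S.sbar) * (2 * noiseLevel S / 2 ^ (k + 1))
      = 2 * (S.kap / (16 * S.sbar) * (noiseLevel S / 2 ^ (k + 1))) := by ring
  rw [h3, h7]
  linarith

/-- Under `hK` the preliminary phase ends with squared error at most `R²/2^K + noiseLevel ≤ 2 ·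
noiseLevel`, which starts the induction. -/
theorem asymptotic_le (hM : Model S P φ ξ) {xs : Vec n} (hxs : xs ∈ S.signals) (N o k : ℕ)
    (hK : S.R ^ 2 / 2 ^ S.K N ≤ noiseLevel S) :
    ∫⁻ ω, ENNReal.ofReal (gObj S P φ ξ xs (S.xAs N (drop o (obs S φ ξ xs ω)) (k + 1))
        - gStar S P φ ξ xs) ∂P
      ≤ ENNReal.ofReal (S.kap / (16 * S.sbar) * (2 * noiseLevel S / 2 ^ (k + 1))) := by
  have hB := hM.noiseLevel_nonneg hxs
  have hnu := hM.nu_pos hxs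
  have hvk := hM.one_le_vk
  have key : ∀ k : ℕ, ∫⁻ ω, ENNReal.ofReal (l1 (S.yAs N (drop o (obs S φ ξ xs ω)) k - xs) ^ 2) ∂P
      ≤ ENNReal.ofReal (2 * noiseLevel S / 2 ^ k) →
    ∫⁻ ω, ENNReal.ofReal (gObj S P φ ξ xs (S.xAs N (drop o (obs S φ ξ xs ω)) (k + 1))
        - gStar S P φ ξ xs) ∂P
      ≤ ENNReal.ofReal (S.kap / (16 * S.sbar) * (2 * noiseLevel S / 2 ^ (k + 1))) ∧
    ∫⁻ ω, ENNReal.ofReal (l1 (S.yAs N (drop o (obs S φ ξ xs ω)) (k + 1) - xs) ^ 2) ∂P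
      ≤ ENNReal.ofReal (2 * noiseLevel S / 2 ^ (k + 1)) := by
    intro k hk
    have hβ : 2 * S.vk * S.nu ≤ S.betaA (k + 1) := by
      have h1 : (2 : ℝ) ≤ 2 ^ (k + 1) := by
        rw [pow_succ]; linarith [one_le_pow₀ (M₀ := ℝ) one_le_two (n := k)]
      have h2 : 0 < S.nu * S.vk := by positivity
      unfold Params.betaA
      nlinarith
    have h := hM.stage_le hxs hβ
      (k := o + (S.K N * S.m0 + ∑ i ∈ Finset.Icc 1 k, S.mA i))
      ((hM.measurable_yAs hxs N o k).mono (dataSigma_mono fun i hi => hi.2) le_rfl)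
      (fun ω => hM.yAs_mem hxs N _ k) (hM.mA_pos hxs (k + 1)) hk (by positivity)
      (hM.asymptotic_step hxs k)
    simpa only [Params.yAs, Params.xAs, drop_drop, Nat.add_sub_cancel] using h
  have hall : ∀ k : ℕ,
      ∫⁻ ω, ENNReal.ofReal (l1 (S.yAs N (drop o (obs S φ ξ xs ω)) k - xs) ^ 2) ∂P
      ≤ ENNReal.ofReal (2 * noiseLevel S / 2 ^ k) := by
    intro k
    induction k with
    | zero =>
      refine (hM.preliminary_le hxs o (S.K N)).1.trans (ENNReal.ofReal_le_ofReal ?_)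
      rw [pow_zero, div_one]
      linarith
    | succ k ih => exact (key k ih).2
  exact (key k (hall k)).1

end Model

end MultiStage

/-! ### Rates -/

/-- Only `ln 2 > 1/2` is used. -/
theorem one_div_two_pow_le_exp {t : ℝ} {K : ℕ} (h : t ≤ K) : 1 / (2 : ℝ) ^ K ≤ Real.exp (-(t / 2)) := by
  have h1 : (2 : ℝ) ^ K = Real.exp (K * Real.log 2) := by
    rw [Real.exp_nat_mul, Real.exp_log (by norm_num)]
  rw [h1, one_div, ← Real.exp_neg]
  refine Real.exp_le_exp.2 ?_
  have h2 := Real.log_two_gt_d9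
  have h3 : (0 : ℝ) ≤ K := Nat.cast_nonneg K
  nlinarith

section Rates

variable {n : ℕ} {S : Params n} {Ω : Type*} [MeasurableSpace Ω] {P : Measure Ω}
  {φ : ℕ → Ω → Vec n} {ξ : ℕ → Ω → ℝ}

/-- The order `ϰ s̄ ν ln n / (u̲ κ_Σ)` of the length of a preliminary stage. -/
def stageScale (S : Params n) : ℝ := S.vk * S.sbar * S.nu * Real.log n / S.kap

/-- The order of the squared `ℓ₁` error achieved with `N` observations. -/
def rateSq (S : Params n) (N : ℕ) : ℝ :=
  S.R ^ 2 * Real.exp (-(N / (4000 * stageScale S)))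
    + S.sbar ^ 2 * S.nu * S.sigma ^ 2 * S.vk' * Real.log n / (S.kap ^ 2 * N)

namespace Model

/-- It allows the additive 1 from rounding stage lengths up to be absorbed into multiples of
`stageScale`. -/
theorem one_le_stageScale (hM : Model S P φ ξ) {xs : Vec n} (hxs : xs ∈ S.signals) :
    1 ≤ stageScale S := by
  have hk := hM.kap_pos
  have h1 := hM.kap_le_nu hxs
  have h2 := one_lt_log hM.dim
  unfold stageScale
  rw [one_le_div hk]
  have h3 : 1 ≤ S.vk * S.sbar := one_le_mul_of_one_le_of_one_le hM.one_le_vk hM.one_le_sbar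
  have h4 : S.nu ≤ S.vk * S.sbar * S.nu := le_mul_of_one_le_left (by linarith) h3
  have h5 : S.vk * S.sbar * S.nu ≤ S.vk * S.sbar * S.nu * Real.log n :=
    le_mul_of_one_le_right (by linarith) h2.le
  linarith

theorem m0_le (hM : Model S P φ ξ) {xs : Vec n} (hxs : xs ∈ S.signals) :
    (S.m0 : ℝ) ≤ 500 * stageScale S := by
  have hk := hM.kap_pos
  have hnu := hM.nu_pos hxs
  have hs := hM.one_le_sbar
  have hvk := hM.one_le_vk
  have hl := one_lt_log hM.dim
  have hq := hM.one_le_stageScale hxs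
  have h1 : (S.m0 : ℝ)
      < 16 * S.nu * S.sbar / S.kap * (4 * Real.exp 1 ^ 2 * S.vk * Real.log n + 1) + 1 :=
    Nat.ceil_lt_add_one (by positivity)
  have he : Real.exp 1 ^ 2 ≤ 7.4 := by
    have := Real.exp_one_lt_d9
    have h0 := Real.exp_pos 1
    nlinarith
  have h2 : 1 ≤ S.vk * Real.log n := one_le_mul_of_one_le_of_one_le hvk hl.le
  have h3 : 4 * Real.exp 1 ^ 2 * S.vk * Real.log n + 1 ≤ 30.6 * (S.vk * Real.log n) := by
    nlinarith
  have h4 := mul_le_mul_of_nonneg_left h3 (by positivity : 0 ≤ 16 * S.nu * S.sbar / S.kap)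
  have h5 : 16 * S.nu * S.sbar / S.kap * (30.6 * (S.vk * Real.log n)) = 489.6 * stageScale S := by
    unfold stageScale; ring
  linarith

theorem mA_le (hM : Model S P φ ξ) {xs : Vec n} (hxs : xs ∈ S.signals) (k : ℕ) :
    (S.mA k : ℝ) ≤ 2000 * stageScale S * 2 ^ k := by
  have hk := hM.kap_pos
  have hnu := hM.nu_pos hxs
  have hs := hM.one_le_sbar
  have hvk := hM.one_le_vk
  have hl := one_lt_log hM.dim
  have hq := hM.one_le_stageScale hxs
  have h1 : (S.mA k : ℝ) < 512 * (S.sbar * Theta n * S.nu * S.vk / S.kap) * 2 ^ k + 1 :=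
    Nat.ceil_lt_add_one (by unfold Theta; positivity)
  have he : Real.exp 1 ^ 2 ≤ 7.4 := by
    have := Real.exp_one_lt_d9
    have h0 := Real.exp_pos 1
    nlinarith
  have h2 : 512 * (S.sbar * Theta n * S.nu * S.vk / S.kap) * 2 ^ k
      = 256 * Real.exp 1 ^ 2 * (stageScale S * 2 ^ k) := by
    unfold stageScale Theta; ring
  have h3 : 1 ≤ stageScale S * 2 ^ k :=
    one_le_mul_of_one_le_of_one_le hq (one_le_pow₀ one_le_two)
  rw [h2] at h1
  nlinarith

theorem sum_mA_le (hM : Model S P φ ξ) {xs : Vec n} (hxs : xs ∈ S.signals) (k : ℕ) :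
    (∑ i ∈ Finset.Icc 1 k, (S.mA i : ℝ)) ≤ 2000 * stageScale S * 2 ^ (k + 1) := by
  have hq := hM.one_le_stageScale hxs
  induction k with
  | zero => simp; positivity
  | succ k ih =>
    rw [Finset.sum_Icc_succ_top (by omega)]
    have := hM.mA_le hxs (k + 1)
    calc _ ≤ 2000 * stageScale S * 2 ^ (k + 1) + 2000 * stageScale S * 2 ^ (k + 1) :=
          add_le_add ih this
      _ = _ := by ring

theorem noiseLevel_pos (hM : Model S P φ ξ) {xs : Vec n} (hxs : xs ∈ S.signals) (hv : S.vs ≠ 0) :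
    0 < noiseLevel S := by
  have h1 := hM.nu_pos hxs
  have h2 := hM.kap_pos
  have h3 := hM.one_le_sbar
  have h5 := hM.one_le_vk
  have h6 := hM.one_le_vk'
  unfold noiseLevel
  positivity

theorem Kbar_eq (hM : Model S P φ ξ) {xs : Vec n} (hxs : xs ∈ S.signals) (hv : S.vs ≠ 0) :
    S.Kbar = max 1 ⌈Real.logb 2 (S.R ^ 2 / noiseLevel S)⌉₊ := by
  have h1 := hM.nu_pos hxs
  have h2 := hM.kap_pos
  have h3 := hM.one_le_sbar
  have h5 := hM.one_le_vk
  have h6 := hM.one_le_vk'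
  unfold Params.Kbar
  congr 3
  unfold noiseLevel
  field_simp

theorem R_sq_div_le (hM : Model S P φ ξ) {xs : Vec n} (hxs : xs ∈ S.signals) (hv : S.vs ≠ 0) :
    S.R ^ 2 / 2 ^ S.Kbar ≤ noiseLevel S := by
  have hB := hM.noiseLevel_pos hxs hv
  by_cases hR : S.R = 0
  · rw [hR]; simpa using hB.le
  have h1 : Real.logb 2 (S.R ^ 2 / noiseLevel S) ≤ S.Kbar := by
    rw [hM.Kbar_eq hxs hv]
    exact (Nat.le_ceil _).trans (by exact_mod_cast le_max_right _ _)
  rw [Real.logb_le_iff_le_rpow one_lt_two (by positivity), Real.rpow_natCast,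
    div_le_iff₀ hB] at h1
  rw [div_le_iff₀ (by positivity)]
  linarith

/-- Minimality of `K̄`: before that many stages, the exponential part of the error still exceeds the
noise floor. -/
theorem noiseLevel_lt (hM : Model S P φ ξ) {xs : Vec n} (hxs : xs ∈ S.signals) (hv : S.vs ≠ 0)
    {j : ℕ} (hj : 1 ≤ j) (hjK : j < S.Kbar) : noiseLevel S < S.R ^ 2 / 2 ^ j := by
  have hB := hM.noiseLevel_pos hxs hv
  rw [hM.Kbar_eq hxs hv, lt_max_iff, Nat.lt_ceil] at hjK
  have h1 : (j : ℝ) < Real.logb 2 (S.R ^ 2 / noiseLevel S) := by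
    rcases hjK with h | h
    · omega
    · exact h
  have hR : S.R ≠ 0 := by
    intro hR
    rw [hR] at h1
    simp at h1
    linarith [Nat.cast_nonneg (α := ℝ) j]
  rw [Real.lt_logb_iff_rpow_lt one_lt_two (by positivity), Real.rpow_natCast,
    lt_div_iff₀ hB] at h1
  rw [lt_div_iff₀ (by positivity)]
  linarith

/-- Everything but `ς_*²` cancels to the coefficient of the `1/N` term; `ς_*² ≤ νσ²` does the rest.
A phase whose length is comparable to `stageScale` thus leaves an error of the order of that term.
-/
theorem noiseLevel_mul_le (hM : Model S P φ ξ) {xs : Vec n} (hxs : xs ∈ S.signals) :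
    noiseLevel S * stageScale S
      ≤ 32 * (S.sbar ^ 2 * S.nu * S.sigma ^ 2 * S.vk' * Real.log n / S.kap ^ 2) := by
  have h1 := hM.nu_pos hxs
  have h2 := hM.kap_pos
  have h3 := hM.one_le_sbar
  have h5 := hM.one_le_vk
  have h6 := hM.one_le_vk'
  have hl := one_lt_log hM.dim
  have e : noiseLevel S * stageScale S
      = 32 * S.sbar ^ 2 * S.vk' * Real.log n / S.kap ^ 2 * S.vs ^ 2 := by
    unfold noiseLevel stageScale
    field_simp
  rw [e]
  calc _ ≤ 32 * S.sbar ^ 2 * S.vk' * Real.log n / S.kap ^ 2 * (S.nu * S.sigma ^ 2) := by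
        have := hM.vs_le
        gcongr
    _ = _ := by ring

/-! ### How many stages fit into the sample -/

theorem K_pos (hM : Model S P φ ξ) {xs : Vec n} (hxs : xs ∈ S.signals) {N : ℕ} (hN : S.m0 ≤ N) :
    0 < S.K N := by
  have h1 : 0 < N / S.m0 := Nat.div_pos hN (hM.m0_pos hxs)
  unfold Params.K
  split_ifs
  · exact h1
  · exact lt_min h1 (lt_of_lt_of_le one_pos (le_max_left _ _))

theorem K_mul_m0_le (N : ℕ) : S.K N * S.m0 ≤ N := by
  have h : S.K N ≤ N / S.m0 := by
    unfold Params.K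
    split_ifs
    · exact le_rfl
    · exact min_le_left _ _
  exact (Nat.mul_le_mul_right _ h).trans (Nat.div_mul_le_self _ _)

theorem sum_mA_K'_le (N : ℕ) : ∑ i ∈ Finset.Icc 1 (S.K' N), S.mA i ≤ S.budget N := by
  unfold Params.K'
  exact Nat.findGreatest_spec (P := fun k => ∑ i ∈ Finset.Icc 1 k, S.mA i ≤ S.budget N)
    (m := 0) (Nat.zero_le _) (by simp)

theorem budget_lt (hM : Model S P φ ξ) {xs : Vec n} (hxs : xs ∈ S.signals) (N : ℕ) :
    S.budget N < ∑ i ∈ Finset.Icc 1 (S.K' N + 1), S.mA i := by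
  by_cases h : S.K' N + 1 ≤ S.budget N
  · have := Nat.findGreatest_is_greatest
      (P := fun k => ∑ i ∈ Finset.Icc 1 k, S.mA i ≤ S.budget N) (Nat.lt_succ_self (S.K' N)) h
    simpa using this
  -- The search for `K'` stops at the budget itself. Nothing is lost, because every stage has length
  -- at least 1.
  · have h1 : ∑ i ∈ Finset.Icc 1 (S.K' N + 1), 1 ≤ ∑ i ∈ Finset.Icc 1 (S.K' N + 1), S.mA i :=
      Finset.sum_le_sum fun i _ => hM.mA_pos hxs i
    simp at h1
    omega

/-- The asymptotic phase is nonempty only if the preliminary phase is complete. -/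
theorem complete_of_K'_ne_zero (hM : Model S P φ ξ) {xs : Vec n} (hxs : xs ∈ S.signals) {N : ℕ}
    (h : S.K' N ≠ 0) : S.vs ≠ 0 ∧ S.Kbar ≤ N / S.m0 := by
  have hb : 0 < S.budget N := by
    have h1 : S.K' N ≤ S.budget N := Nat.findGreatest_le _
    omega
  unfold Params.budget at hb
  split_ifs at hb with hv
  · omega
  refine ⟨hv, ?_⟩
  rw [Nat.le_div_iff_mul_le (hM.m0_pos hxs), mul_comm]
  omega

theorem K_of_complete {N : ℕ} (hv : S.vs ≠ 0) (h : S.Kbar ≤ N / S.m0) : S.K N = S.Kbar := by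
  unfold Params.K
  rw [if_neg hv, min_eq_right h]

/-- The solution therefore depends only on its own block of `N` observations, which makes the
subsample solutions independent. -/
theorem K_mul_add_sum_le (hM : Model S P φ ξ) {xs : Vec n} (hxs : xs ∈ S.signals) (N : ℕ) :
    S.K N * S.m0 + ∑ i ∈ Finset.Icc 1 (S.K' N), S.mA i ≤ N := by
  by_cases h : S.K' N = 0
  · rw [h]
    simpa using K_mul_m0_le N
  · obtain ⟨hv, hK⟩ := hM.complete_of_K'_ne_zero hxs h
    have h1 := sum_mA_K'_le (S := S) N
    rw [K_of_complete hv hK]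
    rw [Params.budget, if_neg hv] at h1
    rw [Nat.le_div_iff_mul_le (hM.m0_pos hxs)] at hK
    have h2 : S.m0 * S.Kbar = S.Kbar * S.m0 := mul_comm _ _
    omega

theorem xHat_mem (hM : Model S P φ ξ) {xs : Vec n} (hxs : xs ∈ S.signals) (N : ℕ) (d : ℕ → Obs n) :
    S.xHat N d ∈ S.X := by
  unfold Params.xHat
  split_ifs
  · exact hM.xPre_mem hxs _ _
  · exact hM.xAs_mem hxs _ _ _

/-- The assumption `m₀ ≤ N` guarantees at least one preliminary stage; otherwise the sparse output
would be the bare starting point. -/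
theorem yHat_eq (hM : Model S P φ ξ) {xs : Vec n} (hxs : xs ∈ S.signals) {N : ℕ} (hN : S.m0 ≤ N)
    (d : ℕ → Obs n) : S.yHat N d = S.sp (S.xHat N d) := by
  unfold Params.yHat Params.xHat
  split_ifs with h
  · rw [h]
    obtain ⟨k, hk⟩ : ∃ k, S.K N = k + 1 := Nat.exists_eq_succ_of_ne_zero (hM.K_pos hxs hN).ne'
    simp only [Params.yAs]
    rw [hk]
    rfl
  · obtain ⟨k, hk⟩ : ∃ k, S.K' N = k + 1 := Nat.exists_eq_succ_of_ne_zero h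
    rw [hk]
    rfl

theorem measurable_xHat (hM : Model S P φ ξ) {xs : Vec n} (hxs : xs ∈ S.signals) {N : ℕ}
    (hN : S.m0 ≤ N) (o : ℕ) :
    Measurable[dataSigma φ ξ (Set.Ico o (o + N))]
      fun ω => S.xHat N (drop o (obs S φ ξ xs ω)) := by
  have hsum := hM.K_mul_add_sum_le hxs N
  unfold Params.xHat
  split_ifs with h
  · obtain ⟨k, hk⟩ : ∃ k, S.K N = k + 1 := Nat.exists_eq_succ_of_ne_zero (hM.K_pos hxs hN).ne'
    have h1 := hM.measurable_xPre hxs o k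
    have h2 := K_mul_m0_le (S := S) N
    rw [hk] at h2 ⊢
    exact h1.mono (dataSigma_mono (Set.Ico_subset_Ico_right (by omega))) le_rfl
  · obtain ⟨k, hk⟩ : ∃ k, S.K' N = k + 1 := Nat.exists_eq_succ_of_ne_zero h
    have h1 := hM.measurable_xAs hxs N o k
    rw [hk] at hsum ⊢
    exact h1.mono (dataSigma_mono (Set.Ico_subset_Ico_right (by omega))) le_rfl

/-- Rounding `N/m₀ ≥ 1` down loses at most a factor 2. -/
theorem div_stageScale_le (hM : Model S P φ ξ) {xs : Vec n} (hxs : xs ∈ S.signals) {N : ℕ}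
    (hN : S.m0 ≤ N) : (N : ℝ) / (1000 * stageScale S) ≤ (N / S.m0 : ℕ) := by
  have hq := hM.one_le_stageScale hxs
  have hm := hM.m0_pos hxs
  have h1 : 0 < N / S.m0 := Nat.div_pos hN hm
  have h2 : N < S.m0 * (N / S.m0 + 1) := Nat.lt_mul_div_succ N hm
  have h3 : (N : ℝ) ≤ 2 * (S.m0 * (N / S.m0 : ℕ)) := by
    have : N ≤ 2 * (S.m0 * (N / S.m0)) := by nlinarith
    exact_mod_cast this
  rw [div_le_iff₀ (by positivity)]
  have h4 := mul_le_mul_of_nonneg_right (hM.m0_le hxs) (Nat.cast_nonneg (α := ℝ) (N / S.m0))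
  linarith

/-! ### Error levels as functions of the sample size -/

theorem preliminary_rate (hM : Model S P φ ξ) {xs : Vec n} (hxs : xs ∈ S.signals) {N : ℕ}
    (hN : S.m0 ≤ N) :
    S.R ^ 2 / 2 ^ (N / S.m0) ≤ S.R ^ 2 * Real.exp (-(N / (4000 * stageScale S))) := by
  have hq := hM.one_le_stageScale hxs
  have h1 := one_div_two_pow_le_exp (hM.div_stageScale_le hxs hN)
  rw [← mul_one_div]
  refine mul_le_mul_of_nonneg_left (h1.trans (Real.exp_le_exp.2 (neg_le_neg ?_))) (sq_nonneg _)
  rw [div_div]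
  exact div_le_div_of_nonneg_left (Nat.cast_nonneg N) (by positivity) (by linarith)

theorem second_term_nonneg (hM : Model S P φ ξ) {xs : Vec n} (hxs : xs ∈ S.signals) (N : ℕ) :
    0 ≤ S.sbar ^ 2 * S.nu * S.sigma ^ 2 * S.vk' * Real.log n / (S.kap ^ 2 * N) := by
  have h1 := hM.nu_pos hxs
  have h2 := hM.kap_pos
  have h6 := hM.one_le_vk'
  have hl := one_lt_log hM.dim
  positivity

/-- The error level at the end of the preliminary phase, in the case when there is no room for
the asymptotic one. -/
theorem noiseLevel_le_of_short (hM : Model S P φ ξ) {xs : Vec n} (hxs : xs ∈ S.signals) {N : ℕ}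
    (hN : S.m0 ≤ N) (hv : S.vs ≠ 0) (hlt : N < 2 * (S.m0 * S.Kbar)) :
    noiseLevel S ≤ 32000 * rateSq S N := by
  have hq := hM.one_le_stageScale hxs
  have hG := hM.second_term_nonneg hxs N
  have hm := hM.m0_pos hxs
  have hN0 : (0 : ℝ) < N := by exact_mod_cast hm.trans_le hN
  have hE : 0 ≤ S.R ^ 2 * Real.exp (-(N / (4000 * stageScale S))) := by positivity
  have hm0 := hM.m0_le hxs
  have hK1 : 1 ≤ S.Kbar := le_max_left _ _
  unfold rateSq
  rcases hK1.eq_or_lt with hK | hK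
  -- If `K̄ = 1`, then `N` is of the order of `stageScale`, and the noise floor is bounded by the
  -- `1/N` term.
  · rw [← hK, mul_one] at hlt
    have h1 : (N : ℝ) ≤ 1000 * stageScale S := by
      have : (N : ℝ) ≤ 2 * S.m0 := by exact_mod_cast hlt.le
      linarith
    have h2 := hM.noiseLevel_mul_le hxs
    have h3 : noiseLevel S ≤ 32000
        * (S.sbar ^ 2 * S.nu * S.sigma ^ 2 * S.vk' * Real.log n / (S.kap ^ 2 * N)) := by
      rw [← div_div, ← mul_div_assoc, le_div_iff₀ hN0]
      have := mul_le_mul_of_nonneg_left h1 (hM.noiseLevel_nonneg hxs)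
      linarith
    linarith
  -- If `K̄ ≥ 2`, the floor lies below `R²/2^{K̄-1}`. Since `N < 2m₀K̄ ≤ 4m₀(K̄ - 1)`, this is an
  -- exponential in `N`.
  · have h1 := hM.noiseLevel_lt hxs hv (j := S.Kbar - 1) (by omega) (by omega)
    have h2 : (N : ℝ) / (2000 * stageScale S) ≤ (S.Kbar - 1 : ℕ) := by
      rw [div_le_iff₀ (by positivity)]
      have h3 : (N : ℝ) ≤ 4 * (S.m0 * (S.Kbar - 1 : ℕ)) := by
        have : S.Kbar ≤ 2 * (S.Kbar - 1) := by omega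
        have : N ≤ 4 * (S.m0 * (S.Kbar - 1)) := by nlinarith
        exact_mod_cast this
      have h4 := mul_le_mul_of_nonneg_right hm0 (Nat.cast_nonneg (α := ℝ) (S.Kbar - 1))
      linarith
    have h3 := one_div_two_pow_le_exp h2
    rw [div_div, show 2000 * stageScale S * 2 = 4000 * stageScale S by ring] at h3
    have h4 := mul_le_mul_of_nonneg_left h3 (sq_nonneg S.R)
    rw [mul_one_div] at h4
    linarith

/-- If less than half of the sample remains after the preliminary phase, the floor itself is already
of the right order. Otherwise the budget is at least `N/2`, and it is smaller than the total length
of `K' + 1` stages, a geometric sum of order `stageScale · 2^{K'}`; so `2^{-K'}` is of order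
`stageScale/N`. -/
theorem asymptotic_rate (hM : Model S P φ ξ) {xs : Vec n} (hxs : xs ∈ S.signals) {N : ℕ}
    (hN : S.m0 ≤ N) (hv : S.vs ≠ 0) :
    2 * noiseLevel S / 2 ^ S.K' N ≤ 1024000 * rateSq S N := by
  have hq := hM.one_le_stageScale hxs
  have hG := hM.second_term_nonneg hxs N
  have hm := hM.m0_pos hxs
  have hN0 : (0 : ℝ) < N := by exact_mod_cast hm.trans_le hN
  have hE : 0 ≤ S.R ^ 2 * Real.exp (-(N / (4000 * stageScale S))) := by positivity
  have hB := hM.noiseLevel_nonneg hxs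
  have hrate : 0 ≤ rateSq S N := add_nonneg hE hG
  rcases lt_or_ge N (2 * (S.m0 * S.Kbar)) with h | h
  · have h1 := hM.noiseLevel_le_of_short hxs hN hv h
    have h2 : 2 * noiseLevel S / 2 ^ S.K' N ≤ 2 * noiseLevel S :=
      div_le_self (by positivity) (one_le_pow₀ one_le_two)
    linarith
  · have h1 := hM.budget_lt hxs N
    rw [Params.budget, if_neg hv] at h1
    have h2 : N ≤ 2 * ∑ i ∈ Finset.Icc 1 (S.K' N + 1), S.mA i := by omega
    have h3 : (N : ℝ) ≤ 2 * ∑ i ∈ Finset.Icc 1 (S.K' N + 1), (S.mA i : ℝ) := by exact_mod_cast h2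
    have h4 := hM.sum_mA_le hxs (S.K' N + 1)
    have h5 : (N : ℝ) ≤ 16000 * stageScale S * 2 ^ S.K' N := by
      rw [pow_add, pow_add] at h4
      linarith
    have h6 := hM.noiseLevel_mul_le hxs
    have h7 : 2 * noiseLevel S / 2 ^ S.K' N ≤ 1024000
        * (S.sbar ^ 2 * S.nu * S.sigma ^ 2 * S.vk' * Real.log n / (S.kap ^ 2 * N)) := by
      rw [← div_div, ← mul_div_assoc, div_le_div_iff₀ (by positivity) hN0]
      calc 2 * noiseLevel S * N ≤ 2 * noiseLevel S * (16000 * stageScale S * 2 ^ S.K' N) := by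
            gcongr
        _ = 32000 * (noiseLevel S * stageScale S) * 2 ^ S.K' N := by ring
        _ ≤ 32000 * (32 * (S.sbar ^ 2 * S.nu * S.sigma ^ 2 * S.vk' * Real.log n / S.kap ^ 2))
            * 2 ^ S.K' N := by gcongr
        _ = _ := by ring
    unfold rateSq
    linarith

/-- The expected optimality gap of the solution computed from the observations
`o + 1, …, o + N`. -/
theorem lintegral_gap_xHat_le (hM : Model S P φ ξ) {xs : Vec n} (hxs : xs ∈ S.signals) {N : ℕ}
    (hN : S.m0 ≤ N) (o : ℕ) :
    ∫⁻ ω, ENNReal.ofReal (gObj S P φ ξ xs (S.xHat N (drop o (obs S φ ξ xs ω)))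
        - gStar S P φ ξ xs) ∂P
      ≤ ENNReal.ofReal (S.kap / (16 * S.sbar) * (1024000 * rateSq S N)) := by
  have hk := hM.kap_pos
  have hs := hM.one_le_sbar
  have hG := hM.second_term_nonneg hxs N
  have hE : 0 ≤ S.R ^ 2 * Real.exp (-(N / (4000 * stageScale S))) := by positivity
  by_cases h : S.K' N = 0
  · obtain ⟨k, hk'⟩ : ∃ k, S.K N = k + 1 :=
      Nat.exists_eq_succ_of_ne_zero (hM.K_pos hxs hN).ne'
    have h1 := (hM.preliminary_le hxs o k).2
    simp only [Params.xHat, h, ↓reduceIte, hk']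
    refine h1.trans (ENNReal.ofReal_le_ofReal (mul_le_mul_of_nonneg_left ?_ (by positivity)))
    rw [← hk']
    by_cases hv : S.vs = 0
    · have h2 := hM.preliminary_rate hxs hN
      have h3 : noiseLevel S = 0 := by simp [noiseLevel, hv]
      rw [h3, show S.K N = N / S.m0 by rw [Params.K, if_pos hv]]
      unfold rateSq
      linarith
    -- If the preliminary phase is cut short, the noise floor is below the exponential term. If it
    -- is complete but no asymptotic stage fits, `asymptotic_rate` with `K' = 0` bounds twice the
    -- floor.
    rcases lt_or_ge (N / S.m0) S.Kbar with hlt | hge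
    · have h2 := hM.preliminary_rate hxs hN
      have h3 := hM.noiseLevel_lt hxs hv (Nat.div_pos hN (hM.m0_pos hxs)) hlt
      rw [show S.K N = N / S.m0 by rw [Params.K, if_neg hv, min_eq_left hlt.le]]
      unfold rateSq
      linarith
    · have h2 := hM.R_sq_div_le hxs hv
      have h3 := hM.asymptotic_rate hxs hN hv
      rw [h, pow_zero, div_one] at h3
      rw [K_of_complete hv hge]
      linarith
  · obtain ⟨hv, hK⟩ := hM.complete_of_K'_ne_zero hxs h
    obtain ⟨k, hk'⟩ : ∃ k, S.K' N = k + 1 := Nat.exists_eq_succ_of_ne_zero h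
    have h3 := hM.asymptotic_rate hxs hN hv
    have h1 := hM.asymptotic_le hxs N o k (by
      rw [K_of_complete hv hK]; exact hM.R_sq_div_le hxs hv)
    simp only [Params.xHat, h, ↓reduceIte]
    rw [hk'] at h3 ⊢
    exact h1.trans (ENNReal.ofReal_le_ofReal (mul_le_mul_of_nonneg_left h3 (by positivity)))

/-- The expected squared Euclidean error of the solution computed from the observations
`o + 1, …, o + N`. -/
theorem lintegral_norm_xHat_le (hM : Model S P φ ξ) {xs : Vec n} (hxs : xs ∈ S.signals) {N : ℕ}
    (hN : S.m0 ≤ N) (o : ℕ) :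
    ∫⁻ ω, ENNReal.ofReal (‖S.xHat N (drop o (obs S φ ξ xs ω)) - xs‖ ^ 2) ∂P
      ≤ ENNReal.ofReal (128000 * rateSq S N / S.sbar) := by
  have hk := hM.kap_pos
  have hs := hM.one_le_sbar
  calc _ ≤ ∫⁻ ω, ENNReal.ofReal (2 / S.kap) * ENNReal.ofReal (gObj S P φ ξ xs
        (S.xHat N (drop o (obs S φ ξ xs ω))) - gStar S P φ ξ xs) ∂P := by
        refine lintegral_mono fun ω => ?_
        rw [← ENNReal.ofReal_mul (by positivity)]
        refine ENNReal.ofReal_le_ofReal ?_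
        have h1 := hM.half_kap_mul_le_gap hxs.1 (S.xHat N (drop o (obs S φ ξ xs ω)))
        have h2 := mul_le_mul_of_nonneg_left h1 (by positivity : 0 ≤ 2 / S.kap)
        refine le_trans (le_of_eq ?_) h2
        field_simp
    _ = ENNReal.ofReal (2 / S.kap) * _ := lintegral_const_mul' _ _ ENNReal.ofReal_ne_top
    _ ≤ ENNReal.ofReal (2 / S.kap)
        * ENNReal.ofReal (S.kap / (16 * S.sbar) * (1024000 * rateSq S N)) := by
        gcongr
        exact hM.lintegral_gap_xHat_le hxs hN o
    _ = _ := by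
        rw [← ENNReal.ofReal_mul (by positivity)]
        congr 1
        field_simp
        ring

end Model

end Rates

/-! ### Median-type aggregation -/

section Aggregation

variable {n L : ℕ} {z : Fin L → Vec n} {x xs : Vec n} {θ : ℝ}

/-- The indices of the points at distance at least `θ` from `xs`. -/
def badSet (z : Fin L → Vec n) (xs : Vec n) (θ : ℝ) : Finset (Fin L) :=
  Finset.univ.filter fun l => θ ≤ ‖z l - xs‖

theorem sum_ite_mem_badSet (a b : ℝ) :
    ∑ l, (if l ∈ badSet z xs θ then a else b)
      = (badSet z xs θ).card * a + (L - (badSet z xs θ).card) * b := by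
  classical
  have h1 : Finset.univ.filter (fun l => l ∈ badSet z xs θ) = badSet z xs θ := by ext; simp
  have h2 : Finset.univ.filter (fun l => l ∉ badSet z xs θ) = (badSet z xs θ)ᶜ := by ext; simp
  rw [Finset.sum_ite, Finset.sum_const, Finset.sum_const, nsmul_eq_mul, nsmul_eq_mul, h1, h2,
    Finset.card_compl, Fintype.card_fin, Nat.cast_sub ((Finset.card_le_univ _).trans (by simp))]

theorem norm_lt_of_notMem_badSet {l : Fin L} (h : l ∉ badSet z xs θ) : ‖z l - xs‖ < θ := by
  simpa [badSet] using h

theorem exists_notMem_badSet (hL : 0 < L) (hB : 4 * (badSet z xs θ).card ≤ L) :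
    ∃ j, j ∉ badSet z xs θ := by
  by_contra! h
  rw [Finset.eq_univ_iff_forall.2 h, Finset.card_univ, Fintype.card_fin] at hB
  omega

/-- Moving from `xs` to `x` changes the distance to a good point by at least `‖x - xs‖ - 2θ` and to
a bad one by at least `-‖x - xs‖`. With at most a quarter of bad points, a large `‖x - xs‖` would
increase the sum. -/
theorem geometric_le (hL : 0 < L) (hB : 4 * (badSet z xs θ).card ≤ L) (hθ : 0 < θ)
    (h : ∑ l, ‖x - z l‖ ≤ ∑ l, ‖xs - z l‖) : ‖x - xs‖ ≤ 5 * θ := by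
  have h1 : ∑ l, (if l ∈ badSet z xs θ then -‖x - xs‖ else ‖x - xs‖ - 2 * θ)
      ≤ ∑ l, (‖x - z l‖ - ‖xs - z l‖) := by
    refine Finset.sum_le_sum fun l _ => ?_
    split_ifs with hl
    · have := norm_sub_le_norm_sub_add_norm_sub xs x (z l)
      rw [norm_sub_rev xs x] at this
      linarith
    · have h2 := norm_lt_of_notMem_badSet hl
      have h3 := norm_sub_le_norm_sub_add_norm_sub x (z l) xs
      rw [norm_sub_rev xs]
      linarith
  rw [sum_ite_mem_badSet, Finset.sum_sub_distrib] at h1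
  have hB' : 4 * ((badSet z xs θ).card : ℝ) ≤ L := by exact_mod_cast hB
  have hL' : (0 : ℝ) < L := by exact_mod_cast hL
  have h0 : (0 : ℝ) ≤ (badSet z xs θ).card := Nat.cast_nonneg _
  by_contra! hc
  nlinarith

/-- The competitor is now a good point `z j` instead of `xs`, which costs one more `θ` on every
summand. The constant 5 is what this case requires. -/
theorem empirical_le (hL : 0 < L) (hB : 4 * (badSet z xs θ).card ≤ L) (hθ : 0 < θ)
    (h : ∀ j, ∑ l, ‖x - z l‖ ≤ ∑ l, ‖z j - z l‖) : ‖x - xs‖ ≤ 5 * θ := by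
  obtain ⟨j, hj⟩ := exists_notMem_badSet hL hB
  have hj' := norm_lt_of_notMem_badSet hj
  have h1 : ∑ l, (if l ∈ badSet z xs θ then -(‖x - xs‖ + θ) else ‖x - xs‖ - 3 * θ)
      ≤ ∑ l, (‖x - z l‖ - ‖z j - z l‖) := by
    refine Finset.sum_le_sum fun l _ => ?_
    split_ifs with hl
    · have h2 := norm_sub_le_norm_sub_add_norm_sub (z j) x (z l)
      have h3 := norm_sub_le_norm_sub_add_norm_sub (z j) xs x
      rw [norm_sub_rev xs x] at h3
      linarith
    · have h2 := norm_lt_of_notMem_badSet hl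
      have h3 := norm_sub_le_norm_sub_add_norm_sub x (z l) xs
      have h4 := norm_sub_le_norm_sub_add_norm_sub (z j) xs (z l)
      rw [norm_sub_rev xs (z l)] at h4
      linarith
  rw [sum_ite_mem_badSet, Finset.sum_sub_distrib] at h1
  have hB' : 4 * ((badSet z xs θ).card : ℝ) ≤ L := by exact_mod_cast hB
  have hL' : (0 : ℝ) < L := by exact_mod_cast hL
  have h0 : (0 : ℝ) ≤ (badSet z xs θ).card := Nat.cast_nonneg _
  have h2 := h j
  by_contra! hc
  nlinarith

theorem bddBelow_orderStat (i : Fin L) (k : ℕ) (hk : 0 < k) :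
    BddBelow {t : ℝ | k ≤ (Finset.univ.filter fun j => j ≠ i ∧ ‖z i - z j‖ ≤ t).card} := by
  refine ⟨0, fun t ht => ?_⟩
  obtain ⟨j, hj⟩ := Finset.card_pos.1 (hk.trans_le ht)
  exact (norm_nonneg _).trans (Finset.mem_filter.1 hj).2.2

/-- Good points lie within `2θ` of each other, so the order statistic of a good point, hence also of
the selected one, is at most `2θ`. More than half of the points are then close to the selected one,
and some of them must be good. The condition on `L` ensures that enough points remain after removing
the bad ones and the point itself. -/
theorem ranked_le (hL : 9 ≤ L) (hB : 4 * (badSet z xs θ).card ≤ L) (hθ : 0 < θ) {i : Fin L}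
    (h : ∀ j, orderStat z (L / 2 + 1) i ≤ orderStat z (L / 2 + 1) j) : ‖z i - xs‖ ≤ 5 * θ := by
  classical
  obtain ⟨j, hj⟩ := exists_notMem_badSet (by omega) hB
  have hj' := norm_lt_of_notMem_badSet hj
  have h1 : orderStat z (L / 2 + 1) j ≤ 2 * θ := by
    refine csInf_le (bddBelow_orderStat j _ (by omega)) ?_
    have hsub : (badSet z xs θ)ᶜ.erase j
        ⊆ Finset.univ.filter fun l => l ≠ j ∧ ‖z j - z l‖ ≤ 2 * θ := by
      intro l hl
      rw [Finset.mem_erase, Finset.mem_compl] at hl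
      refine Finset.mem_filter.2 ⟨Finset.mem_univ _, hl.1, ?_⟩
      have h2 := norm_lt_of_notMem_badSet hl.2
      have h4 := norm_sub_le_norm_sub_add_norm_sub (z j) xs (z l)
      rw [norm_sub_rev xs (z l)] at h4
      linarith
    refine le_trans ?_ (Finset.card_le_card hsub)
    rw [Finset.card_erase_of_mem (Finset.mem_compl.2 hj), Finset.card_compl, Fintype.card_fin]
    omega
  have hne : {t : ℝ | L / 2 + 1
      ≤ (Finset.univ.filter fun j => j ≠ i ∧ ‖z i - z j‖ ≤ t).card}.Nonempty := by
    refine ⟨∑ l, ‖z i - z l‖, ?_⟩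
    have hsub : (Finset.univ : Finset (Fin L)).erase i
        ⊆ Finset.univ.filter fun l => l ≠ i ∧ ‖z i - z l‖ ≤ ∑ l, ‖z i - z l‖ := by
      intro l hl
      refine Finset.mem_filter.2 ⟨Finset.mem_univ _, (Finset.mem_erase.1 hl).1, ?_⟩
      exact Finset.single_le_sum (f := fun l => ‖z i - z l‖) (fun _ _ => norm_nonneg _)
        (Finset.mem_univ l)
    refine le_trans ?_ (Finset.card_le_card hsub)
    rw [Finset.card_erase_of_mem (Finset.mem_univ _), Finset.card_univ, Fintype.card_fin]
    omega
  obtain ⟨t, ht, htθ⟩ := exists_lt_of_csInf_lt hne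
    (show sInf _ < 3 * θ from ((h j).trans h1).trans_lt (by linarith))
  have ht' : L / 2 + 1 ≤ (Finset.univ.filter fun j => j ≠ i ∧ ‖z i - z j‖ ≤ t).card := ht
  obtain ⟨l, hl, hlb⟩ := Finset.exists_mem_notMem_of_card_lt_card
    (show (badSet z xs θ).card < (Finset.univ.filter fun j => j ≠ i ∧ ‖z i - z j‖ ≤ t).card by omega)
  have h2 := norm_lt_of_notMem_badSet hlb
  have h3 := (Finset.mem_filter.1 hl).2.2
  have h4 := norm_sub_le_norm_sub_add_norm_sub (z i) (z l) xs
  linarith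

/-- An aggregate of points most of which are close to `xs` is close to `xs`. -/
theorem IsAggregate.norm_sub_le (hL : 9 ≤ L) (hB : 4 * (badSet z xs θ).card ≤ L) (hθ : 0 < θ)
    {rule : Rule} (h : IsAggregate z x rule) : ‖x - xs‖ ≤ 5 * θ := by
  cases rule with
  | geometric => exact geometric_le (by omega) hB hθ (h xs)
  | empirical => exact empirical_le (by omega) hB hθ h.2
  | ranked =>
    obtain ⟨i, rfl, hi⟩ := h
    exact ranked_le hL hB hθ hi

/-- An aggregate of points of a closed convex set belongs to this set. -/
theorem IsAggregate.mem {X : Set (Vec n)} (hX : IsClosed X) (hconv : Convex ℝ X) (hL : 0 < L)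
    (hz : ∀ l, z l ∈ X) {rule : Rule} (h : IsAggregate z x rule) : x ∈ X := by
  cases rule with
  | empirical => obtain ⟨⟨i, rfl⟩, -⟩ := h; exact hz i
  | ranked => obtain ⟨i, rfl, -⟩ := h; exact hz i
  | geometric =>
    obtain ⟨v, hv, hvx⟩ := exists_norm_eq_iInf_of_complete_convex ⟨_, hz ⟨0, hL⟩⟩
      hX.isComplete hconv x
    rw [norm_eq_iInf_iff_real_inner_le_zero hconv hv] at hvx
    by_contra hx
    have hxv : 0 < ‖x - v‖ := norm_pos_iff.2 (sub_ne_zero.2 fun h => hx (h ▸ hv))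
    -- Projecting a point outside `X` onto `X` strictly decreases its distance to every point of
    -- `X`, so such a point cannot be a geometric median.
    have hlt : ∀ l, ‖v - z l‖ < ‖x - z l‖ := by
      intro l
      refine lt_of_pow_lt_pow_left₀ 2 (norm_nonneg _) ?_
      have h1 := hvx (z l) (hz l)
      have h2 : inner ℝ (x - v) (v - z l) = -inner ℝ (x - v) (z l - v) := by
        rw [← inner_neg_right, neg_sub]
      have h3 := norm_add_sq_real (x - v) (v - z l)
      rw [sub_add_sub_cancel] at h3
      have h4 : 0 < ‖x - v‖ ^ 2 := by positivity
      linarith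
    have := h v
    have h5 : ∑ l, ‖v - z l‖ < ∑ l, ‖x - z l‖ :=
      Finset.sum_lt_sum_of_nonempty ⟨⟨0, hL⟩, Finset.mem_univ _⟩ fun l _ => hlt l
    linarith

end Aggregation

/-! ### Confidence amplification -/

section Amplification

variable {n : ℕ} {S : Params n} {Ω : Type*} [MeasurableSpace Ω] {P : Measure Ω}
  {φ : ℕ → Ω → Vec n} {ξ : ℕ → Ω → ℝ}

namespace Model

/-- Events depending on disjoint groups of observations. -/
theorem measure_biInter_le (hM : Model S P φ ξ) {ι : Type*} {E : ι → Set Ω} {T : ι → Set ℕ}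
    (hE : ∀ j, MeasurableSet[dataSigma φ ξ (T j)] (E j))
    (hT : ∀ i j, i ≠ j → Disjoint (T i) (T j)) {p : ℝ≥0∞} (hp : ∀ j, P (E j) ≤ p)
    (J : Finset ι) : P (⋂ j ∈ J, E j) ≤ p ^ J.card := by
  classical
  have := hM.prob
  induction J using Finset.induction_on with
  | empty => simp
  | insert i J hi ih =>
    rw [Finset.set_biInter_insert, Finset.card_insert_of_notMem hi, pow_succ, mul_comm]
    have hmeas : MeasurableSet[dataSigma φ ξ (⋃ j ∈ J, T j)] (⋂ j ∈ J, E j) :=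
      @Finset.measurableSet_biInter _ _ (_) _ J fun j hj =>
        dataSigma_mono (Set.subset_biUnion_of_mem (u := fun j => T j) hj) _ (hE j)
    have hdisj : Disjoint (T i) (⋃ j ∈ J, T j) := by
      simp only [Set.disjoint_iUnion_right]
      exact fun j hj => hT i j fun h => hi (h ▸ hj)
    rw [(Indep_iff _ _ _).1 (hM.indep_dataSigma hdisj) _ _ (hE i) hmeas]
    exact mul_le_mul' (hp i) ih

theorem measure_many_bad_le (hM : Model S P φ ξ) {L : ℕ} {z : Ω → Fin L → Vec n} {xs : Vec n}
    {θ : ℝ} {T : Fin L → Set ℕ} (hz : ∀ l, Measurable[dataSigma φ ξ (T l)] fun ω => z ω l)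
    (hT : ∀ i j, i ≠ j → Disjoint (T i) (T j))
    (hp : ∀ l, P {ω | θ ≤ ‖z ω l - xs‖} ≤ ENNReal.ofReal (1 / 256)) :
    P {ω | L < 4 * (badSet (z ω) xs θ).card} ≤ ENNReal.ofReal (1 / 2 ^ L) := by
  have hE : ∀ l, MeasurableSet[dataSigma φ ξ (T l)] {ω | θ ≤ ‖z ω l - xs‖} := fun l =>
    hz l (isClosed_le continuous_const (by fun_prop) :
      IsClosed {v : Vec n | θ ≤ ‖v - xs‖}).measurableSet
  have hsub : {ω | L < 4 * (badSet (z ω) xs θ).card}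
      ⊆ ⋃ J ∈ (Finset.univ : Finset (Finset (Fin L))).filter (fun J => L < 4 * J.card),
        ⋂ l ∈ J, {ω | θ ≤ ‖z ω l - xs‖} := by
    intro ω hω
    simp only [Set.mem_iUnion, Set.mem_iInter]
    exact ⟨badSet (z ω) xs θ, Finset.mem_filter.2 ⟨Finset.mem_univ _, hω⟩,
      fun l hl => (Finset.mem_filter.1 hl).2⟩
  refine (measure_mono hsub).trans ((measure_biUnion_finset_le _ _).trans ?_)
  -- As `1/256 = 4^{-4}` and `4|J| > L`, each intersection has probability at most `4^{-L}`; there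
  -- are at most `2^L` sets `J`.
  have hJ : ∀ J ∈ (Finset.univ : Finset (Finset (Fin L))).filter (fun J => L < 4 * J.card),
      P (⋂ l ∈ J, {ω | θ ≤ ‖z ω l - xs‖}) ≤ ENNReal.ofReal ((1 / 4) ^ L) := by
    intro J hJ
    refine (hM.measure_biInter_le hE hT hp J).trans ?_
    rw [← ENNReal.ofReal_pow (by norm_num)]
    refine ENNReal.ofReal_le_ofReal ?_
    rw [show (1 / 256 : ℝ) = (1 / 4) ^ 4 by norm_num, ← pow_mul]
    exact pow_le_pow_of_le_one (by norm_num) (by norm_num) (Finset.mem_filter.1 hJ).2.le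
  refine (Finset.sum_le_sum hJ).trans ?_
  rw [Finset.sum_const, nsmul_eq_mul]
  have hcard : (((Finset.univ : Finset (Finset (Fin L))).filter
      (fun J => L < 4 * J.card)).card : ℝ≥0∞) ≤ ENNReal.ofReal (2 ^ L) := by
    rw [← ENNReal.ofReal_natCast]
    refine ENNReal.ofReal_le_ofReal ?_
    have : ((Finset.univ : Finset (Finset (Fin L))).filter (fun J => L < 4 * J.card)).card ≤ 2 ^ L :=
      (Finset.card_filter_le _ _).trans (by simp)
    exact_mod_cast this
  refine (mul_le_mul_left hcard _).trans (le_of_eq ?_)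
  rw [← ENNReal.ofReal_mul (by positivity), ← mul_pow, ← one_div_pow]
  norm_num

/-- Chebyshev's inequality, the radius being 16 times the bound on the root mean square error. -/
theorem measure_norm_xHat_ge_le (hM : Model S P φ ξ) {xs : Vec n} (hxs : xs ∈ S.signals) {N : ℕ}
    (hN : S.m0 ≤ N) (o : ℕ) {θ : ℝ} (hθ : 0 < θ)
    (hθN : 256 * (128000 * rateSq S N / S.sbar) ≤ θ ^ 2) :
    P {ω | θ ≤ ‖S.xHat N (drop o (obs S φ ξ xs ω)) - xs‖} ≤ ENNReal.ofReal (1 / 256) := by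
  have hm : Measurable fun ω => ENNReal.ofReal (‖S.xHat N (drop o (obs S φ ξ xs ω)) - xs‖ ^ 2) :=
    ((((hM.measurable_xHat hxs hN o).mono (hM.dataSigma_le _) le_rfl).sub_const
      xs).norm.pow_const 2).ennreal_ofReal
  have h1 := mul_meas_ge_le_lintegral (μ := P) hm (ENNReal.ofReal (θ ^ 2))
  have h2 := h1.trans (hM.lintegral_norm_xHat_le hxs hN o)
  have h3 : {ω | θ ≤ ‖S.xHat N (drop o (obs S φ ξ xs ω)) - xs‖} ⊆ {ω | ENNReal.ofReal (θ ^ 2)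
      ≤ ENNReal.ofReal (‖S.xHat N (drop o (obs S φ ξ xs ω)) - xs‖ ^ 2)} := fun ω hω =>
    ENNReal.ofReal_le_ofReal (pow_le_pow_left₀ hθ.le hω 2)
  have h4 : ENNReal.ofReal (θ ^ 2) * P {ω | θ ≤ ‖S.xHat N (drop o (obs S φ ξ xs ω)) - xs‖}
      ≤ ENNReal.ofReal (θ ^ 2) * ENNReal.ofReal (1 / 256) := by
    refine (mul_le_mul_right (measure_mono h3) _).trans (h2.trans ?_)
    rw [← ENNReal.ofReal_mul (by positivity)]
    exact ENNReal.ofReal_le_ofReal (by linarith)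
  exact (ENNReal.mul_le_mul_iff_right (by simpa using by positivity) ENNReal.ofReal_ne_top).1 h4

/-- The deterministic bound `5θ` excludes the event at `6θ`. Only monotonicity of the measure is
applied to this event, so the aggregate may be selected in a nonmeasurable way. -/
theorem measure_aggregate_ge_le (hM : Model S P φ ξ) {xs : Vec n} (hxs : xs ∈ S.signals)
    {N L : ℕ} (hL : 9 ≤ L) (hN : S.m0 ≤ N / L) {θ : ℝ} (hθ : 0 < θ)
    (hθN : 256 * (128000 * rateSq S (N / L) / S.sbar) ≤ θ ^ 2) {rule : Rule}
    {est : (ℕ → Obs n) → Vec n} (hest : ∀ d, IsAggregate (S.subSol N L d) (est d) rule) :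
    P {ω | ENNReal.ofReal (6 * θ) ≤ ENNReal.ofReal (l2 (est (obs S φ ξ xs ω) - xs))}
      ≤ ENNReal.ofReal (1 / 2 ^ L) := by
  have hblock : ∀ i j : Fin L, i ≠ j → Disjoint
      (Set.Ico (i * (N / L)) (i * (N / L) + N / L)) (Set.Ico (j * (N / L)) (j * (N / L) + N / L)) := by
    intro i j hij
    rw [Set.disjoint_left]
    rintro a ⟨h1, h2⟩ ⟨h3, h4⟩
    refine hij (Fin.ext ?_)
    have e1 : a / (N / L) = i := Nat.div_eq_of_lt_le h1 (by rw [add_mul, one_mul]; exact h2)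
    have e2 : a / (N / L) = j := Nat.div_eq_of_lt_le h3 (by rw [add_mul, one_mul]; exact h4)
    omega
  refine (measure_mono ?_).trans (hM.measure_many_bad_le (xs := xs) (θ := θ)
    (z := fun ω => S.subSol N L (obs S φ ξ xs ω))
    (fun l => hM.measurable_xHat hxs hN (l * (N / L))) hblock
    fun l => hM.measure_norm_xHat_ge_le hxs hN _ hθ hθN)
  intro ω hω
  by_contra hc
  have h1 := (hest (obs S φ ξ xs ω)).norm_sub_le hL (not_lt.1 hc) hθ
  have h2 : 6 * θ ≤ ‖est (obs S φ ξ xs ω) - xs‖ :=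
    (ENNReal.ofReal_le_ofReal_iff (norm_nonneg _)).1 hω
  linarith

theorem aggregate_mem (hM : Model S P φ ξ) {xs : Vec n} (hxs : xs ∈ S.signals) {N L : ℕ}
    (hL : 0 < L) {rule : Rule} {d : ℕ → Obs n} {x : Vec n}
    (hx : IsAggregate (S.subSol N L d) x rule) : x ∈ S.X :=
  hx.mem hM.closed hM.convex hL fun _ => hM.xHat_mem hxs _ _

end Model

end Amplification

/-! ### Risk bounds -/

theorem drop_zero {n : ℕ} (d : ℕ → Obs n) : drop 0 d = d := by
  ext1 i
  simp [drop]

section Risks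

variable {n : ℕ} {S : Params n} {Ω : Type*} [MeasurableSpace Ω] {P : Measure Ω}
  {φ : ℕ → Ω → Vec n} {ξ : ℕ → Ω → ℝ}

theorem risk_eq_zero_of_isEmpty (h : S.signals = ∅) (nrm : Vec n → ℝ)
    (est : (ℕ → Obs n) → Vec n) : risk S P φ ξ nrm est = 0 := by
  simp [risk, h]

theorem riskG_eq_zero_of_isEmpty (h : S.signals = ∅) (est : (ℕ → Obs n) → Vec n) :
    riskG S P φ ξ est = 0 := by
  simp [riskG, h]

theorem riskEps_eq_zero_of_isEmpty (h : S.signals = ∅) (nrm : Vec n → ℝ) (ε : ℝ)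
    (est : (ℕ → Obs n) → Vec n) : riskEps S P φ ξ nrm ε est = 0 :=
  nonpos_iff_eq_zero.1 (sInf_le (by simp [h]))

theorem risk_le_mul {nrm nrm' : Vec n → ℝ} {est est' : (ℕ → Obs n) → Vec n} {c : ℝ} (hc : 0 ≤ c)
    (h0 : ∀ x, 0 ≤ nrm x)
    (h : ∀ xs ∈ S.signals, ∀ d, nrm (est d - xs) ≤ c * nrm' (est' d - xs)) :
    risk S P φ ξ nrm est ≤ ENNReal.ofReal c * risk S P φ ξ nrm' est' := by
  refine iSup₂_le fun xs hxs => ?_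
  refine le_trans ?_ (mul_le_mul_right (le_iSup₂ (f := fun xs (_ : xs ∈ S.signals) =>
    (∫⁻ ω, ENNReal.ofReal (nrm' (est' (obs S φ ξ xs ω) - xs) ^ 2) ∂P) ^ (1 / 2 : ℝ)) xs hxs) _)
  have hsq : ENNReal.ofReal c = ENNReal.ofReal (c ^ 2) ^ (1 / 2 : ℝ) := by
    rw [ENNReal.ofReal_rpow_of_nonneg (by positivity) (by norm_num), ← Real.sqrt_eq_rpow,
      Real.sqrt_sq hc]
  rw [hsq, ← ENNReal.mul_rpow_of_nonneg _ _ (by norm_num),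
    ← lintegral_const_mul' _ _ ENNReal.ofReal_ne_top]
  refine ENNReal.rpow_le_rpow (lintegral_mono fun ω => ?_) (by norm_num)
  rw [← ENNReal.ofReal_mul (by positivity), ← mul_pow]
  exact ENNReal.ofReal_le_ofReal (pow_le_pow_left₀ (h0 _) (h xs hxs _) 2)

theorem riskEps_le_mul {nrm nrm' : Vec n → ℝ} {est est' : (ℕ → Obs n) → Vec n} {c ε : ℝ}
    (hc : 0 ≤ c) (h : ∀ xs ∈ S.signals, ∀ d, nrm (est d - xs) ≤ c * nrm' (est' d - xs)) :
    riskEps S P φ ξ nrm ε est ≤ ENNReal.ofReal c * riskEps S P φ ξ nrm' ε est' := by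
  -- The factor is zero when `s = 0`. The left error is then never positive, and every positive `r`
  -- is admissible.
  rcases hc.eq_or_lt with rfl | hc
  · rw [ENNReal.ofReal_zero, zero_mul]
    by_contra! hpos
    obtain ⟨r, hr, hr'⟩ := exists_between hpos
    refine hr'.not_ge (sInf_le fun xs hxs => ?_)
    have : {ω | r ≤ ENNReal.ofReal (nrm (est (obs S φ ξ xs ω) - xs))} = ∅ := by
      refine Set.eq_empty_of_forall_notMem fun ω hω => ?_
      have h1 := h xs hxs (obs S φ ξ xs ω)
      rw [zero_mul] at h1
      have hω' : r ≤ ENNReal.ofReal (nrm (est (obs S φ ξ xs ω) - xs)) := hω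
      rw [ENNReal.ofReal_of_nonpos h1] at hω'
      exact hr.not_ge hω'
    rw [this, measure_empty]
    exact zero_le
  have hc0 : ENNReal.ofReal c ≠ 0 := by simpa using hc
  have hc1 : ENNReal.ofReal c ≠ ⊤ := ENNReal.ofReal_ne_top
  rw [mul_comm, ← ENNReal.div_le_iff hc0 hc1]
  refine le_sInf fun r hr => ?_
  rw [ENNReal.div_le_iff hc0 hc1]
  refine sInf_le fun xs hxs => (measure_mono fun ω hω => ?_).trans (hr xs hxs)
  have h1 := (show r * ENNReal.ofReal c ≤ _ from hω).trans
    (ENNReal.ofReal_le_ofReal (h xs hxs (obs S φ ξ xs ω)))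
  rw [ENNReal.ofReal_mul hc.le, mul_comm] at h1
  exact (ENNReal.mul_le_mul_iff_right hc0 hc1).1 h1

/-- Chebyshev's inequality is used with a positive radius, while the rate may vanish; approaching
the bound from above covers this case. -/
theorem le_ofReal_of_forall_gt {a : ℝ≥0∞} {t : ℝ} (ht : 0 ≤ t)
    (h : ∀ r, t < r → a ≤ ENNReal.ofReal r) : a ≤ ENNReal.ofReal t := by
  by_contra! hlt
  obtain ⟨r, hr, hr'⟩ := exists_between hlt
  have hrt : r ≠ ⊤ := hr'.ne_top
  have h1 := h r.toReal ((ENNReal.ofReal_lt_iff_lt_toReal ht hrt).1 hr)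
  rw [ENNReal.ofReal_toReal hrt] at h1
  exact hr'.not_ge h1

namespace Model

theorem R_nonneg {xs : Vec n} (hxs : xs ∈ S.signals) : 0 ≤ S.R :=
  (l1_nonneg _).trans hxs.2.2

theorem rateSq_nonneg (hM : Model S P φ ξ) {xs : Vec n} (hxs : xs ∈ S.signals) (N : ℕ) :
    0 ≤ rateSq S N :=
  add_nonneg (by positivity) (hM.second_term_nonneg hxs N)

theorem sqrt_rateSq_le (hM : Model S P φ ξ) {xs : Vec n} (hxs : xs ∈ S.signals) (N : ℕ) :
    Real.sqrt (rateSq S N) ≤ S.R * Real.exp (-(N / (8000 * stageScale S)))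
      + S.sigma * S.sbar / S.kap * Real.sqrt (S.vk' * S.nu * Real.log n / N) := by
  have hR := R_nonneg hxs
  have hk := hM.kap_pos
  have hs := hM.one_le_sbar
  have hsig := hM.sigma_nonneg
  have hnu := hM.nu_pos hxs
  have hvk' := hM.one_le_vk'
  have hl := one_lt_log hM.dim
  refine Real.sqrt_le_iff.2 ⟨by positivity, ?_⟩
  have h1 : (S.R * Real.exp (-(N / (8000 * stageScale S)))) ^ 2
      = S.R ^ 2 * Real.exp (-(N / (4000 * stageScale S))) := by
    rw [mul_pow, ← Real.exp_nat_mul]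
    congr 2
    push_cast
    rw [show 8000 * stageScale S = 4000 * stageScale S * 2 by ring, ← div_div]
    ring
  have h2 : (S.sigma * S.sbar / S.kap * Real.sqrt (S.vk' * S.nu * Real.log n / N)) ^ 2
      = S.sbar ^ 2 * S.nu * S.sigma ^ 2 * S.vk' * Real.log n / (S.kap ^ 2 * N) := by
    rw [mul_pow, Real.sq_sqrt (by positivity), div_pow, div_mul_div_comm]
    congr 1
    ring
  unfold rateSq
  rw [← h1, ← h2, add_sq]
  have : 0 ≤ 2 * (S.R * Real.exp (-(N / (8000 * stageScale S))))
      * (S.sigma * S.sbar / S.kap * Real.sqrt (S.vk' * S.nu * Real.log n / N)) := by positivity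
  linarith

/-- The factor `s` from sparsity cancels against `s̄`, and `506² ≥ 256000`. -/
theorem sqrt_mul_sqrt_le (hM : Model S P φ ξ) {xs : Vec n} (hxs : xs ∈ S.signals) (N : ℕ) :
    Real.sqrt (2 * S.s) * Real.sqrt (128000 * rateSq S N / S.sbar)
      ≤ 506 * Real.sqrt (rateSq S N) := by
  have hs := hM.one_le_sbar
  have hsl := hM.s_le
  have hr := hM.rateSq_nonneg hxs N
  rw [← Real.sqrt_mul (by positivity)]
  refine Real.sqrt_le_iff.2 ⟨by positivity, ?_⟩
  rw [mul_pow, Real.sq_sqrt hr]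
  have h1 : (S.s : ℝ) / S.sbar ≤ 1 := by rw [div_le_one (by linarith)]; exact hsl
  calc _ = S.s / S.sbar * (256000 * rateSq S N) := by ring
    _ ≤ 1 * (256000 * rateSq S N) := by gcongr
    _ ≤ _ := by linarith

theorem risk_l2_xHat_le (hM : Model S P φ ξ) {N : ℕ} (hN : S.m0 ≤ N) :
    risk S P φ ξ l2 (S.xHat N)
      ≤ ENNReal.ofReal (Real.sqrt (128000 * rateSq S N / S.sbar)) := by
  refine iSup₂_le fun xs hxs => ?_
  have hs := hM.one_le_sbar
  have hr := hM.rateSq_nonneg hxs N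
  have h := hM.lintegral_norm_xHat_le hxs hN 0
  simp only [drop_zero] at h
  rw [Real.sqrt_eq_rpow, ← ENNReal.ofReal_rpow_of_nonneg (by positivity) (by norm_num)]
  exact ENNReal.rpow_le_rpow h (by norm_num)

theorem riskG_xHat_le (hM : Model S P φ ξ) {N : ℕ} (hN : S.m0 ≤ N) :
    riskG S P φ ξ (S.xHat N)
      ≤ ENNReal.ofReal (S.kap / (16 * S.sbar) * (1024000 * rateSq S N)) := by
  refine iSup₂_le fun xs hxs => ?_
  have h := hM.lintegral_gap_xHat_le hxs hN 0
  simpa only [drop_zero] using h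

/-- Here `96 = 6 · 16`, with 16 from Chebyshev's inequality at level `1/256` and 6 from the
aggregation. -/
theorem riskEps_aggregate_le (hM : Model S P φ ξ) {xs : Vec n} (hxs : xs ∈ S.signals)
    {N L : ℕ} (hL : 9 ≤ L) (hN : S.m0 ≤ N / L) {ε : ℝ} (hε : 1 / 2 ^ L ≤ ε) {rule : Rule}
    {est : (ℕ → Obs n) → Vec n} (hest : ∀ d, IsAggregate (S.subSol N L d) (est d) rule) :
    riskEps S P φ ξ l2 ε est
      ≤ ENNReal.ofReal (96 * Real.sqrt (128000 * rateSq S (N / L) / S.sbar)) := by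
  have hs := hM.one_le_sbar
  have hr := hM.rateSq_nonneg hxs (N / L)
  refine le_ofReal_of_forall_gt (by positivity) fun r hrt => sInf_le fun xs' hxs' => ?_
  have h0 : 0 ≤ Real.sqrt (128000 * rateSq S (N / L) / S.sbar) := Real.sqrt_nonneg _
  have hθ : 0 < r / 6 := by linarith
  have h1 := hM.measure_aggregate_ge_le hxs' hL hN hθ (by
    have h2 : 16 * Real.sqrt (128000 * rateSq S (N / L) / S.sbar) ≤ r / 6 := by linarith
    have h3 := pow_le_pow_left₀ (by positivity) h2 2
    rw [mul_pow, Real.sq_sqrt (by positivity)] at h3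
    linarith) hest
  rw [show 6 * (r / 6) = r by ring] at h1
  exact h1.trans (ENNReal.ofReal_le_ofReal hε)

end Model

end Risks

/-! ### The main statement -/

section Main

variable {n : ℕ} {S : Params n} {Ω : Type*} [MeasurableSpace Ω] {P : Measure Ω}
  {φ : ℕ → Ω → Vec n} {ξ : ℕ → Ω → ℝ}

namespace Model

theorem exponent_eq (c N : ℝ) : c * N * (S.uLow * S.kappaSigma)
    / (S.vk * S.sbar * S.nu * Real.log n) = c * N / stageScale S := by
  unfold stageScale Params.kap
  rw [div_div_eq_mul_div]

theorem exponent_eps_eq (c N l : ℝ) : c * N * (S.uLow * S.kappaSigma)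
    / (S.vk * S.sbar * S.nu * l * Real.log n) = c * N / (stageScale S * l) := by
  rw [show S.vk * S.sbar * S.nu * l * Real.log n = S.vk * S.sbar * S.nu * Real.log n * l by ring,
    ← div_div, exponent_eq, div_div]

theorem smd_sr_risks (hM : Model S P φ ξ) {N : ℕ} (hN : S.m0 ≤ N) :
    risk S P φ ξ l1 (S.yHat N)
        ≤ ENNReal.ofReal (2 * Real.sqrt (2 * S.s)) * risk S P φ ξ l2 (S.xHat N) ∧
    ENNReal.ofReal (2 * Real.sqrt (2 * S.s)) * risk S P φ ξ l2 (S.xHat N)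
        ≤ ENNReal.ofReal (400000 * (S.R * Real.exp (-(1 / 112000 * N * (S.uLow * S.kappaSigma)
              / (S.vk * S.sbar * S.nu * Real.log n)))
            + S.sigma * S.sbar / (S.uLow * S.kappaSigma)
              * Real.sqrt (S.vk' * S.nu * Real.log n / N))) ∧
    riskG S P φ ξ (S.xHat N)
        ≤ ENNReal.ofReal (400000 * (S.uLow * S.kappaSigma * S.R ^ 2 / S.sbar
              * Real.exp (-(1 / 112000 * N * (S.uLow * S.kappaSigma)
                / (S.vk * S.sbar * S.nu * Real.log n)))
            + S.nu * S.sigma ^ 2 * S.sbar * S.vk' * Real.log n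
              / (S.uLow * S.kappaSigma * N))) := by
  -- Without signals all risks are zero. A signal is needed below, since positivity of `ν` and `R ≥
  -- 0` are derived from it.
  rcases S.signals.eq_empty_or_nonempty with hemp | ⟨xs, hxs⟩
  · simp only [risk_eq_zero_of_isEmpty hemp, riskG_eq_zero_of_isEmpty hemp, mul_zero]
    exact ⟨le_rfl, zero_le, zero_le⟩
  have hk := hM.kap_pos
  have hs := hM.one_le_sbar
  have hnu := hM.nu_pos hxs
  have hvk' := hM.one_le_vk'
  have hl := one_lt_log hM.dim
  have hR := R_nonneg hxs
  have hsig := hM.sigma_nonneg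
  have hq := hM.one_le_stageScale hxs
  have hN0 : (0 : ℝ) < N := by exact_mod_cast (hM.m0_pos hxs).trans_le hN
  have hexp : ∀ a : ℝ, 0 < a → a ≤ 112000 → Real.exp (-(N / (a * stageScale S)))
      ≤ Real.exp (-(1 / 112000 * N / stageScale S)) := by
    intro a ha ha'
    refine Real.exp_le_exp.2 (neg_le_neg ?_)
    rw [show 1 / 112000 * (N : ℝ) / stageScale S = N / (112000 * stageScale S) by ring]
    gcongr
  refine ⟨?_, ?_, ?_⟩
  · refine risk_le_mul (by positivity) l1_nonneg fun xs' hxs' d => ?_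
    rw [hM.yHat_eq hxs hN]
    exact hM.l1_sp_sub_le_two_mul hxs' (hM.xHat_mem hxs N d)
  · refine (mul_le_mul_right (hM.risk_l2_xHat_le hN) _).trans ?_
    rw [← ENNReal.ofReal_mul (by positivity), exponent_eq]
    refine ENNReal.ofReal_le_ofReal ?_
    have h1 := hM.sqrt_mul_sqrt_le hxs N
    have h2 := hM.sqrt_rateSq_le hxs N
    have h3 := mul_le_mul_of_nonneg_left (hexp 8000 (by norm_num) (by norm_num)) hR
    have h4 : 0 ≤ S.R * Real.exp (-(1 / 112000 * N / stageScale S)) := by positivity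
    have h5 : 0 ≤ S.sigma * S.sbar / S.kap * Real.sqrt (S.vk' * S.nu * Real.log n / N) := by
      positivity
    change _ ≤ 400000 * (_ + S.sigma * S.sbar / S.kap * _)
    linarith
  · refine (hM.riskG_xHat_le hN).trans (ENNReal.ofReal_le_ofReal ?_)
    rw [exponent_eq]
    change _ ≤ 400000 * (S.kap * S.R ^ 2 / S.sbar * _ + _ / (S.kap * N))
    have h3 := mul_le_mul_of_nonneg_left (hexp 4000 (by norm_num) (by norm_num))
      (by positivity : 0 ≤ S.kap * S.R ^ 2 / S.sbar)
    have e : S.kap / (16 * S.sbar) * (1024000 * rateSq S N)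
        = 64000 * (S.kap * S.R ^ 2 / S.sbar * Real.exp (-(N / (4000 * stageScale S)))
          + S.nu * S.sigma ^ 2 * S.sbar * S.vk' * Real.log n / (S.kap * N)) := by
      unfold rateSq
      field_simp
      ring
    have h4 : 0 ≤ S.kap * S.R ^ 2 / S.sbar * Real.exp (-(1 / 112000 * N / stageScale S)) := by
      positivity
    have h5 : 0 ≤ S.nu * S.sigma ^ 2 * S.sbar * S.vk' * Real.log n / (S.kap * N) := by positivity
    rw [e]
    linarith

theorem reliable_risks (hM : Model S P φ ξ) {rule : Rule} {ε : ℝ} (hε : 0 < ε) (hε4 : ε ≤ 1 / 4)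
    {N : ℕ} (hN : 7 * S.m0 * Real.log (1 / ε) ≤ N) {est : (ℕ → Obs n) → Vec n}
    (hest : ∀ d, IsAggregate (S.subSol N ⌈6 * Real.log (1 / ε)⌉₊ d) (est d) rule) :
    riskEps S P φ ξ l1 ε (fun d => S.sp (est d))
        ≤ ENNReal.ofReal (Real.sqrt (2 * S.s)) * riskEps S P φ ξ l2 ε (fun d => S.sp (est d)) ∧
    ENNReal.ofReal (Real.sqrt (2 * S.s)) * riskEps S P φ ξ l2 ε (fun d => S.sp (est d))
        ≤ ENNReal.ofReal (2 * Real.sqrt (2 * S.s)) * riskEps S P φ ξ l2 ε est ∧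
    ENNReal.ofReal (2 * Real.sqrt (2 * S.s)) * riskEps S P φ ξ l2 ε est
        ≤ ENNReal.ofReal (400000 * (S.R * Real.exp (-(1 / 112000 * N * (S.uLow * S.kappaSigma)
              / (S.vk * S.sbar * S.nu * Real.log (1 / ε) * Real.log n)))
            + S.sigma * S.sbar / (S.uLow * S.kappaSigma)
              * Real.sqrt (S.vk' * S.nu * Real.log (1 / ε) * Real.log n / N))) := by
  rcases S.signals.eq_empty_or_nonempty with hemp | ⟨xs, hxs⟩
  · simp only [riskEps_eq_zero_of_isEmpty hemp, mul_zero]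
    exact ⟨le_rfl, le_rfl, zero_le⟩
  have hk := hM.kap_pos
  have hs := hM.one_le_sbar
  have hnu := hM.nu_pos hxs
  have hvk' := hM.one_le_vk'
  have hl := one_lt_log hM.dim
  have hR := R_nonneg hxs
  have hsig := hM.sigma_nonneg
  have hq := hM.one_le_stageScale hxs
  have hm := hM.m0_pos hxs
  set l := Real.log (1 / ε) with hldef
  -- The restriction `ε ≤ 1/4` enters here: it gives `6l > 8`, hence `L ≥ 9`, and `L ≤ 6l + 1 ≤ 7l`.
  have hl4 : 1.38 < l := by
    have h1 : Real.log 4 ≤ l := Real.log_le_log (by norm_num) (by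
      rw [le_div_iff₀ hε]; linarith)
    have h2 : Real.log 4 = 2 * Real.log 2 := by
      rw [show (4 : ℝ) = 2 ^ 2 by norm_num, Real.log_pow]; norm_num
    linarith [Real.log_two_gt_d9]
  set L := ⌈6 * l⌉₊ with hLdef
  have hL9 : 9 ≤ L := by
    have : 8 < L := Nat.lt_ceil.2 (by push_cast; linarith)
    omega
  have hLle : (L : ℝ) ≤ 7 * l := by
    have := Nat.ceil_lt_add_one (by linarith : 0 ≤ 6 * l)
    linarith
  have hLge : 6 * l ≤ L := Nat.le_ceil _
  have hNL : S.m0 ≤ N / L := by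
    rw [Nat.le_div_iff_mul_le (by omega)]
    have h1 : (S.m0 : ℝ) * L ≤ N := by
      have := mul_le_mul_of_nonneg_left hLle (Nat.cast_nonneg (α := ℝ) S.m0)
      linarith
    exact_mod_cast h1
  have hεL : 1 / 2 ^ L ≤ ε := by
    refine (one_div_two_pow_le_exp (t := 2 * l) (by linarith)).trans (le_of_eq ?_)
    rw [mul_div_cancel_left₀ _ two_ne_zero, hldef, one_div, Real.log_inv, neg_neg, Real.exp_log hε]
  have hmem : ∀ d, est d ∈ S.X := fun d => hM.aggregate_mem hxs (by omega) (hest d)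
  refine ⟨?_, ?_, ?_⟩
  · exact riskEps_le_mul (by positivity) fun xs' hxs' d => hM.l1_sp_sub_le hxs' (hmem d)
  · have h1 : riskEps S P φ ξ l2 ε (fun d => S.sp (est d))
        ≤ ENNReal.ofReal 2 * riskEps S P φ ξ l2 ε est :=
      riskEps_le_mul (by norm_num) fun xs' hxs' d => hM.norm_sp_sub_le hxs' (hmem d)
    refine (mul_le_mul_right h1 _).trans (le_of_eq ?_)
    rw [← mul_assoc, ← ENNReal.ofReal_mul (by positivity), mul_comm (Real.sqrt _)]
  · refine (mul_le_mul_right (hM.riskEps_aggregate_le hxs hL9 hNL hεL hest) _).trans ?_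
    rw [← ENNReal.ofReal_mul (by positivity), exponent_eps_eq]
    refine ENNReal.ofReal_le_ofReal ?_
    have hN'0 : (0 : ℝ) < (N / L : ℕ) := by exact_mod_cast hm.trans_le hNL
    -- Rounding `N/L` down costs a factor 2 and `L ≤ 7l`. The resulting 14 multiplies 8000 to give
    -- the constant 112000, and `√14 ≤ 4` is used for the second term.
    have hNN' : (N : ℝ) / (14 * l) ≤ (N / L : ℕ) := by
      rw [div_le_iff₀ (by positivity)]
      have h1 : N < L * (N / L + 1) := Nat.lt_mul_div_succ N (by omega)
      have h2 : N ≤ 2 * (L * (N / L)) := by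
        have : 1 ≤ N / L := hm.trans_le hNL
        nlinarith
      have h3 : (N : ℝ) ≤ 2 * (L * (N / L : ℕ)) := by exact_mod_cast h2
      have := mul_le_mul_of_nonneg_right hLle hN'0.le
      linarith
    have hN0 : (0 : ℝ) < N := by
      refine lt_of_lt_of_le ?_ hN
      have : (0 : ℝ) < S.m0 := by exact_mod_cast hm
      positivity
    have h1 := hM.sqrt_mul_sqrt_le hxs (N / L)
    have h2 := hM.sqrt_rateSq_le hxs (N / L)
    have h3 : Real.exp (-((N / L : ℕ) / (8000 * stageScale S)))
        ≤ Real.exp (-(1 / 112000 * N / (stageScale S * l))) := by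
      refine Real.exp_le_exp.2 (neg_le_neg ?_)
      calc 1 / 112000 * N / (stageScale S * l) = N / (14 * l) / (8000 * stageScale S) := by
            field_simp
            norm_num
        _ ≤ _ := by gcongr
    have h4 : Real.sqrt (S.vk' * S.nu * Real.log n / (N / L : ℕ))
        ≤ 4 * Real.sqrt (S.vk' * S.nu * l * Real.log n / N) := by
      refine Real.sqrt_le_iff.2 ⟨by positivity, ?_⟩
      rw [mul_pow, Real.sq_sqrt (by positivity)]
      calc S.vk' * S.nu * Real.log n / (N / L : ℕ)
          ≤ S.vk' * S.nu * Real.log n / (N / (14 * l)) := by gcongr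
        _ = 14 * (S.vk' * S.nu * l * Real.log n / N) := by field_simp
        _ ≤ 4 ^ 2 * (S.vk' * S.nu * l * Real.log n / N) := by gcongr; norm_num
    have h5 := mul_le_mul_of_nonneg_left h3 hR
    have h6 := mul_le_mul_of_nonneg_left h4 (by positivity : 0 ≤ S.sigma * S.sbar / S.kap)
    have h7 : 0 ≤ S.R * Real.exp (-(1 / 112000 * N / (stageScale S * l))) := by positivity
    have h8 : 0 ≤ S.sigma * S.sbar / S.kap * Real.sqrt (S.vk' * S.nu * l * Real.log n / N) := by
      positivity
    change _ ≤ 400000 * (_ + S.sigma * S.sbar / S.kap * _)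
    -- The numerical constant is `2 · 96 · 506 · 4 = 388608`, which is below 400000.
    linarith

end Model

end Main

end SparseGLM

end

theorem proposition3 :
    ∃ (c C α : ℝ) (a : SparseGLM.Rule → ℝ), 0 < c ∧ 0 < C ∧ 0 < α ∧ (∀ r, 0 < a r) ∧
      ∀ (n : ℕ) (S : SparseGLM.Params n) (Ω : Type*) (_ : MeasurableSpace Ω)
        (P : MeasureTheory.Measure Ω) (φ : ℕ → Ω → SparseGLM.Vec n) (ξ : ℕ → Ω → ℝ),
        SparseGLM.Model S P φ ξ →
        -- (i) SMD-SR solutions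
        (∀ N : ℕ, S.m0 ≤ N →
          SparseGLM.risk S P φ ξ SparseGLM.l1 (S.yHat N)
              ≤ ENNReal.ofReal (2 * Real.sqrt (2 * S.s))
                * SparseGLM.risk S P φ ξ SparseGLM.l2 (S.xHat N) ∧
          ENNReal.ofReal (2 * Real.sqrt (2 * S.s))
                * SparseGLM.risk S P φ ξ SparseGLM.l2 (S.xHat N)
              ≤ ENNReal.ofReal (C * (S.R * Real.exp (-(c * N * (S.uLow * S.kappaSigma)
                    / (S.vk * S.sbar * S.nu * Real.log n)))
                  + S.sigma * S.sbar / (S.uLow * S.kappaSigma)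
                    * Real.sqrt (S.vk' * S.nu * Real.log n / N))) ∧
          SparseGLM.riskG S P φ ξ (S.xHat N)
              ≤ ENNReal.ofReal (C * (S.uLow * S.kappaSigma * S.R ^ 2 / S.sbar
                    * Real.exp (-(c * N * (S.uLow * S.kappaSigma)
                      / (S.vk * S.sbar * S.nu * Real.log n)))
                  + S.nu * S.sigma ^ 2 * S.sbar * S.vk' * Real.log n
                    / (S.uLow * S.kappaSigma * N)))) ∧
        -- (ii) median-type aggregates of `L = ⌈a ln(1/ε)⌉` SMD-SR solutions
        (∀ (rule : SparseGLM.Rule) (ε : ℝ), 0 < ε → ε ≤ 1 / 4 →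
          ∀ N : ℕ, α * S.m0 * Real.log (1 / ε) ≤ N →
          ∀ est : (ℕ → SparseGLM.Obs n) → SparseGLM.Vec n,
            (∀ d, SparseGLM.IsAggregate (S.subSol N ⌈a rule * Real.log (1 / ε)⌉₊ d)
              (est d) rule) →
          SparseGLM.riskEps S P φ ξ SparseGLM.l1 ε (fun d => S.sp (est d))
              ≤ ENNReal.ofReal (Real.sqrt (2 * S.s))
                * SparseGLM.riskEps S P φ ξ SparseGLM.l2 ε (fun d => S.sp (est d)) ∧
          ENNReal.ofReal (Real.sqrt (2 * S.s))
                * SparseGLM.riskEps S P φ ξ SparseGLM.l2 ε (fun d => S.sp (est d))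
              ≤ ENNReal.ofReal (2 * Real.sqrt (2 * S.s))
                * SparseGLM.riskEps S P φ ξ SparseGLM.l2 ε est ∧
          ENNReal.ofReal (2 * Real.sqrt (2 * S.s))
                * SparseGLM.riskEps S P φ ξ SparseGLM.l2 ε est
              ≤ ENNReal.ofReal (C * (S.R * Real.exp (-(c * N * (S.uLow * S.kappaSigma)
                    / (S.vk * S.sbar * S.nu * Real.log (1 / ε) * Real.log n)))
                  + S.sigma * S.sbar / (S.uLow * S.kappaSigma)
                    * Real.sqrt (S.vk' * S.nu * Real.log (1 / ε) * Real.log n / N)))) := by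
  refine ⟨1 / 112000, 400000, 7, fun _ => 6, by norm_num, by norm_num, by norm_num,
    fun _ => by norm_num, fun n S Ω _ P φ ξ hM => ⟨fun N hN => hM.smd_sr_risks hN,
      fun rule ε hε hε4 N hN est hest => hM.reliable_risks hε hε4 hN hest⟩⟩
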